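/- **Setting.** A *match* of a pattern $P$ with at most $k$ errors in a string $S$ is a position $j\in[1,|S|]$ such that for some $i\in[1,j]$ the edit distance (minimum number of insertions, deletions and substitutions) between $P$ and $S[i,j]$ is at most $k$. A *ZL78 compressed string* of length $n$ is $Z=(r_1,\alpha_1)\cdots(r_n,\alpha_n)$ with $r_i\in\{0,\dots,i-1\}$ and characters $\alpha_i$; with $\mathrm{phrase}(0)=\epsilon$ and $\mathrm{phrase}(i)=\mathrm{phrase}(r_i)\cdot\alpha_i$, it represents $Q=\mathrm{phrase}(1)\cdots\mathrm{phrase}(n)$. A *ZLW compressed string* of length $n$ is a sequence of $n$ codes. Each code is either a character of the alphabet $\{0,\dots,\sigma-1\}$, whose phrase is this character, or refers to an earlier step $j$, and its phrase is then the $j$-th phrase followed by the first character of the $(j+1)$-st phrase; it represents the concatenation of its $n$ phrases. Algorithms are programs for a word RAM. Input is read-only and output is write-only; time is the number of executed instructions and tests; space is the number of words of working memory, where the initial contents of this memory are arbitrary; a random word is available as one instruction. A program has to work for all word lengths $w$ of at least a constant times the logarithm of the input length (and of the required space); this constant may depend on the program. All characters and numbers in the input fit into one word. **Theorem.** Let $A$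 be any algorithm for the uncompressed approximate string matching problem, which for every pattern of length $m$, text of length $u$ and threshold $k<m$ outputs all matches in sorted order in worst-case time $t(m,u,k)$ and space $s(m,u,k)$. There is an algorithm $B$ which, given a ZL78 compressed string $Z$ of length $n\ge 1$ representing $Q$, a pattern $P$ of length $m$, an error threshold $k<m$, and a parameter $\tau\ge 1$, outputs each match of $P$ in $Q$ with at most $k$ errors exactly once, in $$O\bigl(n(\tau+m+t(m,2m+2k,k))+\mathrm{occ}\bigr)\ \text{expected time and}\ O\bigl(n/\tau+m+s(m,2m+2k,k)+\mathrm{occ}\bigr)\ \text{space},$$ where $\mathrm{occ}$ is the number of these matches. The expectation is over the random words used by $B$ only; the output is always correct and the space bound always holds. With $O(n)$ additional space, that is, in $O(n+n/\tau+m+s(m,2m+2k,k)+\mathrm{occ})$ space, the same time bound holds in the worst case, both for ZL78 and for ZLW compressed strings. The constants in the $O$-bounds are absolute; they do not depend on $A$. -/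

import Mathlib

open MeasureTheory
open scoped ENNReal

/-! ## Edit distance and approximate matches -/

/-- One edit operation: an insertion, a deletion or a substitution of one character. -/
inductive EditStep {α : Type*} : List α → List α → Prop
  | insert (u v : List α) (a : α) : EditStep (u ++ v) (u ++ a :: v)
  | delete (u v : List α) (a : α) : EditStep (u ++ a :: v) (u ++ v)
  | subst (u v : List α) (a b : α) : EditStep (u ++ a :: v) (u ++ b :: v)

/-- `EditSeq d A B`: the string `A` is converted into `B` by a sequence of `d` edit operations. -/
inductive EditSeq {α : Type*} : ℕ → List α → List α → Prop
  | nil (A : List α) : EditSeq 0 A A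
  | cons {d : ℕ} {A B C : List α} : EditStep A B → EditSeq d B C → EditSeq (d + 1) A C

/-- The edit distance: the minimum number of edit operations that convert `A` into `B`. -/
noncomputable def editDistance {α : Type*} (A B : List α) : ℕ := sInf {d | EditSeq d A B}

/-- Every string can be converted into every other one, so the minimum above is attained. -/
theorem exists_editSeq {α : Type*} (A B : List α) : ∃ d, EditSeq d A B := by
  have hins : ∀ B : List α, ∀ C : List α, ∃ d, EditSeq d C (B ++ C) := by
    intro B C
    induction B using List.reverseRecOn generalizing C with
    | nil => exact ⟨0, EditSeq.nil C⟩
    | append_singleton B b ih =>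
      obtain ⟨d, hd⟩ := ih (b :: C)
      refine ⟨d + 1, EditSeq.cons (EditStep.insert [] C b) ?_⟩
      simpa using hd
  induction A with
  | nil => simpa using hins B []
  | cons a A ih =>
    obtain ⟨d, hd⟩ := ih
    exact ⟨d + 1, EditSeq.cons (EditStep.delete [] A a) hd⟩

/-- The substring `S[i, j]` with both ends included; positions are numbered from 1. -/
def substring {α : Type*} (S : List α) (i j : ℕ) : List α := (S.drop (i - 1)).take (j + 1 - i)

open Classical in
/-- The ending positions `j ∈ [1, |S|]` of the substrings `S[i, j]`, `i ∈ [1, j]`, whose edit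
distance to `P` is at most `k`. -/
noncomputable def matchSet {α : Type*} (k : ℕ) (P S : List α) : Finset ℕ :=
  (Finset.Icc 1 S.length).filter
    fun j => ∃ i ∈ Finset.Icc 1 j, editDistance P (substring S i j) ≤ k

/-! ## Compressed strings -/

/-- A ZL78 compressed string `(r₁, α₁) … (rₙ, αₙ)` with `rᵢ ∈ {0, …, i - 1}`. The element number
`i + 1` is `(ref i, label i)` for `i = 0, …, n - 1`; the element number `0` is the root. -/
structure ZL78 (α : Type*) where
  n : ℕ
  ref : Fin n → ℕ
  label : Fin n → α
  ref_le : ∀ i : Fin n, ref i ≤ i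

namespace ZL78

/-- The phrase of the element number `i`. -/
def phrase {α : Type*} (Z : ZL78 α) : (i : ℕ) → i ≤ Z.n → List α
  | 0, _ => []
  | i + 1, h =>
    Z.phrase (Z.ref ⟨i, h⟩) ((Z.ref_le ⟨i, h⟩).trans (Nat.le_of_succ_le h)) ++ [Z.label ⟨i, h⟩]
termination_by i => i
decreasing_by exact Nat.lt_succ_of_le (Z.ref_le ⟨i, h⟩)

/-- The represented string: the concatenation of the phrases of the elements `1, …, n`. -/
def text {α : Type*} (Z : ZL78 α) : List α :=
  (List.ofFn fun i : Fin Z.n => Z.phrase (i + 1) i.isLt).flatten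

end ZL78

/-- A ZLW compressed string over the alphabet `{0, …, alph - 1}`. The code number `i` (numbered
from 0) is either a character, or `alph + j` with `j < i`: this refers to the dictionary entry
created by the step `j`, namely the phrase number `j` followed by the first character of the
phrase number `j + 1`. -/
structure ZLW where
  alph : ℕ
  n : ℕ
  code : Fin n → ℕ
  code_lt : ∀ i : Fin n, code i < alph + i

namespace ZLW

/-- The first character of the phrase number `i`. -/
def first (Z : ZLW) (i : ℕ) (h : i < Z.n) : ℕ :=
  if hc : Z.code ⟨i, h⟩ < Z.alph then Z.code ⟨i, h⟩
  else Z.first (Z.code ⟨i, h⟩ - Z.alph)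
    (by have h' : Z.code ⟨i, h⟩ < Z.alph + i := Z.code_lt ⟨i, h⟩
        omega)
termination_by i
decreasing_by
  have h' : Z.code ⟨i, h⟩ < Z.alph + i := Z.code_lt ⟨i, h⟩
  omega

/-- The phrase number `i`. -/
def phrase (Z : ZLW) (i : ℕ) (h : i < Z.n) : List ℕ :=
  if hc : Z.code ⟨i, h⟩ < Z.alph then [Z.code ⟨i, h⟩]
  else Z.phrase (Z.code ⟨i, h⟩ - Z.alph)
      (by have h' : Z.code ⟨i, h⟩ < Z.alph + i := Z.code_lt ⟨i, h⟩
          omega) ++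
    [Z.first (Z.code ⟨i, h⟩ - Z.alph + 1)
      (by have h' : Z.code ⟨i, h⟩ < Z.alph + i := Z.code_lt ⟨i, h⟩
          omega)]
termination_by i
decreasing_by
  have h' : Z.code ⟨i, h⟩ < Z.alph + i := Z.code_lt ⟨i, h⟩
  omega

/-- The represented string: the concatenation of all phrases. -/
def text (Z : ZLW) : List ℕ := (List.ofFn fun i : Fin Z.n => Z.phrase i i.isLt).flatten

end ZLW

/-! ## The word RAM

Words have `w` bits. A program works on finitely many registers (those it names), a random access
working memory addressed by words, read-only input arrays, a write-only output stream and a source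
of random words. A program is independent of `w`. -/

/-- Arithmetic, logical and comparison operations on words. -/
inductive WordOp
  | add | sub | mul | div | mod | and | or | xor | shl | shr | eq | lt

/-- The value of an operation; arithmetic is modulo `2 ^ w`, truth values are `1` and `0`. -/
def WordOp.eval {w : ℕ} : WordOp → BitVec w → BitVec w → BitVec w
  | .add, x, y => x + y
  | .sub, x, y => x - y
  | .mul, x, y => x * y
  | .div, x, y => x / y
  | .mod, x, y => x % y
  | .and, x, y => x &&& y
  | .or, x, y => x ||| y
  | .xor, x, y => x ^^^ y
  | .shl, x, y => x <<< y
  | .shr, x, y => x >>> y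
  | .eq, x, y => if x = y then 1 else 0
  | .lt, x, y => if x < y then 1 else 0

/-- Elementary instructions. Numbers `d`, `a`, `b` name registers. -/
inductive Instr
  /-- `d := v` for a number `v` fixed in the program -/
  | const (d : ℕ) (v : ℕ)
  /-- `d := a o b` -/
  | op (o : WordOp) (d a b : ℕ)
  /-- `d := input array number i, at the address in a` -/
  | read (d i a : ℕ)
  /-- `d := working memory, at the address in a` -/
  | load (d a : ℕ)
  /-- `working memory, at the address in a, := b` -/
  | store (a b : ℕ)
  /-- `d := a fresh random word` -/
  | rand (d : ℕ)
  /-- append the contents of `a` to the output -/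
  | write (a : ℕ)

/-- Programs: instructions with sequencing, branching and loops. A test asks whether a register
is nonzero. -/
inductive Program
  | instr (e : Instr)
  | seq (p q : Program)
  | ite (a : ℕ) (p q : Program)
  | loop (a : ℕ) (p : Program)

/-- A configuration of the machine with `w`-bit words. -/
structure State (w : ℕ) where
  reg : ℕ → BitVec w
  input : ℕ → BitVec w → BitVec w
  mem : BitVec w → BitVec w
  /-- the random words that have not been used so far -/
  tape : ℕ → Fin (2 ^ w)
  output : List (BitVec w)
  /-- the number of words of working memory in use: one more than the largest address of the
  working memory accessed so far, or `0` if there was no access -/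
  space : ℕ

/-- The effect of an instruction. -/
def Instr.step {w : ℕ} : Instr → State w → State w
  | .const d v, σ => { σ with reg := Function.update σ.reg d (BitVec.ofNat w v) }
  | .op o d a b, σ => { σ with reg := Function.update σ.reg d (o.eval (σ.reg a) (σ.reg b)) }
  | .read d i a, σ => { σ with reg := Function.update σ.reg d (σ.input i (σ.reg a)) }
  | .load d a, σ =>
    { σ with
      reg := Function.update σ.reg d (σ.mem (σ.reg a))
      space := max σ.space ((σ.reg a).toNat + 1) }
  | .store a b, σ =>
    { σ with
      mem := Function.update σ.mem (σ.reg a) (σ.reg b)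
      space := max σ.space ((σ.reg a).toNat + 1) }
  | .rand d, σ =>
    { σ with
      reg := Function.update σ.reg d (BitVec.ofFin (σ.tape 0))
      tape := fun i => σ.tape (i + 1) }
  | .write a, σ => { σ with output := σ.output ++ [σ.reg a] }

/-- `Exec p σ T σ'`: started in `σ`, the program `p` halts in `σ'` after `T` steps. Every
instruction and every test of a branch or of a loop is one step. -/
inductive Exec {w : ℕ} : Program → State w → ℕ → State w → Prop
  | instr (e : Instr) (σ : State w) : Exec (.instr e) σ 1 (e.step σ)
  | seq {p q : Program} {σ σ' σ'' : State w} {T T' : ℕ} :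
      Exec p σ T σ' → Exec q σ' T' σ'' → Exec (.seq p q) σ (T + T') σ''
  | ite_true {a : ℕ} {p q : Program} {σ σ' : State w} {T : ℕ} :
      σ.reg a ≠ 0 → Exec p σ T σ' → Exec (.ite a p q) σ (T + 1) σ'
  | ite_false {a : ℕ} {p q : Program} {σ σ' : State w} {T : ℕ} :
      σ.reg a = 0 → Exec q σ T σ' → Exec (.ite a p q) σ (T + 1) σ'
  | loop_done {a : ℕ} {p : Program} {σ : State w} :
      σ.reg a = 0 → Exec (.loop a p) σ 1 σ
  | loop_next {a : ℕ} {p : Program} {σ σ' σ'' : State w} {T T' : ℕ} :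
      σ.reg a ≠ 0 → Exec p σ T σ' → Exec (.loop a p) σ' T' σ'' →
      Exec (.loop a p) σ (T + T' + 1) σ''

/-- The running time of `p` from `σ`; it is `⊤` if `p` does not halt. -/
noncomputable def runTime {w : ℕ} (p : Program) (σ : State w) : ℕ∞ :=
  ⨅ (T : ℕ) (_ : ∃ σ', Exec p σ T σ'), (T : ℕ∞)

/-- The distribution of a sequence of independent, uniformly distributed words. -/
noncomputable def randomTape (w : ℕ) : Measure (ℕ → Fin (2 ^ w)) :=
  Measure.infinitePi fun _ => (PMF.uniformOfFintype (Fin (2 ^ w))).toMeasure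

/-- The expected running time of `p` from `σ`, over the choice of the random words. -/
noncomputable def expectedTime {w : ℕ} (p : Program) (σ : State w) : ℝ≥0∞ :=
  ∫⁻ ω, (runTime p { σ with tape := ω } : ℝ≥0∞) ∂(randomTape w)

/-- `σ` is an initial configuration with the numbers `nums` in the registers `0, 1, …` and the
strings `arrays` in the input arrays `0, 1, …`. Nothing is assumed about the other registers, the
initial contents of the working memory, or the input arrays beyond the ends of the strings. -/
def Loaded {w : ℕ} (σ : State w) (nums : List ℕ) (arrays : List (List (BitVec w))) : Prop :=
  σ.output = [] ∧ σ.space = 0 ∧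
  (∀ (r : ℕ) (h : r < nums.length), σ.reg r = BitVec.ofNat w nums[r]) ∧
  ∀ (a : ℕ) (h : a < arrays.length) (i : ℕ) (hi : i < arrays[a].length),
    σ.input a (BitVec.ofNat w i) = arrays[a][i]

/-- From `σ`, with its given random words, `p` halts within `T` steps and `S` words of working
memory, and its output has the property `R`. -/
def RunsWithin {w : ℕ} (p : Program) (σ : State w) (T S : ℕ) (R : List ℕ → Prop) : Prop :=
  ∃ T' σ', Exec p σ T' σ' ∧ T' ≤ T ∧ σ'.space ≤ S ∧ R (σ'.output.map BitVec.toNat)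

/-- From `σ`, the expected running time of `p` is at most `T` (so that `p` halts almost surely),
and whenever `p` halts, it has used at most `S` words of working memory and its output has the
property `R`. -/
def RunsWithinExpected {w : ℕ} (p : Program) (σ : State w) (T S : ℕ) (R : List ℕ → Prop) : Prop :=
  expectedTime p σ ≤ (T : ℝ≥0∞) ∧
  ∀ (ω : ℕ → Fin (2 ^ w)) (T' : ℕ) (σ' : State w), Exec p { σ with tape := ω } T' σ' →
    σ'.space ≤ S ∧ R (σ'.output.map BitVec.toNat)

/-- The list `l` names each element of `F` exactly once, and nothing else. -/
def ListsExactly (l : List ℕ) (F : Finset ℕ) : Prop := l.Nodup ∧ l.toFinset = F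

/-- `A` solves the uncompressed approximate string matching problem (with `k < m`) in worst-case
time `t m u k` and space `s m u k` for patterns of length `m`, texts of length `u` and error
threshold `k`, on words of at least `κ * log₂ (m + u + 1)` bits, and outputs the matches in
increasing order. -/
def SolvesMatching (A : Program) (κ : ℕ) (t s : ℕ → ℕ → ℕ → ℕ) : Prop :=
  ∀ (w : ℕ) (P S : List (BitVec w)) (k : ℕ), k < P.length →
    (P.length + S.length + 1) ^ κ ≤ 2 ^ w →
    ∀ σ : State w, Loaded σ [P.length, S.length, k] [P, S] →
      RunsWithin A σ (t P.length S.length k) (s P.length S.length k)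
        fun l => l = (matchSet k P S).sort (· ≤ ·)

/-- The two input arrays that hold a ZL78 compressed string: references and labels. -/
def ZL78.arrays {w : ℕ} (Z : ZL78 (BitVec w)) : List (List (BitVec w)) :=
  [List.ofFn fun i => BitVec.ofNat w (Z.ref i), List.ofFn Z.label]

/-- The input array that holds a ZLW compressed string. -/
def ZLW.array (Z : ZLW) (w : ℕ) : List (BitVec w) := List.ofFn fun i => BitVec.ofNat w (Z.code i)

/-!
# Approximate matching in ZL78 and ZLW compressed strings

The algorithm uses no random words of its own, and the bound on the expected time holds because the
worst case time satisfies it. It rests on the following observations. Let `D = m + k`, which bounds the length of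
any substring that matches. The phrases of a ZL78 compressed string are the nodes of a trie, with
the phrase of a node spelled out on the path from the root.

* Matches that end within the first `D` characters of a phrase depend only on these characters and
  the last `D` characters of the text before the phrase (`Env.mem_matchSet_window`). One call of the
  given algorithm `A` on a text of length `2 * D = 2 * m + 2 * k` finds them. The buffer holding
  that window is updated from phrase to phrase in `O(D)` steps.
* Matches that end at a later position of a phrase lie inside the phrase (`endsMatch_append`). They
  end where an ancestor of depth more than `D` ends; whether a match ends there depends only on the
  last `D` characters of that ancestor's own phrase (`Env.mem_matchSet_suffix`), and so one call of
  `A` per node finds the nodes with this property, which are called flagged. A flagged node is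
  itself a phrase of the text with a match at its end, and hence there are at most `occ` flagged
  nodes (`Env.flags_le_card`). They can all be stored, each with a link to the next flagged ancestor
  (`ChainTable`), and following the links from the nearest flagged ancestor of a phrase takes time
  proportional to the number of matches that are output.

`Env.listsExactly_succ` combines both kinds of matches. What remains is to find, for every node,
its depth, its nearest flagged ancestor, and its ancestor of depth `D`, from which the first `D`
characters of the phrase are read off (`Env.near_depthMark`). Only `O(n / τ)` words are available
for this, and walking up the trie takes too long. The nodes are therefore divided into at most `τ`
blocks of `b = n / τ + 1` consecutive nodes. The questions for the nodes of one block are answered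
together by passing through this block and all preceding ones in descending order
(`wp_answerQueries`): as references point backwards, a table computed in one scan of a block tells
for each of its nodes the first ancestor outside of the block, the distance to it, and the nearest
marked ancestor on the way; this moves all questions below the block. Every pass through all blocks
takes `O(n)` steps, and altogether this is `O(n * τ)`.

A ZLW compressed string is turned into the references and characters of a ZL78 compressed string
with the same phrases, which takes `O(n)` additional words, and then the same search is run.

The program for the word RAM is obtained by compiling a small structured language of loops,
variables and arrays of natural numbers, which has `A` as a primitive. Its commands come with
weakest preconditions that also keep account of the time (`Cmd.wp`). `Cmd.exec_compile` shows that
the compiled program does what they promise; it embeds `A` as a subroutine, with the memory of `A`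
in an array and at most five steps for each step of `A`.
-/

/-! ### A structured language over natural numbers, compiled to the word RAM -/

/-- Binary operations of the structured language; on words they are exact only under
`BinOp.Safe`. -/
inductive BinOp
  | add | sub | mul | div | lt | eq

namespace BinOp

/-- The word operation that implements the operation. -/
def word : BinOp → WordOp
  | add => .add
  | sub => .sub
  | mul => .mul
  | div => .div
  | lt => .lt
  | eq => .eq

/-- The value on natural numbers. -/
def eval : BinOp → ℕ → ℕ → ℕ
  | add, x, y => x + y
  | sub, x, y => x - y
  | mul, x, y => x * y
  | div, x, y => x / y
  | lt, x, y => if x < y then 1 else 0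
  | eq, x, y => if x = y then 1 else 0

/-- No overflow on words of `w` bits. -/
def Safe (w : ℕ) : BinOp → ℕ → ℕ → Prop
  | add, x, y => x + y < 2 ^ w
  | sub, x, y => y ≤ x
  | mul, x, y => x * y < 2 ^ w
  | _, _, _ => True

theorem toNat_word {w : ℕ} (hw : 1 < 2 ^ w) (o : BinOp) (x y : BitVec w)
    (h : o.Safe w x.toNat y.toNat) :
    (o.word.eval x y).toNat = o.eval x.toNat y.toNat := by
  have h1 : (1 : BitVec w).toNat = 1 := by
    simpa using Nat.mod_eq_of_lt hw
  cases o <;> simp only [word, eval, WordOp.eval, Safe] at *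
  · rw [BitVec.toNat_add, Nat.mod_eq_of_lt h]
  · exact BitVec.toNat_sub_of_le (BitVec.le_def.2 h)
  · rw [BitVec.toNat_mul, Nat.mod_eq_of_lt h]
  · simp
  · have hlt : x < y ↔ x.toNat < y.toNat := BitVec.lt_def
    by_cases hxy : x.toNat < y.toNat
    · rw [if_pos (hlt.2 hxy), if_pos hxy, h1]
    · rw [if_neg (mt hlt.1 hxy), if_neg hxy]; simp
  · have heq : x = y ↔ x.toNat = y.toNat := BitVec.toNat_inj.symm
    by_cases hxy : x.toNat = y.toNat
    · rw [if_pos (heq.2 hxy), if_pos hxy, h1]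
    · rw [if_neg (mt heq.1 hxy), if_neg hxy]; simp

end BinOp

/-- Expressions of the structured language. `ref` and `chr` read the compressed string, `get a e`
reads the element `e` of the array `a`. -/
inductive Ex
  | var (r : ℕ)
  | lit (c : ℕ)
  | bin (o : BinOp) (e f : Ex)
  | get (a : ℕ) (e : Ex)
  | ref (e : Ex)
  | chr (e : Ex)

/-- Commands of the structured language. `rep r e c` runs `c` with `r = 0, …, e - 1`, where `e` is
evaluated once; `call a r` runs the given matching algorithm on the text in the array `a` and puts
the number of its matches into `r`. -/
inductive Cmd
  | skip
  | set (r : ℕ) (e : Ex)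
  | put (a : ℕ) (i x : Ex)
  | out (e : Ex)
  | seq (c d : Cmd)
  | ite (e : Ex) (c d : Cmd)
  | rep (r : ℕ) (e : Ex) (c : Cmd)
  | call (a r : ℕ)

/-- States of the structured language: variables, arrays, output, and a counter that bounds the
number of executed instructions. -/
@[ext] structure VS where
  reg : ℕ → ℕ
  arr : ℕ → ℕ → ℕ
  out : List ℕ
  time : ℕ

/-- What a command may rely on. Arrays have `L` elements; the arrays `vis, …, 31` are read-only,
with the contents `hid`. The compressed string has `n` elements, given by `ref` and `chr`, which are
stored in the hidden arrays `30` and `31` (if `stored`) or in the input arrays `0` and `1`. The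
pattern `P`, the threshold `k` and the time bound `callTime` belong to the matching algorithm. -/
structure Env (w : ℕ) where
  L : ℕ
  vis : ℕ
  stored : Bool
  n : ℕ
  ref : ℕ → ℕ
  chr : ℕ → ℕ
  inp : ℕ → BitVec w → BitVec w
  hid : ℕ → ℕ → ℕ
  P : List (BitVec w)
  k : ℕ
  callTime : ℕ

namespace Ex

variable {w : ℕ}

/-- The value in the environment `E` and the state `v`. -/
def eval (E : Env w) (v : VS) : Ex → ℕ
  | var r => v.reg r
  | lit c => c
  | bin o e f => o.eval (e.eval E v) (f.eval E v)
  | get a e => v.arr a (e.eval E v)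
  | ref e => E.ref (e.eval E v)
  | chr e => E.chr (e.eval E v)

/-- The evaluation does not overflow and stays within the arrays. -/
def Safe (E : Env w) (v : VS) : Ex → Prop
  | var _ => True
  | lit c => c < 2 ^ w
  | bin o e f => e.Safe E v ∧ f.Safe E v ∧ o.Safe w (e.eval E v) (f.eval E v)
  | get a e => e.Safe E v ∧ a < E.vis ∧ e.eval E v < E.L
  | ref e => e.Safe E v ∧ e.eval E v < E.n
  | chr e => e.Safe E v ∧ e.eval E v < E.n

/-- An upper bound on the number of instructions. -/
def cost : Ex → ℕ
  | var _ => 1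
  | lit _ => 1
  | bin _ e f => e.cost + (f.cost + 1)
  | get _ e => e.cost + 5
  | ref e => e.cost + 5
  | chr e => e.cost + 5

end Ex

namespace Cmd

variable {w : ℕ}

/-- The weakest precondition of a loop whose body has the weakest precondition `f`; `N` iterations
are left and `j` have been done. -/
def wpRep (f : VS → (VS → Prop) → Prop) (r : ℕ) : ℕ → ℕ → VS → (VS → Prop) → Prop
  | 0, _, v, Q => Q v
  | N + 1, j, v, Q =>
    f { v with reg := Function.update v.reg r j, time := v.time + 5 }
      fun u => wpRep f r N (j + 1) u Q

/-- The sorted list of matches of the pattern in the text stored in the array `a`. -/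
noncomputable def matchesIn (E : Env w) (v : VS) (a : ℕ) : List ℕ :=
  (matchSet E.k E.P
    ((List.range (2 * E.P.length + 2 * E.k)).map fun i => BitVec.ofNat w (v.arr a i))).sort
    (· ≤ ·)

/-- Weakest preconditions. The variables `1`, `2` and `7` have to hold the pattern length, the
threshold and the text length at every call; a call stores the matches in the array `2` and destroys
the array `3`. -/
def wp (E : Env w) : Cmd → VS → (VS → Prop) → Prop
  | skip, v, Q => Q { v with time := v.time + 1 }
  | set r e, v, Q =>
    e.Safe E v ∧
      Q { v with reg := Function.update v.reg r (e.eval E v), time := v.time + (e.cost + 1) }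
  | put a i x, v, Q =>
    i.Safe E v ∧ x.Safe E v ∧ a < E.vis ∧ i.eval E v < E.L ∧
      Q { v with
          arr := Function.update v.arr a (Function.update (v.arr a) (i.eval E v) (x.eval E v))
          time := v.time + (i.cost + x.cost + 5) }
  | out e, v, Q =>
    e.Safe E v ∧ Q { v with out := v.out ++ [e.eval E v], time := v.time + (e.cost + 1) }
  | seq c d, v, Q => c.wp E v fun u => d.wp E u Q
  | ite e c d, v, Q =>
    e.Safe E v ∧
      (e.eval E v ≠ 0 → c.wp E { v with time := v.time + (e.cost + 1) } Q) ∧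
      (e.eval E v = 0 → d.wp E { v with time := v.time + (e.cost + 1) } Q)
  | rep r e c, v, Q =>
    e.Safe E v ∧
      wpRep (fun u Q => c.wp E u Q) r (e.eval E v) 0 { v with time := v.time + (e.cost + 3) } Q
  | call a r, v, Q =>
    a < E.vis ∧ a ≠ 2 ∧ a ≠ 3 ∧
    v.reg 1 = E.P.length ∧ v.reg 2 = E.k ∧ v.reg 7 = 2 * E.P.length + 2 * E.k ∧
    ∀ f : ℕ → ℕ → ℕ,
      (∀ (i : ℕ) (h : i < (matchesIn E v a).length), f 2 i = (matchesIn E v a)[i]) →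
      (∀ a', a' ≠ 2 → a' ≠ 3 → f a' = v.arr a') →
      Q { v with
          reg := Function.update v.reg r (matchesIn E v a).length
          arr := f
          time := v.time + E.callTime }

theorem wp_mono (E : Env w) (c : Cmd) : ∀ {v : VS} {Q R : VS → Prop},
    c.wp E v Q → (∀ u, Q u → R u) → c.wp E v R := by
  induction c with
  | skip => intro v Q R h hQ; exact hQ _ h
  | set r e => intro v Q R h hQ; exact ⟨h.1, hQ _ h.2⟩
  | put a i x => intro v Q R h hQ; exact ⟨h.1, h.2.1, h.2.2.1, h.2.2.2.1, hQ _ h.2.2.2.2⟩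
  | out e => intro v Q R h hQ; exact ⟨h.1, hQ _ h.2⟩
  | seq c d ihc ihd => intro v Q R h hQ; exact ihc h fun u hu => ihd hu hQ
  | ite e c d ihc ihd =>
    intro v Q R h hQ
    exact ⟨h.1, fun he => ihc (h.2.1 he) hQ, fun he => ihd (h.2.2 he) hQ⟩
  | rep r e c ih =>
    intro v Q R h hQ
    refine ⟨h.1, ?_⟩
    have aux : ∀ (N j : ℕ) (v : VS), wpRep (fun u Q => c.wp E u Q) r N j v Q →
        wpRep (fun u Q => c.wp E u Q) r N j v R := by
      intro N
      induction N with
      | zero => intro j v h; exact hQ _ h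
      | succ N ihN => intro j v h; exact ih h fun u hu => ihN _ _ hu
    exact aux _ _ _ h.2
  | call a r =>
    intro v Q R h hQ
    obtain ⟨h1, h2, h3, h4, h5, h6, h7⟩ := h
    exact ⟨h1, h2, h3, h4, h5, h6, fun f hf hf' => hQ _ (h7 f hf hf')⟩

/-- The invariant rule for loops. -/
theorem wp_rep {E : Env w} {r : ℕ} {e : Ex} {c : Cmd} {v : VS} {Q : VS → Prop}
    (I : ℕ → VS → Prop) (hs : e.Safe E v)
    (h0 : I 0 { v with time := v.time + (e.cost + 3) })
    (hstep : ∀ j < e.eval E v, ∀ u, I j u →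
      c.wp E { u with reg := Function.update u.reg r j, time := u.time + 5 } (I (j + 1)))
    (hQ : ∀ u, I (e.eval E v) u → Q u) : (rep r e c).wp E v Q := by
  refine ⟨hs, ?_⟩
  have aux : ∀ (N j : ℕ) (u : VS), j + N = e.eval E v → I j u →
      wpRep (fun u Q => c.wp E u Q) r N j u Q := by
    intro N
    induction N with
    | zero => intro j u hj hu; exact hQ _ (by simpa [← hj] using hu)
    | succ N ihN =>
      intro j u hj hu
      exact wp_mono E c (hstep j (by omega) u hu) fun u' hu' => ihN _ _ (by omega) hu'
  exact aux _ _ _ (by simp) h0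

end Cmd

/-! ### Compilation

The variable `r` lives in the register `4 * r`, temporary values in the registers `4 * t + 1`, loop
counters in the registers `4 * h + 2`, and the register `r` of the matching algorithm in the
register `4 * r + 3`. The element `i` of the array `a` lives at the address `32 * i + a`, so that
all arrays can grow independently. -/

/-- A sequence of instructions. -/
def code : Instr → List Instr → Program
  | e, [] => .instr e
  | e, f :: l => .seq (.instr e) (code f l)

theorem exec_code {w : ℕ} (e : Instr) (l : List Instr) (σ : State w) :
    Exec (code e l) σ (l.length + 1) (l.foldl (fun σ e => e.step σ) (e.step σ)) := by
  induction l generalizing e σ with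
  | nil => exact Exec.instr e σ
  | cons f l ih =>
    have := Exec.seq (Exec.instr e σ) (ih f (e.step σ))
    simpa [code, Nat.add_comm] using this

/-- The address of the element `i` of the array `a`. -/
def cell (w a i : ℕ) : BitVec w := BitVec.ofNat w (32 * i + a)

/-- Replaces the index in the temporary register `t` by the element of the array `a`. -/
def loadCode (a t : ℕ) : Program :=
  code (.const (4 * (t + 1) + 1) 32)
    [.op .mul (4 * t + 1) (4 * t + 1) (4 * (t + 1) + 1), .const (4 * (t + 1) + 1) a,
     .op .add (4 * t + 1) (4 * t + 1) (4 * (t + 1) + 1), .load (4 * t + 1) (4 * t + 1)]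

/-- Code that computes the value of an expression in the temporary register `t`. -/
def Ex.compile (stored : Bool) : Ex → ℕ → Program
  | var r, t => .instr (.op .or (4 * t + 1) (4 * r) (4 * r))
  | lit c, t => .instr (.const (4 * t + 1) c)
  | bin o e f, t =>
    .seq (e.compile stored t) (.seq (f.compile stored (t + 1))
      (.instr (.op o.word (4 * t + 1) (4 * t + 1) (4 * (t + 1) + 1))))
  | get a e, t => .seq (e.compile stored t) (loadCode a t)
  | ref e, t => .seq (e.compile stored t)
      (if stored then loadCode 30 t else .instr (.read (4 * t + 1) 0 (4 * t + 1)))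
  | chr e, t => .seq (e.compile stored t)
      (if stored then loadCode 31 t else .instr (.read (4 * t + 1) 1 (4 * t + 1)))

/-- The machine state `σ` represents `v`. -/
structure Represents {w : ℕ} (E : Env w) (σ : State w) (v : VS) : Prop where
  reg : ∀ r, (σ.reg (4 * r)).toNat = v.reg r
  arr : ∀ a < E.vis, ∀ i < E.L, (σ.mem (cell w a i)).toNat = v.arr a i
  hid : ∀ a, E.vis ≤ a → a < 32 → ∀ i < E.L, (σ.mem (cell w a i)).toNat = E.hid a i
  out : σ.output.map BitVec.toNat = v.out
  space : σ.space ≤ 32 * E.L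
  inp : σ.input = E.inp

/-- The environment is consistent, and addresses fit into words. -/
structure Env.Fits {w : ℕ} (E : Env w) : Prop where
  pos : 0 < E.L
  room : 32 * E.L ≤ 2 ^ w
  vis_le : E.vis ≤ 32
  vis_stored : E.stored → E.vis ≤ 30
  n_le : E.stored → E.n ≤ E.L
  ref_stored : E.stored → ∀ i < E.n, E.ref i = E.hid 30 i
  chr_stored : E.stored → ∀ i < E.n, E.chr i = E.hid 31 i
  ref_inp : ¬ E.stored → ∀ i < E.n, E.ref i = (E.inp 0 (BitVec.ofNat w i)).toNat
  chr_inp : ¬ E.stored → ∀ i < E.n, E.chr i = (E.inp 1 (BitVec.ofNat w i)).toNat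

section

variable {w : ℕ} {E : Env w}

theorem cell_toNat (hE : E.Fits) {a i : ℕ} (ha : a < 32) (hi : i < E.L) :
    (cell w a i).toNat = 32 * i + a := by
  have := hE.room
  rw [cell, BitVec.toNat_ofNat, Nat.mod_eq_of_lt (by omega)]

theorem cell_inj (hE : E.Fits) {a i a' i' : ℕ} (ha : a < 32) (hi : i < E.L) (ha' : a' < 32)
    (hi' : i' < E.L) : cell w a i = cell w a' i' ↔ a = a' ∧ i = i' := by
  constructor
  · intro h
    have := congrArg BitVec.toNat h
    rw [cell_toNat hE ha hi, cell_toNat hE ha' hi'] at this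
    omega
  · rintro ⟨rfl, rfl⟩; rfl

theorem ofNat_cell (x : BitVec w) (a : ℕ) :
    x * BitVec.ofNat w 32 + BitVec.ofNat w a = cell w a x.toNat := by
  rw [cell, Nat.add_comm (32 * _), BitVec.ofNat_add, BitVec.ofNat_mul, BitVec.ofNat_toNat,
    BitVec.setWidth_eq, BitVec.add_comm, BitVec.mul_comm]

/-- `σ'` arises from `σ` by changing temporary registers from `t` on and accessing memory. -/
structure SameUpTo (E : Env w) (t : ℕ) (σ σ' : State w) : Prop where
  reg : ∀ r, (r % 4 ≠ 1 ∨ r < 4 * t + 1) → σ'.reg r = σ.reg r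
  mem : σ'.mem = σ.mem
  out : σ'.output = σ.output
  inp : σ'.input = σ.input
  space : σ.space ≤ 32 * E.L → σ'.space ≤ 32 * E.L

theorem SameUpTo.trans {t t' : ℕ} {σ σ' σ'' : State w} (h : SameUpTo E t σ σ')
    (h' : SameUpTo E t' σ' σ'') (ht : t ≤ t') : SameUpTo E t σ σ'' where
  reg r hr := (h'.reg r (by omega)).trans (h.reg r hr)
  mem := h'.mem.trans h.mem
  out := h'.out.trans h.out
  inp := h'.inp.trans h.inp
  space hs := h'.space (h.space hs)

theorem Represents.same {t : ℕ} {σ σ' : State w} {v : VS} (h : Represents E σ v)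
    (hs : SameUpTo E t σ σ') :
    Represents E σ' v where
  reg r := by rw [hs.reg _ (by omega), h.reg]
  arr := by rw [hs.mem]; exact h.arr
  hid := by rw [hs.mem]; exact h.hid
  out := by rw [hs.out]; exact h.out
  space := hs.space h.space
  inp := by rw [hs.inp]; exact h.inp

theorem Represents.set_time {σ : State w} {v : VS} (h : Represents E σ v) (t : ℕ) :
    Represents E σ { v with time := t } :=
  { h with }

theorem exec_loadCode (hE : E.Fits) (a t : ℕ) (σ : State w) (ha : a < 32)
    (hi : (σ.reg (4 * t + 1)).toNat < E.L) :
    ∃ σ', Exec (loadCode a t) σ 5 σ' ∧ SameUpTo E t σ σ' ∧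
      σ'.reg (4 * t + 1) = σ.mem (cell w a (σ.reg (4 * t + 1)).toNat) := by
  refine ⟨_, exec_code _ _ σ, ⟨?_, ?_, ?_, ?_, ?_⟩, ?_⟩
  · intro r hr
    have h1 : r ≠ 4 * t + 1 := by omega
    have h2 : r ≠ 4 * (t + 1) + 1 := by omega
    simp [Instr.step, h1, h2]
  · simp [Instr.step]
  · simp [Instr.step]
  · simp [Instr.step]
  · intro hs
    have := cell_toNat hE ha hi
    simp [Instr.step, WordOp.eval, hs, ofNat_cell, this]
    omega
  · simp [Instr.step, WordOp.eval, ofNat_cell]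

theorem sameUpTo_update (E : Env w) (t : ℕ) (σ : State w) (x : BitVec w) :
    SameUpTo E t σ { σ with reg := Function.update σ.reg (4 * t + 1) x } where
  reg r hr := Function.update_of_ne (by omega) _ _
  mem := rfl
  out := rfl
  inp := rfl
  space := id

theorem Ex.exec_compile (hE : E.Fits) (e : Ex) : ∀ (t : ℕ) (σ : State w) (v : VS),
    Represents E σ v → e.Safe E v → ∃ T σ', Exec (e.compile E.stored t) σ T σ' ∧ T ≤ e.cost ∧
      SameUpTo E t σ σ' ∧ (σ'.reg (4 * t + 1)).toNat = e.eval E v := by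
  have hw : 1 < 2 ^ w := by have := hE.room; have := hE.pos; omega
  have hroom := hE.room
  have hvis := hE.vis_le
  induction e with
  | var r =>
    intro t σ v h _
    exact ⟨_, _, Exec.instr _ σ, le_rfl, sameUpTo_update _ _ _ _, by
      simp [Instr.step, WordOp.eval, Ex.eval, h.reg]⟩
  | lit c =>
    intro t σ v h hs
    exact ⟨_, _, Exec.instr _ σ, le_rfl, sameUpTo_update _ _ _ _, by
      simpa [Instr.step, Ex.eval] using Nat.mod_eq_of_lt hs⟩
  | bin o e f ihe ihf =>
    intro t σ v h hs
    obtain ⟨T, σ', h1, h2, h3, h4⟩ := ihe t σ v h hs.1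
    obtain ⟨T', σ'', h1', h2', h3', h4'⟩ := ihf (t + 1) σ' v (h.same h3) hs.2.1
    refine ⟨_, _, Exec.seq h1 (Exec.seq h1' (Exec.instr _ σ'')), ?_,
      (h3.trans h3' (Nat.le_succ t)).trans (sameUpTo_update _ t _ _) le_rfl, ?_⟩
    · simp only [Ex.cost]; omega
    · have h5 : σ''.reg (4 * t + 1) = σ'.reg (4 * t + 1) := h3'.reg _ (by omega)
      have h6 := hs.2.2
      rw [← h4, ← h4', ← h5] at h6
      simp only [Instr.step, Function.update_self, BinOp.toNat_word hw o _ _ h6]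
      rw [h5, h4, h4', Ex.eval]
  | get a e ihe =>
    intro t σ v h hs
    obtain ⟨T, σ', h1, h2, h3, h4⟩ := ihe t σ v h hs.1
    obtain ⟨σ'', h5, h6, h7⟩ := exec_loadCode hE a t σ' (by have := hs.2.1; omega)
      (by rw [h4]; exact hs.2.2)
    refine ⟨_, _, Exec.seq h1 h5, ?_, h3.trans h6 le_rfl, ?_⟩
    · simp only [Ex.cost]; omega
    · rw [h7, h4, (h.same h3).arr a hs.2.1 _ hs.2.2, Ex.eval]
  | ref e ihe =>
    intro t σ v h hs
    obtain ⟨T, σ', h1, h2, h3, h4⟩ := ihe t σ v h hs.1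
    have hn := hs.2
    by_cases hst : E.stored = true
    · have := hE.n_le hst
      obtain ⟨σ'', h5, h6, h7⟩ := exec_loadCode hE 30 t σ' (by omega) (by rw [h4]; omega)
      refine ⟨T + 5, σ'', ?_, ?_, h3.trans h6 le_rfl, ?_⟩
      · simpa [Ex.compile, hst] using Exec.seq (by simpa [hst] using h1) h5
      · simp only [Ex.cost]; omega
      · rw [h7, h4, (h.same h3).hid 30 (hE.vis_stored hst) (by omega) _ (by omega), Ex.eval,
          hE.ref_stored hst _ hn]
    · refine ⟨T + 1, _, ?_, ?_,
        h3.trans (sameUpTo_update _ t _ (σ'.input 0 (σ'.reg (4 * t + 1)))) le_rfl, ?_⟩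
      · simpa [Ex.compile, hst, Instr.step] using
          Exec.seq (by simpa [hst] using h1) (Exec.instr (.read (4 * t + 1) 0 (4 * t + 1)) σ')
      · simp only [Ex.cost]; omega
      · rw [Ex.eval, hE.ref_inp hst _ hn, ← h4, (h.same h3).inp]
        simp
  | chr e ihe =>
    intro t σ v h hs
    obtain ⟨T, σ', h1, h2, h3, h4⟩ := ihe t σ v h hs.1
    have hn := hs.2
    by_cases hst : E.stored = true
    · have := hE.n_le hst
      obtain ⟨σ'', h5, h6, h7⟩ := exec_loadCode hE 31 t σ' (by omega) (by rw [h4]; omega)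
      refine ⟨T + 5, σ'', ?_, ?_, h3.trans h6 le_rfl, ?_⟩
      · simpa [Ex.compile, hst] using Exec.seq (by simpa [hst] using h1) h5
      · simp only [Ex.cost]; omega
      · have := hE.vis_stored hst
        rw [h7, h4, (h.same h3).hid 31 (by omega) (by omega) _ (by omega), Ex.eval,
          hE.chr_stored hst _ hn]
    · refine ⟨T + 1, _, ?_, ?_,
        h3.trans (sameUpTo_update _ t _ (σ'.input 1 (σ'.reg (4 * t + 1)))) le_rfl, ?_⟩
      · simpa [Ex.compile, hst, Instr.step] using
          Exec.seq (by simpa [hst] using h1) (Exec.instr (.read (4 * t + 1) 1 (4 * t + 1)) σ')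
      · simp only [Ex.cost]; omega
      · rw [Ex.eval, hE.chr_inp hst _ hn, ← h4, (h.same h3).inp]
        simp

/-! ### The matching algorithm as a subroutine -/

/-- Simulates one instruction of the matching algorithm. Its pattern is the input array `pat`, its
text is the array `a`, its memory is the array `3`, and its output goes to the array `2`. The
temporary registers `0, …, 5` hold the number of outputs, `32`, `a`, `3`, `2` and `1`. -/
def Instr.embed (pat : ℕ) : Instr → Program
  | .const d v => .instr (.const (4 * d + 3) v)
  | .op o d a b => .instr (.op o (4 * d + 3) (4 * a + 3) (4 * b + 3))
  | .read d i a =>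
    if i = 0 then .instr (.read (4 * d + 3) pat (4 * a + 3))
    else if i = 1 then
      .seq (.instr (.op .lt 25 (4 * a + 3) 28))
        (.ite 25 (code (.op .mul 25 (4 * a + 3) 5) [.op .add 25 25 9, .load (4 * d + 3) 25])
          (.instr (.const (4 * d + 3) 0)))
    else .instr (.const (4 * d + 3) 0)
  | .load d a => code (.op .mul 25 (4 * a + 3) 5) [.op .add 25 25 13, .load (4 * d + 3) 25]
  | .store a b => code (.op .mul 25 (4 * a + 3) 5) [.op .add 25 25 13, .store 25 (4 * b + 3)]
  | .rand d => .instr (.rand (4 * d + 3))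
  | .write a => code (.op .mul 25 1 5) [.op .add 25 25 17, .store 25 (4 * a + 3), .op .add 1 1 21]

/-- Simulates a program of the matching algorithm. -/
def Program.embed (pat : ℕ) : Program → Program
  | .instr e => e.embed pat
  | .seq p q => .seq (p.embed pat) (q.embed pat)
  | .ite a p q => .ite (4 * a + 3) (p.embed pat) (q.embed pat)
  | .loop a p => .loop (4 * a + 3) (p.embed pat)

/-- The state `σ` represents the state `ρ` of the matching algorithm, which was called in the state
`σ₀` with `S` words of memory and the text of length `u` in the array `a`. -/
structure Simulates (E : Env w) (S pat a u : ℕ) (σ₀ : State w) (ρ σ : State w) : Prop where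
  reg : ∀ r, σ.reg (4 * r + 3) = ρ.reg r
  tape : σ.tape = ρ.tape
  mem : ∀ x : BitVec w, x.toNat < S → σ.mem (cell w 3 x.toNat) = ρ.mem x
  count : (σ.reg 1).toNat = ρ.output.length
  written : ∀ (i : ℕ) (h : i < ρ.output.length), σ.mem (cell w 2 i) = ρ.output[i]
  const_width : σ.reg 5 = BitVec.ofNat w 32
  const_text : σ.reg 9 = BitVec.ofNat w a
  const_mem : σ.reg 13 = BitVec.ofNat w 3
  const_out : σ.reg 17 = BitVec.ofNat w 2
  const_one : σ.reg 21 = BitVec.ofNat w 1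
  len : (σ.reg 28).toNat = u
  frame : ∀ r, r % 4 = 0 ∨ r % 4 = 2 → σ.reg r = σ₀.reg r
  frame_mem : ∀ a' < 32, a' ≠ 2 → a' ≠ 3 → ∀ i < E.L,
    σ.mem (cell w a' i) = σ₀.mem (cell w a' i)
  output : σ.output = σ₀.output
  input : σ.input = σ₀.input
  space : σ.space ≤ 32 * E.L
  pattern : ρ.input 0 = σ₀.input pat
  text : ∀ x : BitVec w, ρ.input 1 x = if x.toNat < u then σ₀.mem (cell w a x.toNat) else 0
  other : ∀ i, 1 < i → ∀ x, ρ.input i x = 0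

theorem Instr.step_mono (e : Instr) (ρ : State w) : ρ.space ≤ (e.step ρ).space ∧
    ρ.output.length ≤ (e.step ρ).output.length := by
  cases e <;> simp [Instr.step]

theorem Exec.mono {p : Program} {ρ ρ' : State w} {T : ℕ} (h : Exec p ρ T ρ') :
    ρ.space ≤ ρ'.space ∧ ρ.output.length ≤ ρ'.output.length := by
  induction h with
  | instr e σ => exact e.step_mono σ
  | seq _ _ h1 h2 => exact ⟨h1.1.trans h2.1, h1.2.trans h2.2⟩
  | ite_true _ _ h => exact h
  | ite_false _ _ h => exact h
  | loop_done _ => exact ⟨le_rfl, le_rfl⟩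
  | loop_next _ _ _ h1 h2 => exact ⟨h1.1.trans h2.1, h1.2.trans h2.2⟩

theorem Simulates.step (hE : E.Fits) {S pat a u : ℕ} {σ₀ ρ σ : State w} (hS : S ≤ E.L)
    (ha : a < 32) (ha2 : a ≠ 2) (ha3 : a ≠ 3) (hu : u ≤ E.L) (e : Instr)
    (h : Simulates E S pat a u σ₀ ρ σ)
    (hsp : (e.step ρ).space ≤ S) (hout : (e.step ρ).output.length ≤ E.L) :
    ∃ T σ', Exec (e.embed pat) σ T σ' ∧ T ≤ 5 ∧ Simulates E S pat a u σ₀ (e.step ρ) σ' := by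
  have hroom := hE.room
  -- Assigning to a register of the matching algorithm.
  have hset : ∀ (σ' ρ' : State w) (d : ℕ) (x : BitVec w), Simulates E S pat a u σ₀ ρ' σ' →
      Simulates E S pat a u σ₀ { ρ' with reg := Function.update ρ'.reg d x }
        { σ' with reg := Function.update σ'.reg (4 * d + 3) x } := by
    intro σ' ρ' d x h
    have hne : ∀ r, r % 4 ≠ 3 → Function.update σ'.reg (4 * d + 3) x r = σ'.reg r :=
      fun r hr => Function.update_of_ne (by omega) _ _
    refine { h with
      reg := ?_, count := ?_, const_width := ?_, const_text := ?_, const_mem := ?_,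
      const_out := ?_, const_one := ?_, len := ?_, frame := ?_ }
    · intro r
      by_cases hr : r = d
      · subst hr; simp
      · simp [hr, h.reg]
    all_goals first
      | (intro r hr; dsimp only; rw [hne _ (by omega)]; exact h.frame r hr)
      | (dsimp only; rw [hne _ (by decide)];
         first | exact h.count | exact h.const_width | exact h.const_text | exact h.const_mem
               | exact h.const_out | exact h.const_one | exact h.len)
  -- Assigning to the scratch register.
  have htmp : ∀ (σ' ρ' : State w) (x : BitVec w), Simulates E S pat a u σ₀ ρ' σ' →
      Simulates E S pat a u σ₀ ρ' { σ' with reg := Function.update σ'.reg 25 x } := by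
    intro σ' ρ' x h
    have hne : ∀ r, r ≠ 25 → Function.update σ'.reg 25 x r = σ'.reg r :=
      fun r hr => Function.update_of_ne hr _ _
    refine { h with
      reg := ?_, count := ?_, const_width := ?_, const_text := ?_, const_mem := ?_,
      const_out := ?_, const_one := ?_, len := ?_, frame := ?_ }
    · intro r; dsimp only; rw [hne _ (by omega)]; exact h.reg r
    all_goals first
      | (intro r hr; dsimp only; rw [hne _ (by omega)]; exact h.frame r hr)
      | (dsimp only; rw [hne _ (by decide)];
         first | exact h.count | exact h.const_width | exact h.const_text | exact h.const_mem
               | exact h.const_out | exact h.const_one | exact h.len)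
  cases e with
  | const d v => exact ⟨_, _, Exec.instr _ _, by norm_num, hset _ _ _ _ h⟩
  | op o d x y =>
    refine ⟨_, _, Exec.instr _ _, by norm_num, ?_⟩
    simp only [Instr.step, h.reg]
    exact hset _ _ _ _ h
  | rand d =>
    refine ⟨_, _, Exec.instr _ _, by norm_num, ?_⟩
    have := hset _ _ d (BitVec.ofFin (ρ.tape 0)) h
    simp only [Instr.step, h.tape]
    exact { this with tape := rfl }
  | read d i x =>
    by_cases h0 : i = 0
    · subst h0
      refine ⟨_, _, by simpa [Instr.embed] using Exec.instr _ _, by norm_num, ?_⟩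
      have hin : σ.input pat (ρ.reg x) = ρ.input 0 (ρ.reg x) := by rw [h.pattern, h.input]
      simp only [Instr.step, h.reg, hin]
      exact hset _ _ _ _ h
    by_cases h1 : i = 1
    · subst h1
      simp only [Instr.embed, one_ne_zero, if_false, if_true, Instr.step]
      set b := WordOp.eval .lt (σ.reg (4 * x + 3)) (σ.reg 28) with hb
      set σ1 : State w := { σ with reg := Function.update σ.reg 25 b } with hσ1
      have hs1 : Simulates E S pat a u σ₀ ρ σ1 := htmp _ _ _ h
      have e1 : Exec (.instr (.op .lt 25 (4 * x + 3) 28)) σ 1 σ1 := Exec.instr _ _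
      have hb' : b = if (ρ.reg x).toNat < u then 1 else 0 := by
        rw [hb, WordOp.eval, h.reg, ← h.len]
        exact if_congr BitVec.lt_def rfl rfl
      have hr : σ1.reg 25 = b := by simp [hσ1]
      by_cases hx : (ρ.reg x).toNat < u
      · rw [if_pos hx] at hb'
        have hne : b ≠ 0 := by
          rw [hb']; intro hc
          have := congrArg BitVec.toNat hc
          have h1 : (1 : BitVec w).toNat = 1 := by
            have hp := hE.pos
            simpa using Nat.mod_eq_of_lt (show 1 < 2 ^ w by omega)
          rw [h1] at this; simp at this
        refine ⟨_, _, Exec.seq e1 (Exec.ite_true (by rwa [hr]) (exec_code _ _ _)), by norm_num, ?_⟩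
        have hy : σ1.reg (4 * x + 3) = ρ.reg x := hs1.reg x
        have hcell := cell_toNat (w := w) hE ha (hx.trans_le hu)
        simp only [List.foldl, Instr.step, WordOp.eval, Function.update_self, hy, hs1.const_width,
          Function.update_of_ne (show (9 : ℕ) ≠ 25 by decide), hs1.const_text, ofNat_cell, hcell]
        have ht : ρ.input 1 (ρ.reg x) = σ1.mem (cell w a (ρ.reg x).toNat) := by
          rw [h.text, if_pos hx, hs1.frame_mem a ha ha2 ha3 _ (hx.trans_le hu)]
        rw [ht]
        refine { hset _ _ d _ (htmp _ _ _ (htmp _ _ _ hs1)) with space := ?_ }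
        have := hs1.space
        have : (ρ.reg x).toNat < E.L := by omega
        dsimp only
        omega
      · rw [if_neg hx] at hb'
        refine ⟨_, _, Exec.seq e1 (Exec.ite_false (by rw [hr, hb']) (Exec.instr _ _)),
          by norm_num, ?_⟩
        rw [h.text, if_neg hx]
        exact hset _ _ _ _ hs1
    · refine ⟨_, _, by simpa [Instr.embed, h0, h1] using Exec.instr _ _, by norm_num, ?_⟩
      simp only [Instr.step, h.other i (by omega)]
      exact hset _ _ _ _ h
  | load d x =>
    have hx : (ρ.reg x).toNat < S := by
      have := hsp; simp only [Instr.step] at this; omega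
    refine ⟨_, _, exec_code _ _ _, by norm_num, ?_⟩
    have hcell := cell_toNat (w := w) hE (show 3 < 32 by decide) (hx.trans_le hS)
    simp only [List.foldl, Instr.step, WordOp.eval, Function.update_self, h.reg, h.const_width,
      Function.update_of_ne (show (13 : ℕ) ≠ 25 by decide), h.const_mem, ofNat_cell, hcell]
    rw [h.mem _ hx]
    refine { hset _ _ d _ (htmp _ _ _ (htmp _ _ _ h)) with space := ?_ }
    have := h.space
    dsimp only
    omega
  | store x y =>
    have hx : (ρ.reg x).toNat < S := by
      have := hsp; simp only [Instr.step] at this; omega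
    refine ⟨_, _, exec_code _ _ _, by norm_num, ?_⟩
    have hcell := cell_toNat (w := w) hE (show 3 < 32 by decide) (hx.trans_le hS)
    have hy : ∀ z : BitVec w, Function.update σ.reg 25 z (4 * y + 3) = ρ.reg y := fun z => by
      rw [Function.update_of_ne (by omega), h.reg]
    simp only [List.foldl, Instr.step, WordOp.eval, Function.update_self, h.reg, h.const_width,
      Function.update_of_ne (show (13 : ℕ) ≠ 25 by decide), h.const_mem, ofNat_cell, hcell,
      Function.update_idem, hy]
    refine { htmp _ _ _ h with space := ?_, mem := ?_, written := ?_, frame_mem := ?_ }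
    · intro z hz
      by_cases hzx : z = ρ.reg x
      · subst hzx; simp
      · dsimp only
        rw [Function.update_of_ne hzx, Function.update_of_ne, h.mem z hz]
        rw [Ne, cell_inj hE (by decide) (hz.trans_le hS) (by decide) (hx.trans_le hS)]
        exact fun hc => hzx (BitVec.toNat_inj.1 hc.2)
    · intro i hi
      dsimp only
      have hi' : i < E.L := lt_of_lt_of_le hi hout
      rw [Function.update_of_ne, h.written i hi]
      rw [Ne, cell_inj hE (by decide) hi' (by decide) (hx.trans_le hS)]
      omega
    · intro a' ha' h2 h3 i hi
      dsimp only
      rw [Function.update_of_ne, h.frame_mem a' ha' h2 h3 i hi]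
      rw [Ne, cell_inj hE ha' hi (by decide) (hx.trans_le hS)]
      omega
    · have := h.space
      dsimp only
      omega
  | write x =>
    have hlen : ρ.output.length < E.L := by
      have := hout; simp only [Instr.step, List.length_append, List.length_singleton] at this; omega
    have hcell := cell_toNat (w := w) hE (show 2 < 32 by decide) hlen
    refine ⟨_, _, exec_code _ _ _, by norm_num, ?_⟩
    have hy : ∀ z : BitVec w, Function.update σ.reg 25 z (4 * x + 3) = ρ.reg x := fun z => by
      rw [Function.update_of_ne (by omega), h.reg]
    simp only [List.foldl, Instr.step, WordOp.eval, Function.update_self, h.const_width,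
      Function.update_of_ne (show (17 : ℕ) ≠ 25 by decide), h.const_out, ofNat_cell, hcell,
      Function.update_idem, hy, h.count, Function.update_of_ne (show (1 : ℕ) ≠ 25 by decide),
      Function.update_of_ne (show (21 : ℕ) ≠ 25 by decide), h.const_one]
    have h' := htmp _ _ (cell w 2 ρ.output.length) h
    have hne : ∀ (z : BitVec w) r, r ≠ 1 →
        Function.update (Function.update σ.reg 25 (cell w 2 ρ.output.length)) 1 z r =
          Function.update σ.reg 25 (cell w 2 ρ.output.length) r :=
      fun z r hr => Function.update_of_ne hr _ _
    refine { h' with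
      reg := ?_, count := ?_, const_width := ?_, const_text := ?_, const_mem := ?_,
      const_out := ?_, const_one := ?_, len := ?_, frame := ?_, mem := ?_, written := ?_,
      frame_mem := ?_, space := ?_ }
    · intro r; dsimp only; rw [hne _ _ (by omega)]; exact h'.reg r
    · intro z hz
      dsimp only
      rw [Function.update_of_ne, h.mem z hz]
      rw [Ne, cell_inj hE (by decide) (hz.trans_le hS) (by decide) hlen]
      omega
    · simp only [Function.update_self, BitVec.toNat_add, BitVec.toNat_ofNat, h.count,
        List.length_append, List.length_singleton]
      rw [Nat.mod_eq_of_lt (show 1 < 2 ^ w by omega), Nat.mod_eq_of_lt (by omega)]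
    · intro i hi
      dsimp only at hi ⊢
      rw [List.length_append, List.length_singleton] at hi
      by_cases hi' : i = ρ.output.length
      · subst hi'; simp
      · rw [Function.update_of_ne, h.written i (by omega), List.getElem_append_left]
        rw [Ne, cell_inj hE (by decide) (by omega) (by decide) hlen]
        omega
    · dsimp only; rw [hne _ _ (by decide)]; exact h'.const_width
    · dsimp only; rw [hne _ _ (by decide)]; exact h'.const_text
    · dsimp only; rw [hne _ _ (by decide)]; exact h'.const_mem
    · dsimp only; rw [hne _ _ (by decide)]; exact h'.const_out
    · dsimp only; rw [hne _ _ (by decide)]; exact h'.const_one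
    · dsimp only; rw [hne _ _ (by decide)]; exact h'.len
    · intro r hr; dsimp only; rw [hne _ _ (by omega)]; exact h'.frame r hr
    · intro a' ha' h2 h3 i hi
      dsimp only
      rw [Function.update_of_ne, h.frame_mem a' ha' h2 h3 i hi]
      rw [Ne, cell_inj hE ha' hi (by decide) hlen]
      omega
    · have := h.space
      dsimp only
      omega

theorem Simulates.exec (hE : E.Fits) {S pat a u : ℕ} {σ₀ : State w} (hS : S ≤ E.L)
    (ha : a < 32) (ha2 : a ≠ 2) (ha3 : a ≠ 3) (hu : u ≤ E.L) {p : Program} {ρ ρ' : State w} {T : ℕ}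
    (hp : Exec p ρ T ρ') : ∀ σ, Simulates E S pat a u σ₀ ρ σ → ρ'.space ≤ S →
    ρ'.output.length ≤ E.L →
    ∃ T' σ', Exec (p.embed pat) σ T' σ' ∧ T' ≤ 5 * T ∧ Simulates E S pat a u σ₀ ρ' σ' := by
  induction hp with
  | instr e ρ =>
    intro σ h hsp hout
    obtain ⟨T', σ', h1, h2, h3⟩ := h.step hE hS ha ha2 ha3 hu e hsp hout
    exact ⟨T', σ', h1, by omega, h3⟩
  | seq hp hq ihp ihq =>
    intro σ h hsp hout
    obtain ⟨T1, σ1, h1, h2, h3⟩ := ihp σ h (hq.mono.1.trans hsp) (hq.mono.2.trans hout)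
    obtain ⟨T2, σ2, h4, h5, h6⟩ := ihq σ1 h3 hsp hout
    exact ⟨_, σ2, Exec.seq h1 h4, by omega, h6⟩
  | ite_true hne hp ih =>
    intro σ h hsp hout
    obtain ⟨T1, σ1, h1, h2, h3⟩ := ih σ h hsp hout
    exact ⟨_, σ1, Exec.ite_true (by rwa [h.reg]) h1, by omega, h3⟩
  | ite_false heq hp ih =>
    intro σ h hsp hout
    obtain ⟨T1, σ1, h1, h2, h3⟩ := ih σ h hsp hout
    exact ⟨_, σ1, Exec.ite_false (by rwa [h.reg]) h1, by omega, h3⟩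
  | loop_done heq =>
    intro σ h hsp hout
    exact ⟨_, σ, Exec.loop_done (by rwa [h.reg]), by omega, h⟩
  | loop_next hne hp hq ihp ihq =>
    intro σ h hsp hout
    obtain ⟨T1, σ1, h1, h2, h3⟩ := ihp σ h (hq.mono.1.trans hsp) (hq.mono.2.trans hout)
    obtain ⟨T2, σ2, h4, h5, h6⟩ := ihq σ1 h3 hsp hout
    exact ⟨_, σ2, Exec.loop_next (by rwa [h.reg]) h1 h4, by omega, h6⟩

theorem matchSet_subset {α : Type*} (k : ℕ) (P S : List α) :
    matchSet k P S ⊆ Finset.Icc 1 S.length := by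
  intro x hx
  simp only [matchSet, Finset.mem_filter] at hx
  exact hx.1

/-- The matching algorithm `A`, reading its pattern from the input array `pat`, can be called. -/
structure Env.Calls (E : Env w) (A : Program) (pat S T : ℕ) : Prop where
  space : S ≤ E.L
  text : 2 * E.P.length + 2 * E.k ≤ E.L
  vis : 4 ≤ E.vis
  pattern : ∀ (i : ℕ) (hi : i < E.P.length), E.inp pat (BitVec.ofNat w i) = E.P[i]
  time : 5 * T + 10 ≤ E.callTime
  run : ∀ U : List (BitVec w), U.length = 2 * E.P.length + 2 * E.k →
    ∀ ρ : State w, Loaded ρ [E.P.length, U.length, E.k] [E.P, U] →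
      RunsWithin A ρ T S fun l => l = (matchSet E.k E.P U).sort (· ≤ ·)

/-- Calls the matching algorithm `A` on the text in the array `a`, and puts the number of matches
into the variable `r`. -/
def callCode (A : Program) (pat a r : ℕ) : Program :=
  .seq (code (.const 5 32) [.const 9 a, .const 13 3, .const 17 2, .const 21 1, .const 1 0,
      .op .or 3 4 4, .op .or 7 28 28, .op .or 11 8 8])
    (.seq (A.embed pat) (.instr (.op .or (4 * r) 1 1)))

/-- Compilation of commands; `h` is the nesting depth of loops. -/
def Cmd.compile (stored : Bool) (A : Program) (pat : ℕ) : Cmd → ℕ → Program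
  | skip, _ => .instr (.const 1 0)
  | set r e, _ => .seq (e.compile stored 0) (.instr (.op .or (4 * r) 1 1))
  | put a i x, _ =>
    .seq (i.compile stored 0) (.seq (x.compile stored 1)
      (code (.const 9 32) [.op .mul 1 1 9, .const 9 a, .op .add 1 1 9, .store 1 5]))
  | out e, _ => .seq (e.compile stored 0) (.instr (.write 1))
  | seq c d, h => .seq (c.compile stored A pat h) (d.compile stored A pat h)
  | ite e c d, h =>
    .seq (e.compile stored 0) (.ite 1 (c.compile stored A pat h) (d.compile stored A pat h))
  | rep r e c, h =>
    .seq (e.compile stored 0)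
      (.seq (code (.op .or (4 * (2 * h) + 2) 1 1) [.const (4 * (2 * h + 1) + 2) 0])
        (.loop (4 * (2 * h) + 2)
          (.seq (.instr (.op .or (4 * r) (4 * (2 * h + 1) + 2) (4 * (2 * h + 1) + 2)))
            (.seq (c.compile stored A pat (h + 1))
              (code (.const 1 1) [.op .add (4 * (2 * h + 1) + 2) (4 * (2 * h + 1) + 2) 1,
                .op .sub (4 * (2 * h) + 2) (4 * (2 * h) + 2) 1])))))
  | call a r, _ => callCode A pat a r

theorem exec_callCode (hE : E.Fits) {A : Program} {pat S T : ℕ} (hA : E.Calls A pat S T) (a r : ℕ)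
    {v : VS} {Q : VS → Prop} (hwp : (Cmd.call a r).wp E v Q) {σ : State w}
    (h : Represents E σ v) :
    ∃ T' σ' u, Exec (callCode A pat a r) σ T' σ' ∧ Represents E σ' u ∧ v.time + T' ≤ u.time ∧
      (∀ x, σ'.reg (4 * x + 2) = σ.reg (4 * x + 2)) ∧ Q u := by
  obtain ⟨ha, ha2, ha3, hm, hk, hu, hQ⟩ := hwp
  have hroom := hE.room
  have hvis := hE.vis_le
  have htext := hA.text
  set u := 2 * E.P.length + 2 * E.k with hu'
  set U : List (BitVec w) := (List.range u).map fun i => BitVec.ofNat w (v.arr a i) with hU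
  have hUlen : U.length = u := by simp [hU]
  obtain ⟨σ1, hσ1⟩ : ∃ σ1, σ1 = List.foldl (fun σ e => Instr.step e σ)
      ((Instr.const 5 32).step σ) [.const 9 a, .const 13 3, .const 17 2, .const 21 1, .const 1 0,
      .op .or 3 4 4, .op .or 7 28 28, .op .or 11 8 8] := ⟨_, rfl⟩
  have e1 := exec_code (.const 5 32) [.const 9 a, .const 13 3, .const 17 2, .const 21 1, .const 1 0,
      .op .or 3 4 4, .op .or 7 28 28, .op .or 11 8 8] σ
  rw [← hσ1] at e1
  -- The initial state of the matching algorithm.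
  let ρ : State w :=
    { reg := fun x => σ1.reg (4 * x + 3)
      input := fun i x => if i = 0 then σ.input pat x
        else if i = 1 then (if x.toNat < u then σ.mem (cell w a x.toNat) else 0) else 0
      mem := fun x => σ.mem (cell w 3 x.toNat)
      tape := σ.tape
      output := []
      space := 0 }
  have hreg : ∀ (x y : ℕ), (σ.reg (4 * x)).toNat = y → σ.reg (4 * x) = BitVec.ofNat w y := by
    intro x y hxy; rw [← hxy]; simp
  have hload : Loaded ρ [E.P.length, U.length, E.k] [E.P, U] := by
    refine ⟨rfl, rfl, ?_, ?_⟩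
    · intro x hx
      have h1 := hreg 1 _ ((h.reg 1).trans hm)
      have h2 := hreg 2 _ ((h.reg 2).trans hk)
      have h7 := hreg 7 _ ((h.reg 7).trans hu)
      simp only [List.length_cons, List.length_nil] at hx
      norm_num at h1 h2 h7
      interval_cases x <;>
        simp [ρ, hσ1, Instr.step, Function.update, WordOp.eval, h1, h2, h7, hUlen]
    · intro x hx i hi
      simp only [List.length_cons, List.length_nil] at hx
      interval_cases x
      · simp only [List.getElem_cons_zero] at hi ⊢
        simp only [ρ, if_true, h.inp]
        exact hA.pattern i hi
      · simp only [List.getElem_cons_succ, List.getElem_cons_zero] at hi ⊢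
        have hi' : (BitVec.ofNat w i).toNat = i := by
          rw [BitVec.toNat_ofNat, Nat.mod_eq_of_lt (by omega)]
        simp only [ρ, one_ne_zero, if_false, if_true, hi']
        rw [if_pos (by omega)]
        have := h.arr a ha i (by omega)
        simp [hU, ← this]
  obtain ⟨T', ρ', e2, hT', hsp, hout⟩ := hA.run U hUlen ρ hload
  have hsim : Simulates E S pat a u σ ρ σ1 := by
    constructor
    · intro x; rfl
    · simp [hσ1, Instr.step, ρ]
    · intro x _; simp [hσ1, Instr.step, ρ]
    · simp [hσ1, Instr.step, ρ, Function.update]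
    · intro i hi; simp [ρ] at hi
    · simp [hσ1, Instr.step, Function.update]
    · simp [hσ1, Instr.step, Function.update]
    · simp [hσ1, Instr.step, Function.update]
    · simp [hσ1, Instr.step, Function.update]
    · simp [hσ1, Instr.step, Function.update]
    · have := h.reg 7
      simpa [hσ1, Instr.step, Function.update] using this.trans hu
    · intro x hx
      have h1 : x ≠ 5 ∧ x ≠ 9 ∧ x ≠ 13 ∧ x ≠ 17 ∧ x ≠ 21 ∧ x ≠ 1 ∧ x ≠ 3 ∧ x ≠ 7 ∧ x ≠ 11 := by
        omega
      simp [hσ1, Instr.step, Function.update, h1]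
    · intros; simp [hσ1, Instr.step]
    · simp [hσ1, Instr.step]
    · simp [hσ1, Instr.step]
    · simpa [hσ1, Instr.step] using h.space
    · simp [ρ]
    · intro x; simp [ρ]
    · intro i hi x
      simp [ρ, show i ≠ 0 by omega, show i ≠ 1 by omega]
  have hlen : ρ'.output.length = (Cmd.matchesIn E v a).length := by
    rw [← List.length_map (f := BitVec.toNat), hout]; rfl
  have hle : (Cmd.matchesIn E v a).length ≤ u := by
    rw [Cmd.matchesIn, Finset.length_sort, ← hu', ← hU]
    calc _ ≤ (Finset.Icc 1 U.length).card := Finset.card_le_card (matchSet_subset _ _ _)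
      _ = u := by simp [hUlen]
  obtain ⟨T2, σ2, e3, hT2, hs2⟩ :=
    Simulates.exec hE hA.space (by omega) ha2 ha3 htext e2 σ1 hsim hsp
    (by omega)
  have hfr : ∀ x, x % 4 = 0 ∨ x % 4 = 2 → Function.update σ2.reg (4 * r) (σ2.reg 1) x =
      if x = 4 * r then σ2.reg 1 else σ.reg x := by
    intro x hx
    by_cases hxr : x = 4 * r
    · subst hxr; simp
    · rw [Function.update_of_ne hxr, if_neg hxr, hs2.frame x hx]
  have e4 : Exec (.instr (.op .or (4 * r) 1 1)) σ2 1
      { σ2 with reg := Function.update σ2.reg (4 * r) (σ2.reg 1) } := by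
    simpa [Instr.step, WordOp.eval] using Exec.instr (.op .or (4 * r) 1 1) σ2
  refine ⟨_, _, _, Exec.seq e1 (Exec.seq e3 e4), ?_, ?_, ?_,
    hQ (fun a' i => if a' = 2 ∨ a' = 3 then (σ2.mem (cell w a' i)).toNat else v.arr a' i) ?_ ?_⟩
  · constructor
    · intro x
      dsimp only
      rw [hfr _ (by omega)]
      by_cases hx : x = r
      · subst hx; simp [hs2.count, hlen]
      · rw [if_neg (by omega), Function.update_of_ne hx, h.reg]
    · intro a' ha' i hi
      dsimp only
      by_cases h23 : a' = 2 ∨ a' = 3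
      · rw [if_pos h23]
      · rw [if_neg h23, hs2.frame_mem a' (by omega) (by tauto) (by tauto) i hi, h.arr a' ha' i hi]
    · intro a' ha' ha'' i hi
      have := hA.vis
      dsimp only
      rw [hs2.frame_mem a' ha'' (by omega) (by omega) i hi, h.hid a' ha' ha'' i hi]
    · dsimp only; rw [hs2.output, h.out]
    · exact hs2.space
    · dsimp only; rw [hs2.input, h.inp]
  · have := hA.time
    simp only [List.length_cons, List.length_nil]
    omega
  · intro x
    dsimp only
    rw [hfr _ (by omega), if_neg (by omega)]
  · intro i hi
    simp only [true_or, if_true]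
    rw [hs2.written i (by omega)]
    have hl : ρ'.output.map BitVec.toNat = Cmd.matchesIn E v a := hout
    simp [← hl]
  · intro a' h2 h3
    funext i
    rw [if_neg (by tauto)]

/-- Soundness of compilation: if the weakest precondition of a postcondition holds, the compiled
command ends in a state that represents one satisfying it, and the number of steps is at most the
increase of the time counter. Loop counters of enclosing loops are kept. -/
theorem Cmd.exec_compile (hE : E.Fits) {A : Program} {pat S T : ℕ} (hA : E.Calls A pat S T)
    (c : Cmd) : ∀ (h : ℕ) (v : VS) (Q : VS → Prop), c.wp E v Q → ∀ σ, Represents E σ v →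
      ∃ T' σ' u, Exec (c.compile E.stored A pat h) σ T' σ' ∧ Represents E σ' u ∧
        v.time + T' ≤ u.time ∧ (∀ x < 2 * h, σ'.reg (4 * x + 2) = σ.reg (4 * x + 2)) ∧ Q u := by
  have hroom := hE.room
  have hpos := hE.pos
  have hvis := hE.vis_le
  induction c with
  | skip =>
    intro h v Q hwp σ hσ
    have hs := sameUpTo_update E 0 σ (BitVec.ofNat w 0)
    exact ⟨_, _, _, Exec.instr _ σ, (hσ.same hs).set_time _, le_rfl, fun x _ => hs.reg _ (by omega),
      hwp⟩
  | set r e =>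
    intro h v Q hwp σ hσ
    obtain ⟨hs, hQ⟩ := hwp
    obtain ⟨T1, σ1, e1, hT1, hs1, hv1⟩ := e.exec_compile hE 0 σ v hσ hs
    have hσ1 := hσ.same hs1
    refine ⟨_, _, _, Exec.seq e1 (Exec.instr _ _), ?_, ?_, ?_, hQ⟩
    · refine { arr := hσ1.arr, hid := hσ1.hid, out := hσ1.out, space := hσ1.space, inp := hσ1.inp,
               reg := ?_ }
      intro x
      by_cases hx : x = r
      · subst hx; simpa [Instr.step, WordOp.eval] using hv1
      · simp only [Instr.step]
        rw [Function.update_of_ne (by omega), Function.update_of_ne hx, hσ1.reg]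
    · dsimp only; omega
    · intro x _
      simp only [Instr.step]
      rw [Function.update_of_ne (by omega), hs1.reg _ (by omega)]
  | put a i x =>
    intro h v Q hwp σ hσ
    obtain ⟨hsi, hsx, ha, hi, hQ⟩ := hwp
    obtain ⟨T1, σ1, e1, hT1, hs1, hv1⟩ := i.exec_compile hE 0 σ v hσ hsi
    obtain ⟨T2, σ2, e2, hT2, hs2, hv2⟩ := x.exec_compile hE 1 σ1 v (hσ.same hs1) hsx
    have hs12 := hs1.trans hs2 (Nat.zero_le 1)
    have hσ2 := hσ.same hs12
    have hv1' : (σ2.reg 1).toNat = i.eval E v := by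
      rw [hs2.reg 1 (by omega)]; exact hv1
    have hv2' : (σ2.reg 5).toNat = x.eval E v := hv2
    have hcell := cell_toNat (w := w) hE (show a < 32 by omega) hi
    refine ⟨_, _, _, Exec.seq e1 (Exec.seq e2 (exec_code _ _ _)), ?_, ?_, ?_, hQ⟩
    · simp only [List.foldl, Instr.step, WordOp.eval, Function.update_self,
        Function.update_of_ne (show (1 : ℕ) ≠ 9 by decide),
        Function.update_of_ne (show (5 : ℕ) ≠ 9 by decide),
        Function.update_of_ne (show (5 : ℕ) ≠ 1 by decide), ofNat_cell, hv1', hcell]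
      refine { out := hσ2.out, inp := hσ2.inp, reg := ?_, arr := ?_, hid := ?_, space := ?_ }
      · intro y
        dsimp only
        rw [Function.update_of_ne (by omega), Function.update_of_ne (by omega),
          Function.update_of_ne (by omega), Function.update_of_ne (by omega), hσ2.reg]
      · intro a' ha' j hj
        dsimp only
        by_cases haa : a' = a
        · subst haa
          by_cases hij : j = i.eval E v
          · subst hij; simpa using hv2'
          · rw [Function.update_of_ne, Function.update_self, Function.update_of_ne hij,
              hσ2.arr _ ha' j hj]
            rw [Ne, cell_inj hE (by omega) hj (by omega) hi]
            tauto
        · rw [Function.update_of_ne, Function.update_of_ne haa, hσ2.arr _ ha' j hj]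
          rw [Ne, cell_inj hE (by omega) hj (by omega) hi]
          tauto
      · intro a' ha' ha'' j hj
        dsimp only
        rw [Function.update_of_ne, hσ2.hid _ ha' ha'' j hj]
        rw [Ne, cell_inj hE (by omega) hj (by omega) hi]
        omega
      · have := hσ2.space
        dsimp only
        omega
    · simp only [List.length_cons, List.length_nil]
      omega
    · intro y _
      simp only [List.foldl, Instr.step]
      rw [Function.update_of_ne (by omega), Function.update_of_ne (by omega),
          Function.update_of_ne (by omega), Function.update_of_ne (by omega),
          hs12.reg _ (by omega)]
  | out e =>
    intro h v Q hwp σ hσ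
    obtain ⟨hs, hQ⟩ := hwp
    obtain ⟨T1, σ1, e1, hT1, hs1, hv1⟩ := e.exec_compile hE 0 σ v hσ hs
    have hσ1 := hσ.same hs1
    refine ⟨_, _, _, Exec.seq e1 (Exec.instr _ _), ?_, ?_, ?_, hQ⟩
    · refine { arr := hσ1.arr, hid := hσ1.hid, out := ?_, space := hσ1.space, inp := hσ1.inp,
               reg := hσ1.reg }
      simp only [Instr.step, List.map_append, List.map_cons, List.map_nil, hσ1.out]
      rw [← hv1]
    · dsimp only; omega
    · intro x _
      exact hs1.reg _ (by omega)
  | seq c d ihc ihd =>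
    intro h v Q hwp σ hσ
    obtain ⟨T1, σ1, u1, e1, hr1, hT1, hf1, hw1⟩ := ihc h v _ hwp σ hσ
    obtain ⟨T2, σ2, u2, e2, hr2, hT2, hf2, hw2⟩ := ihd h u1 _ hw1 σ1 hr1
    exact ⟨_, σ2, u2, Exec.seq e1 e2, hr2, by omega,
      fun x hx => (hf2 x hx).trans (hf1 x hx), hw2⟩
  | ite e c d ihc ihd =>
    intro h v Q hwp σ hσ
    obtain ⟨hs, hc, hd⟩ := hwp
    obtain ⟨T1, σ1, e1, hT1, hs1, hv1⟩ := e.exec_compile hE 0 σ v hσ hs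
    have hσ1 := hσ.same hs1
    have hσ1' := hσ1.set_time (v.time + (e.cost + 1))
    by_cases he : e.eval E v = 0
    · obtain ⟨T2, σ2, u2, e2, hr2, hT2, hf2, hw2⟩ := ihd h _ _ (hd he) σ1 hσ1'
      refine ⟨_, σ2, u2, Exec.seq e1 (Exec.ite_false ?_ e2), hr2, ?_,
        fun x hx => (hf2 x hx).trans (hs1.reg _ (by omega)), hw2⟩
      · rw [← BitVec.toNat_inj]; simpa [he] using hv1
      · dsimp only at hT2; omega
    · obtain ⟨T2, σ2, u2, e2, hr2, hT2, hf2, hw2⟩ := ihc h _ _ (hc he) σ1 hσ1'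
      refine ⟨_, σ2, u2, Exec.seq e1 (Exec.ite_true ?_ e2), hr2, ?_,
        fun x hx => (hf2 x hx).trans (hs1.reg _ (by omega)), hw2⟩
      · intro hc0
        rw [show σ1.reg (4 * 0 + 1) = σ1.reg 1 from rfl, hc0] at hv1
        exact he (by rw [← hv1]; simp)
      · dsimp only at hT2; omega
  | call a r =>
    intro h v Q hwp σ hσ
    obtain ⟨T', σ', u, h1, h2, h3, h4, h5⟩ := exec_callCode hE hA a r hwp hσ
    exact ⟨T', σ', u, h1, h2, h3, fun x _ => h4 x, h5⟩
  | rep r e c ih =>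
    intro h v Q hwp σ hσ
    obtain ⟨hs, hwp⟩ := hwp
    obtain ⟨T1, σ1, e1, hT1, hs1, hv1⟩ := e.exec_compile hE 0 σ v hσ hs
    have hσ1 := hσ.same hs1
    -- The loop, with `N` iterations left.
    have loop : ∀ (N j : ℕ) (v : VS) (σ : State w), N + j < 2 ^ w → Represents E σ v →
        (σ.reg (4 * (2 * h) + 2)).toNat = N → (σ.reg (4 * (2 * h + 1) + 2)).toNat = j →
        wpRep (fun u Q => c.wp E u Q) r N j v Q →
        ∃ T' σ' u, Exec (.loop (4 * (2 * h) + 2)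
          (.seq (.instr (.op .or (4 * r) (4 * (2 * h + 1) + 2) (4 * (2 * h + 1) + 2)))
            (.seq (c.compile E.stored A pat (h + 1))
              (code (.const 1 1) [.op .add (4 * (2 * h + 1) + 2) (4 * (2 * h + 1) + 2) 1,
                .op .sub (4 * (2 * h) + 2) (4 * (2 * h) + 2) 1])))) σ T' σ' ∧ Represents E σ' u ∧
        v.time + T' ≤ u.time + 1 ∧ (∀ x < 2 * h, σ'.reg (4 * x + 2) = σ.reg (4 * x + 2)) ∧
        Q u := by
      intro N
      induction N with
      | zero =>
        intro j v σ _ hσ hN hj hwp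
        exact ⟨_, σ, v, Exec.loop_done (by rw [← BitVec.toNat_inj]; simpa using hN), hσ, le_rfl,
          fun _ _ => rfl, hwp⟩
      | succ N ihN =>
        intro j v σ hlt hσ hN hj hwp
        obtain ⟨σ1, hσ1⟩ : ∃ σ1, σ1 = (Instr.op .or (4 * r) (4 * (2 * h + 1) + 2)
          (4 * (2 * h + 1) + 2)).step σ := ⟨_, rfl⟩
        have e1 := Exec.instr (.op .or (4 * r) (4 * (2 * h + 1) + 2) (4 * (2 * h + 1) + 2)) σ
        rw [← hσ1] at e1
        have hr1 : Represents E σ1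
            { v with reg := Function.update v.reg r j, time := v.time + 5 } := by
          subst hσ1
          refine { arr := hσ.arr, hid := hσ.hid, out := hσ.out, space := hσ.space, inp := hσ.inp,
                   reg := ?_ }
          intro x
          by_cases hx : x = r
          · subst hx; simpa [Instr.step, WordOp.eval] using hj
          · simp only [Instr.step]
            rw [Function.update_of_ne (by omega), Function.update_of_ne hx, hσ.reg]
        have hf1 : ∀ x, σ1.reg (4 * x + 2) = σ.reg (4 * x + 2) := by
          intro x
          subst hσ1
          simp only [Instr.step]
          rw [Function.update_of_ne (by omega)]
        obtain ⟨T2, σ2, u2, e2, hr2, hT2, hf2, hw2⟩ := ih (h + 1) _ _ hwp σ1 hr1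
        have hN2 : (σ2.reg (4 * (2 * h) + 2)).toNat = N + 1 := by
          rw [hf2 _ (by omega), hf1, hN]
        have hj2 : (σ2.reg (4 * (2 * h + 1) + 2)).toNat = j := by
          rw [hf2 _ (by omega), hf1, hj]
        obtain ⟨σ3, hσ3⟩ : ∃ σ3, σ3 = List.foldl (fun σ e => Instr.step e σ)
            ((Instr.const 1 1).step σ2) [.op .add (4 * (2 * h + 1) + 2) (4 * (2 * h + 1) + 2) 1,
                .op .sub (4 * (2 * h) + 2) (4 * (2 * h) + 2) 1] := ⟨_, rfl⟩
        have e3 := exec_code (.const 1 1) [.op .add (4 * (2 * h + 1) + 2) (4 * (2 * h + 1) + 2) 1,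
                .op .sub (4 * (2 * h) + 2) (4 * (2 * h) + 2) 1] σ2
        rw [← hσ3] at e3
        have h1w : (BitVec.ofNat w 1).toNat = 1 := by
          rw [BitVec.toNat_ofNat, Nat.mod_eq_of_lt (by omega)]
        have hr3 : Represents E σ3 u2 := by
          subst hσ3
          refine { arr := hr2.arr, hid := hr2.hid, out := hr2.out, space := hr2.space,
                   inp := hr2.inp, reg := ?_ }
          intro x
          simp only [List.foldl, Instr.step]
          rw [Function.update_of_ne (by omega), Function.update_of_ne (by omega),
            Function.update_of_ne (by omega), hr2.reg]
        have hj3 : (σ3.reg (4 * (2 * h + 1) + 2)).toNat = j + 1 := by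
          subst hσ3
          simp only [List.foldl, Instr.step, WordOp.eval]
          rw [Function.update_of_ne (by omega), Function.update_self,
            Function.update_of_ne (by omega), Function.update_self, BitVec.toNat_add, hj2, h1w,
            Nat.mod_eq_of_lt (by omega)]
        have hN3 : (σ3.reg (4 * (2 * h) + 2)).toNat = N := by
          subst hσ3
          simp only [List.foldl, Instr.step, WordOp.eval]
          rw [Function.update_self, Function.update_of_ne (by omega),
            Function.update_of_ne (by omega), Function.update_of_ne (by omega),
            Function.update_self, BitVec.toNat_sub_of_le, hN2, h1w]
          · rfl
          · rw [BitVec.le_def, hN2, h1w]; omega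
        have hf3 : ∀ x < 2 * h, σ3.reg (4 * x + 2) = σ2.reg (4 * x + 2) := by
          intro x hx
          subst hσ3
          simp only [List.foldl, Instr.step]
          rw [Function.update_of_ne (by omega), Function.update_of_ne (by omega),
            Function.update_of_ne (by omega)]
        obtain ⟨T4, σ4, u4, e4, hr4, hT4, hf4, hw4⟩ :=
          ihN (j + 1) u2 σ3 (by omega) hr3 hN3 hj3 hw2
        refine ⟨_, σ4, u4, Exec.loop_next ?_ (Exec.seq e1 (Exec.seq e2 e3)) e4, hr4, ?_, ?_, hw4⟩
        · intro hc; rw [hc] at hN; simp at hN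
        · simp only [List.length_cons, List.length_nil] at *
          omega
        · intro x hx
          rw [hf4 x hx, hf3 x hx, hf2 x (by omega), hf1]
    obtain ⟨σ2, hσ2⟩ : ∃ σ2, σ2 = List.foldl (fun σ e => Instr.step e σ)
      ((Instr.op .or (4 * (2 * h) + 2) 1 1).step σ1) [.const (4 * (2 * h + 1) + 2) 0] := ⟨_, rfl⟩
    have e2 := exec_code (.op .or (4 * (2 * h) + 2) 1 1) [.const (4 * (2 * h + 1) + 2) 0] σ1
    rw [← hσ2] at e2
    have hlt : e.eval E v < 2 ^ w := by rw [← hv1]; exact BitVec.isLt _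
    obtain ⟨T3, σ3, u3, e3, hr3, hT3, hf3, hw3⟩ := loop (e.eval E v) 0 _ σ2 (by omega) (by
        subst hσ2
        refine { arr := hσ1.arr, hid := hσ1.hid, out := hσ1.out, space := hσ1.space,
                 inp := hσ1.inp, reg := ?_ }
        intro x
        simp only [List.foldl, Instr.step]
        rw [Function.update_of_ne (by omega), Function.update_of_ne (by omega), hσ1.reg])
      (by
        subst hσ2
        simp only [List.foldl, Instr.step, WordOp.eval]
        rw [Function.update_of_ne (by omega), Function.update_self, BitVec.or_self]
        exact hv1)
      (by subst hσ2; simp [Instr.step]) hwp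
    refine ⟨_, σ3, u3, Exec.seq e1 (Exec.seq e2 e3), hr3, ?_, ?_, hw3⟩
    · simp only [List.length_cons, List.length_nil] at *
      omega
    · intro x hx
      rw [hf3 x hx]
      subst hσ2
      simp only [List.foldl, Instr.step]
      rw [Function.update_of_ne (by omega), Function.update_of_ne (by omega), hs1.reg _ (by omega)]

end

/-! ### Matches and their windows -/

section

variable {α : Type*}

theorem EditStep.length_le {A B : List α} (h : EditStep A B) : B.length ≤ A.length + 1 := by
  cases h <;> simp <;> omega

theorem EditSeq.length_le {d : ℕ} {A B : List α} (h : EditSeq d A B) :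
    B.length ≤ A.length + d := by
  induction h with
  | nil => omega
  | cons h _ ih => have := h.length_le; omega

theorem length_le_add_editDistance (A B : List α) : B.length ≤ A.length + editDistance A B := by
  have h : editDistance A B ∈ {d | EditSeq d A B} := Nat.sInf_mem (exists_editSeq A B)
  exact EditSeq.length_le h

/-- Some nonempty suffix of `X` matches `P` with at most `k` errors. -/
def EndsMatch (k : ℕ) (P X : List α) : Prop :=
  ∃ Y, Y ≠ [] ∧ Y <:+ X ∧ editDistance P Y ≤ k

theorem mem_matchSet_iff {k : ℕ} {P S : List α} {j : ℕ} :
    j ∈ matchSet k P S ↔ 1 ≤ j ∧ j ≤ S.length ∧ EndsMatch k P (S.take j) := by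
  simp only [matchSet, Finset.mem_filter, Finset.mem_Icc, and_assoc]
  refine and_congr_right fun h1 => and_congr_right fun h2 => ?_
  constructor
  · rintro ⟨i, hi, hij, hed⟩
    refine ⟨substring S i j, ?_, ?_, hed⟩
    · intro h0
      have := congrArg List.length h0
      simp [substring] at this
      omega
    · have : substring S i j = (S.take j).drop (i - 1) := by
        rw [List.drop_take, substring, show j + 1 - i = j - (i - 1) by omega]
      rw [this]
      exact List.drop_suffix _ _
  · rintro ⟨Y, hY, hs, hed⟩
    have hl := hs.length_le
    have hpos := List.length_pos_iff.2 hY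
    have hlen : (S.take j).length = j := by simp [h2]
    refine ⟨j - Y.length + 1, by omega, by omega, ?_⟩
    have : substring S (j - Y.length + 1) j = Y := by
      have h3 := List.suffix_iff_eq_drop.1 hs
      rw [hlen, List.drop_take] at h3
      rw [substring, Nat.add_sub_cancel,
        show j + 1 - (j - Y.length + 1) = j - (j - Y.length) by omega]
      exact h3.symm
    rwa [this]

/-- Only the last `P.length + k` characters matter for a match. -/
theorem endsMatch_append {k : ℕ} {P X Z : List α} (h : P.length + k ≤ Z.length ∨ X = []) :
    EndsMatch k P (X ++ Z) ↔ EndsMatch k P Z := by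
  rcases h with h | rfl
  · constructor
    · rintro ⟨Y, hY, hs, hed⟩
      have := length_le_add_editDistance P Y
      exact ⟨Y, hY, List.suffix_of_suffix_length_le hs (List.suffix_append X Z) (by omega), hed⟩
    · rintro ⟨Y, hY, hs, hed⟩
      exact ⟨Y, hY, hs.trans (List.suffix_append X Z), hed⟩
  · simp

end

/-! ### The trie of a compressed string -/

namespace Env

variable {w : ℕ} (E : Env w)

/-- The parent of a node of the trie; nodes are numbered from 1, and 0 is the root. The minimum only
matters for nodes beyond the compressed string. -/
def par (v : ℕ) : ℕ := min (E.ref (v - 1)) (v - 1)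

/-- The character on the edge from the parent. -/
def letter (v : ℕ) : BitVec w := BitVec.ofNat w (E.chr (v - 1))

theorem par_lt {v : ℕ} (h : v ≠ 0) : E.par v < v :=
  lt_of_le_of_lt (min_le_right _ _) (by omega)

/-- The phrase of a node. -/
def str (v : ℕ) : List (BitVec w) :=
  if _h : v = 0 then [] else str (E.par v) ++ [E.letter v]
termination_by v
decreasing_by exact E.par_lt ‹_›

/-- The depth of a node. -/
def dep (v : ℕ) : ℕ := (E.str v).length

/-- The concatenation of the first `i` phrases. -/
def textTo : ℕ → List (BitVec w)
  | 0 => []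
  | i + 1 => textTo i ++ E.str (i + 1)

/-- The longest substrings that match have length `P.length + k`. -/
def D : ℕ := E.P.length + E.k

/-- References point backwards, and characters are words. -/
structure Wf : Prop where
  ref_le : ∀ i < E.n, E.ref i ≤ i
  chr_lt : ∀ i < E.n, E.chr i < 2 ^ w
  k_lt : E.k < E.P.length

/-- An internal match ends at the end of the phrase, more than `D` characters after its start. -/
def Flagged (v : ℕ) : Prop := E.D < E.dep v ∧ EndsMatch E.k E.P (E.str v)

open Classical in
/-- The number of flagged nodes among the first `v` nodes. -/
noncomputable def flags (v : ℕ) : ℕ := ((Finset.Icc 1 v).filter E.Flagged).card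

open Classical in
/-- The depths of the flagged ancestors of `v`, including `v` itself. -/
noncomputable def chain (v : ℕ) : List ℕ :=
  if _h : v = 0 then []
  else if E.Flagged v then E.dep v :: chain (E.par v) else chain (E.par v)
termination_by v
decreasing_by all_goals exact E.par_lt ‹_›

/-- The mark of the nearest ancestor of `v`, including `v` itself, that has a nonzero mark. -/
def near (mk : ℕ → ℕ) (v : ℕ) : ℕ :=
  if _h : v = 0 then 0 else if mk v ≠ 0 then mk v else near mk (E.par v)
termination_by v
decreasing_by exact E.par_lt ‹_›

open Classical in
/-- Flagged nodes are marked by their number among the flagged nodes. -/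
noncomputable def flagMark (v : ℕ) : ℕ := if E.Flagged v then E.flags v else 0

/-- Nodes of depth `D` are marked by their own number. -/
def depthMark (v : ℕ) : ℕ := if E.dep v = E.D then v else 0

variable {E}

theorem Wf.par_eq (h : E.Wf) {v : ℕ} (h0 : v ≠ 0) (hv : v ≤ E.n) : E.par v = E.ref (v - 1) :=
  min_eq_left (h.ref_le _ (by omega))

theorem Wf.letter_toNat (h : E.Wf) {v : ℕ} (h0 : v ≠ 0) (hv : v ≤ E.n) :
    (E.letter v).toNat = E.chr (v - 1) := by
  rw [letter, BitVec.toNat_ofNat, Nat.mod_eq_of_lt (h.chr_lt _ (by omega))]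

@[simp] theorem str_zero : E.str 0 = [] := by rw [str]; simp

theorem str_of_ne {v : ℕ} (h : v ≠ 0) : E.str v = E.str (E.par v) ++ [E.letter v] := by
  rw [str]; simp [h]

@[simp] theorem dep_zero : E.dep 0 = 0 := by simp [dep]

theorem dep_of_ne {v : ℕ} (h : v ≠ 0) : E.dep v = E.dep (E.par v) + 1 := by
  simp [dep, str_of_ne h]

theorem dep_eq_zero {v : ℕ} : E.dep v = 0 ↔ v = 0 := by
  constructor
  · intro h; by_contra h0; rw [dep_of_ne h0] at h; omega
  · rintro rfl; simp

theorem dep_le (v : ℕ) : E.dep v ≤ v := by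
  induction v using Nat.strong_induction_on with
  | _ v ih =>
    by_cases h : v = 0
    · subst h; simp
    · have h1 := E.par_lt h
      have := ih _ h1
      rw [dep_of_ne h]; omega

theorem textTo_length_le (i : ℕ) : (E.textTo i).length ≤ i * i := by
  induction i with
  | zero => simp [textTo]
  | succ i ih =>
    have : (E.str (i + 1)).length ≤ i + 1 := dep_le _
    simp only [textTo, List.length_append]
    nlinarith

theorem textTo_length_succ (i : ℕ) :
    (E.textTo (i + 1)).length = (E.textTo i).length + E.dep (i + 1) := by
  simp [textTo, dep]

theorem textTo_prefix {i j : ℕ} (h : i ≤ j) : E.textTo i <+: E.textTo j := by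
  induction h with
  | refl => exact List.prefix_rfl
  | step _ ih => exact ih.trans (List.prefix_append _ _)

theorem textTo_length_lt {i j : ℕ} (h : i < j) : (E.textTo i).length < (E.textTo j).length := by
  have h1 := (textTo_prefix (E := E) (show i + 1 ≤ j from h)).length_le
  rw [textTo_length_succ] at h1
  have : E.dep (i + 1) ≠ 0 := by rw [Ne, dep_eq_zero]; omega
  omega

theorem flags_zero : E.flags 0 = 0 := by simp [flags]

open Classical in
theorem flags_succ (v : ℕ) :
    E.flags (v + 1) = E.flags v + if E.Flagged (v + 1) then 1 else 0 := by
  have : Finset.Icc 1 (v + 1) = insert (v + 1) (Finset.Icc 1 v) := by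
    ext x; simp; omega
  simp only [flags, this, Finset.filter_insert]
  split_ifs
  · rw [Finset.card_insert_of_notMem (by simp)]
  · rfl

theorem flags_mono {u v : ℕ} (h : u ≤ v) : E.flags u ≤ E.flags v := by
  classical
  exact Finset.card_le_card (Finset.filter_subset_filter _ (Finset.Icc_subset_Icc_right h))

theorem flags_of_flagged {v : ℕ} (h : E.Flagged v) : E.flags v = E.flags (v - 1) + 1 := by
  have h0 : v ≠ 0 := by rintro rfl; simpa using h.1
  obtain ⟨u, rfl⟩ := Nat.exists_eq_succ_of_ne_zero h0
  simp [flags_succ, h]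

theorem flags_of_not_flagged {v : ℕ} (h0 : v ≠ 0) (h : ¬ E.Flagged v) :
    E.flags v = E.flags (v - 1) := by
  obtain ⟨u, rfl⟩ := Nat.exists_eq_succ_of_ne_zero h0
  simp [flags_succ, h]

theorem flags_le (v : ℕ) : E.flags v ≤ v := by
  classical
  exact (Finset.card_filter_le _ _).trans (by simp)

/-- Every flagged node yields a match at the end of the corresponding phrase of the text. -/
theorem flags_le_card {N : ℕ} :
    E.flags N ≤ (matchSet E.k E.P (E.textTo N)).card := by
  classical
  refine Finset.card_le_card_of_injOn (fun v => (E.textTo v).length) ?_ ?_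
  · intro v hv
    simp only [Finset.coe_filter, Finset.mem_Icc, Set.mem_ofPred_eq] at hv
    obtain ⟨⟨h1, h2⟩, h3, h4⟩ := hv
    simp only [Finset.mem_coe]
    have hpre := textTo_prefix (E := E) h2
    have hlt := textTo_length_lt (E := E) (show 0 < v by omega)
    refine mem_matchSet_iff.2 ⟨by omega, hpre.length_le, ?_⟩
    rw [List.prefix_iff_eq_take.1 hpre |>.symm]
    obtain ⟨u, rfl⟩ := Nat.exists_eq_succ_of_ne_zero (show v ≠ 0 by omega)
    rw [Nat.succ_eq_add_one, textTo, endsMatch_append]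
    · exact h4
    · left; exact h3.le
  · intro u _ v _ huv
    rcases lt_trichotomy u v with h | h | h
    · have := textTo_length_lt (E := E) h; simp only at huv; omega
    · exact h
    · have := textTo_length_lt (E := E) h; simp only at huv; omega

@[simp] theorem chain_zero : E.chain 0 = [] := by rw [chain]; simp

theorem chain_of_flagged {v : ℕ} (h : E.Flagged v) :
    E.chain v = E.dep v :: E.chain (E.par v) := by
  have h0 : v ≠ 0 := by rintro rfl; simpa using h.1
  rw [chain]; simp [h0, h]

theorem chain_of_not_flagged {v : ℕ} (h0 : v ≠ 0) (h : ¬ E.Flagged v) :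
    E.chain v = E.chain (E.par v) := by
  rw [chain]; simp [h0, h]

theorem mem_chain {v q : ℕ} :
    q ∈ E.chain v ↔ E.D < q ∧ q ≤ E.dep v ∧ EndsMatch E.k E.P ((E.str v).take q) := by
  induction v using Nat.strong_induction_on with
  | _ v ih =>
    by_cases h0 : v = 0
    · subst h0; simp; omega
    have ih := ih _ (E.par_lt h0)
    have hd := E.dep_of_ne h0
    have htake : ∀ q, q ≤ E.dep (E.par v) → (E.str v).take q = (E.str (E.par v)).take q := by
      intro q hq
      rw [str_of_ne h0, List.take_append_of_le_length hq]
    have hself : (E.str v).take (E.dep v) = E.str v := List.take_length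
    by_cases h : E.Flagged v
    · rw [chain_of_flagged h, List.mem_cons, ih]
      constructor
      · rintro (rfl | ⟨h1, h2, h3⟩)
        · exact ⟨h.1, le_rfl, by rw [hself]; exact h.2⟩
        · exact ⟨h1, by omega, by rwa [htake _ h2]⟩
      · rintro ⟨h1, h2, h3⟩
        rcases Nat.eq_or_lt_of_le h2 with h4 | h4
        · exact Or.inl h4
        · exact Or.inr ⟨h1, by omega, by rwa [htake _ (by omega)] at h3⟩
    · rw [chain_of_not_flagged h0 h, ih]
      constructor
      · rintro ⟨h1, h2, h3⟩
        exact ⟨h1, by omega, by rwa [htake _ h2]⟩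
      · rintro ⟨h1, h2, h3⟩
        rcases Nat.eq_or_lt_of_le h2 with rfl | h4
        · rw [hself] at h3
          exact absurd ⟨h1, h3⟩ h
        · exact ⟨h1, by omega, by rwa [htake _ (by omega)] at h3⟩

theorem nodup_chain (v : ℕ) : (E.chain v).Nodup := by
  induction v using Nat.strong_induction_on with
  | _ v ih =>
    by_cases h0 : v = 0
    · subst h0; simp
    have ih := ih _ (E.par_lt h0)
    by_cases h : E.Flagged v
    · rw [chain_of_flagged h, List.nodup_cons]
      refine ⟨fun hm => ?_, ih⟩
      have := (mem_chain.1 hm).2.1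
      rw [dep_of_ne h0] at this
      omega
    · rwa [chain_of_not_flagged h0 h]

@[simp] theorem near_zero (mk : ℕ → ℕ) : E.near mk 0 = 0 := by rw [near]; simp

theorem near_of_mark {mk : ℕ → ℕ} {v : ℕ} (h0 : v ≠ 0) (h : mk v ≠ 0) : E.near mk v = mk v := by
  rw [near]; simp [h0, h]

theorem near_of_not_mark {mk : ℕ → ℕ} {v : ℕ} (h0 : v ≠ 0) (h : mk v = 0) :
    E.near mk v = E.near mk (E.par v) := by
  rw [near]; simp [h0, h]

theorem flagMark_of_flagged {v : ℕ} (h : E.Flagged v) : E.flagMark v = E.flags v := by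
  simp [flagMark, h]

theorem flagMark_of_not_flagged {v : ℕ} (h : ¬ E.Flagged v) : E.flagMark v = 0 := by
  simp [flagMark, h]

/-- The nearest flagged ancestor starts the chain. -/
theorem chain_near (v : ℕ) : (E.near E.flagMark v = 0 ∧ E.chain v = []) ∨
    ∃ z, z ≤ v ∧ E.Flagged z ∧ E.near E.flagMark v = E.flags z ∧
      E.chain v = E.dep z :: E.chain (E.par z) := by
  induction v using Nat.strong_induction_on with
  | _ v ih =>
    by_cases h0 : v = 0
    · subst h0; simp
    by_cases h : E.Flagged v
    · right
      have h1 := flags_of_flagged h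
      have h2 := flagMark_of_flagged h
      exact ⟨v, le_rfl, h, by rw [near_of_mark h0 (by omega), h2], chain_of_flagged h⟩
    · rw [near_of_not_mark h0 (flagMark_of_not_flagged h), chain_of_not_flagged h0 h]
      have hp := E.par_lt h0
      rcases ih _ hp with h1 | ⟨z, hz, h1⟩
      · exact Or.inl h1
      · exact Or.inr ⟨z, by omega, h1⟩

/-- Below depth `D`, the nearest marked ancestor is the prefix of length `D`. -/
theorem near_depthMark {v : ℕ} (h0 : 0 < E.D) (h : E.D ≤ E.dep v) :
    E.near E.depthMark v ≤ v ∧ E.str (E.near E.depthMark v) = (E.str v).take E.D := by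
  induction v using Nat.strong_induction_on with
  | _ v ih =>
    have hv : v ≠ 0 := by rintro rfl; simp at h; omega
    by_cases h1 : E.dep v = E.D
    · rw [near_of_mark hv (by simp [depthMark, h1, hv])]
      simp only [depthMark, h1, if_true, le_refl, true_and]
      rw [← h1]; exact List.take_length.symm
    · have hp := E.par_lt hv
      have hd := E.dep_of_ne hv
      rw [near_of_not_mark hv (by simp [depthMark, h1])]
      obtain ⟨h2, h3⟩ := ih _ hp (by omega)
      refine ⟨by omega, ?_⟩
      rw [h3, str_of_ne hv, List.take_append_of_le_length]
      exact show E.D ≤ E.dep (E.par v) by omega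

/-- The matches of the text after one more phrase. -/
theorem listsExactly_succ {i : ℕ} {l near : List ℕ}
    (hl : ListsExactly l (matchSet E.k E.P (E.textTo i))) (hnear : near.Nodup)
    (hmem : ∀ x, x ∈ near ↔ ∃ q, 1 ≤ q ∧ q ≤ E.D ∧ q ≤ E.dep (i + 1) ∧
      x = (E.textTo i).length + q ∧
      EndsMatch E.k E.P (E.textTo i ++ (E.str (i + 1)).take q)) :
    ListsExactly (l ++ near ++ (E.chain (i + 1)).map fun d => (E.textTo i).length + d)
      (matchSet E.k E.P (E.textTo (i + 1))) := by
  obtain ⟨hnd, hset⟩ := hl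
  have hl' : ∀ x, x ∈ l ↔ x ∈ matchSet E.k E.P (E.textTo i) := by
    intro x; rw [← hset]; simp
  set u := (E.textTo i).length with hu
  constructor
  · rw [List.nodup_append', List.nodup_append']
    refine ⟨⟨hnd, hnear, ?_⟩, (nodup_chain _).map (fun a b h => by simpa using h), ?_⟩
    · intro x hx hx'
      have h1 := (mem_matchSet_iff.1 ((hl' x).1 hx)).2.1
      obtain ⟨q, h2, _, _, h3, _⟩ := (hmem x).1 hx'
      omega
    · intro x hx hx'
      obtain ⟨d, hd, rfl⟩ := List.mem_map.1 hx'
      have hd := mem_chain.1 hd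
      rcases List.mem_append.1 hx with hx | hx
      · have h1 := (mem_matchSet_iff.1 ((hl' _).1 hx)).2.1
        omega
      · obtain ⟨q, h2, h4, _, h3, _⟩ := (hmem _).1 hx
        omega
  · ext x
    have hlen := E.textTo_length_succ i
    rw [← hu] at hlen
    simp only [List.mem_toFinset, List.mem_append, List.mem_map, hl', hmem, mem_matchSet_iff,
      mem_chain, hlen]
    have hle : ∀ y, y ≤ u → (E.textTo (i + 1)).take y = (E.textTo i).take y := fun y hy => by
      rw [textTo, List.take_append_of_le_length hy]
    have hgt : ∀ q, (E.textTo (i + 1)).take (u + q) = E.textTo i ++ (E.str (i + 1)).take q :=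
      fun q => by rw [textTo, hu, List.take_length_add_append]
    constructor
    · rintro ((⟨h1, h2, h3⟩ | ⟨q, h1, h2, h3, rfl, h4⟩) | ⟨d, ⟨h1, h2, h3⟩, rfl⟩)
      · exact ⟨h1, by omega, by rwa [hle _ (by omega)]⟩
      · exact ⟨by omega, by omega, by rwa [hgt]⟩
      · refine ⟨by omega, by omega, ?_⟩
        rw [hgt, endsMatch_append]
        · exact h3
        · left
          rw [List.length_take]
          have : (E.str (i + 1)).length = E.dep (i + 1) := rfl
          simp only [D] at h1
          omega
    · rintro ⟨h1, h2, h3⟩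
      by_cases hx : x ≤ u
      · exact Or.inl (Or.inl ⟨h1, hx, by rwa [hle _ hx] at h3⟩)
      · obtain ⟨q, rfl⟩ := Nat.exists_eq_add_of_le (show u ≤ x by omega)
        rw [hgt] at h3
        by_cases hq : q ≤ E.D
        · exact Or.inl (Or.inr ⟨q, by omega, hq, by omega, rfl, h3⟩)
        · refine Or.inr ⟨q, ⟨by omega, by omega, ?_⟩, rfl⟩
          rwa [endsMatch_append] at h3
          left
          rw [List.length_take]
          have : (E.str (i + 1)).length = E.dep (i + 1) := rfl
          simp only [D] at hq
          omega

/-- The last `min (X.length) D` characters of the preceding text `X` decide about the matches that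
end within the first `D` characters of a phrase `Y`. -/
theorem mem_matchSet_window {X Y W : List (BitVec w)} {g l q : ℕ} (hg : g = min X.length E.D)
    (hl : l ≤ Y.length) (hW : W.take (g + l) = X.drop (X.length - g) ++ Y.take l)
    (hq : 1 ≤ q) (hql : q ≤ l) :
    g + q ∈ matchSet E.k E.P W ↔ EndsMatch E.k E.P (X ++ Y.take q) := by
  have hlen : (W.take (g + l)).length = g + l := by
    rw [hW]; simp; omega
  have hWl : g + l ≤ W.length := by
    rw [List.length_take] at hlen; omega
  have hdrop : (X.drop (X.length - g)).length = g := by simp; omega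
  have htake : W.take (g + q) = X.drop (X.length - g) ++ Y.take q := by
    have : W.take (g + q) = (W.take (g + l)).take (g + q) := by
      rw [List.take_take, min_eq_left (by omega)]
    rw [this, hW]
    generalize X.drop (X.length - g) = A at hdrop
    rw [← hdrop, List.take_length_add_append, List.take_take, min_eq_left hql]
  rw [mem_matchSet_iff, htake]
  conv_rhs => rw [← List.take_append_drop (X.length - g) X, List.append_assoc]
  rw [endsMatch_append (X := X.take (X.length - g))]
  · constructor
    · exact fun h => h.2.2
    · exact fun h => ⟨by omega, by omega, h⟩
  · by_cases h : X.length ≤ E.D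
    · right; rw [hg, min_eq_left h]; simp
    · left; rw [List.length_append, hdrop]; simp only [D] at hg h; omega

/-- The last `D` characters of a phrase decide whether a match ends at its end. -/
theorem mem_matchSet_suffix {Y W : List (BitVec w)} (h0 : 0 < E.D) (hY : E.D ≤ Y.length)
    (hW : W.take E.D = Y.drop (Y.length - E.D)) :
    E.D ∈ matchSet E.k E.P W ↔ EndsMatch E.k E.P Y := by
  have hlen : (W.take E.D).length = E.D := by rw [hW]; simp; omega
  have hWl : E.D ≤ W.length := by rw [List.length_take] at hlen; omega
  rw [mem_matchSet_iff, hW]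
  conv_rhs => rw [← List.take_append_drop (Y.length - E.D) Y]
  rw [endsMatch_append]
  · exact ⟨fun h => h.2.2, fun h => ⟨h0, hWl, h⟩⟩
  · left; simp only [List.length_drop, D] at *; omega

end Env

/-! ### The search program

The variables of the program are used as follows.

| variable | meaning |
| --- | --- |
| 0, 1, 2, 3 | number of nodes, pattern length, threshold, bound on the number of blocks |
| 4 | size of the alphabet (ZLW only) |
| 5, 6, 7 | `D`, size of a block, `2 * D` |
| 8, 29 | number of flagged nodes found, and before the current block |
| 9, 10 | length of the text before the current phrase, length of the window |
| 11, 12, 13 | current block: number, first node, number of nodes |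
| 14 | position in the list of flagged nodes |
| 15, 16, 19 | loop counters |
| 17, 18 | visited block: first node, number of nodes |
| 20, 21, 22, 28 | temporary values |
| 23, 24 | number of characters to be read, number of matches found by the last call |
| 25 | position in the chain of flagged ancestors |
| 26, 27 | current node and its depth |

The arrays are used as follows.

| array | contents |
| --- | --- |
| 0, 1 | texts for the calls: last characters of a phrase; window |
| 2, 3 | matches found by the last call; memory of the matching algorithm |
| 4, 5, 6 | queries: ancestor reached, distance, mark found |
| 7, 8 | depths and nearest flagged proper ancestors of the nodes of the current block |
| 9, 10, 11 | table for the visited block: ancestor outside, distance, mark |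
| 12 | flagged nodes |
| 13, 14, 15 | for flagged nodes: depth, next flagged ancestor, number of flagged ancestors |
| 29, 30, 31 | for ZLW: first characters of the phrases, references, characters |
-/

infixl:65 " ⊕ " => Ex.bin BinOp.add
infixl:65 " ⊖ " => Ex.bin BinOp.sub
infixl:70 " ⊗ " => Ex.bin BinOp.mul
infixl:70 " ⊘ " => Ex.bin BinOp.div
infix:50 " ≺ " => Ex.bin BinOp.lt
infix:50 " ≐ " => Ex.bin BinOp.eq
infixr:30 " ;; " => Cmd.seq

/-- `u` arises from `v` by changes of the variables `R`, the arrays `A` and the time. -/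
structure Keeps (R A : List ℕ) (v u : VS) : Prop where
  reg : ∀ r, r ∉ R → u.reg r = v.reg r
  arr : ∀ a, a ∉ A → u.arr a = v.arr a
  out : u.out = v.out

namespace Keeps

theorem refl (R A : List ℕ) (v : VS) : Keeps R A v v := ⟨fun _ _ => rfl, fun _ _ => rfl, rfl⟩

theorem trans {R A : List ℕ} {v u x : VS} (h : Keeps R A v u) (h' : Keeps R A u x) :
    Keeps R A v x :=
  ⟨fun r hr => (h'.reg r hr).trans (h.reg r hr), fun a ha => (h'.arr a ha).trans (h.arr a ha),
    h'.out.trans h.out⟩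

theorem mono {R A R' A' : List ℕ} {v u : VS} (h : Keeps R A v u) (hR : R ⊆ R') (hA : A ⊆ A') :
    Keeps R' A' v u :=
  ⟨fun r hr => h.reg r fun h' => hr (hR h'), fun a ha => h.arr a fun h' => ha (hA h'), h.out⟩

theorem mk' {R A : List ℕ} {v u : VS} {f : ℕ → ℕ} {g : ℕ → ℕ → ℕ} {t : ℕ} (h : Keeps R A v u)
    (hf : ∀ r, r ∉ R → f r = u.reg r) (hg : ∀ a, a ∉ A → g a = u.arr a) :
    Keeps R A v ⟨f, g, u.out, t⟩ :=
  ⟨fun r hr => (hf r hr).trans (h.reg r hr), fun a ha => (hg a ha).trans (h.arr a ha), h.out⟩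

end Keeps

/-- Size assumptions on the environment; `b` is the block size. -/
structure Env.Roomy {w : ℕ} (E : Env w) (b : ℕ) : Prop where
  fits : E.Fits
  wf : E.Wf
  vis : 16 ≤ E.vis
  b_pos : 0 < b
  b_le : b ≤ E.L
  D_le : 2 * E.D ≤ E.L
  flags_lt : E.flags E.n < E.L
  word : (E.n + 1) * (E.n + 1) + 8 * (E.n + b + E.D + 8) ≤ 2 ^ w

theorem Env.Wf.D_pos {w : ℕ} {E : Env w} (h : E.Wf) : 0 < E.D := by
  have := h.k_lt
  simp only [Env.D]; omega

/-- The last characters of the phrase of the node in the variable `20` go to the array `a`, as many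
as the variable `23` says, from the position in the variable `28` on. -/
def walk (a : ℕ) : Cmd :=
  .rep 19 (.var 23) (.ite (.var 20)
    (.put a (.var 28 ⊕ ((.var 23 ⊖ .lit 1) ⊖ .var 19)) (.chr (.var 20 ⊖ .lit 1)) ;;
      .set 20 (.ref (.var 20 ⊖ .lit 1)))
    .skip)

section

variable {w : ℕ} {E : Env w} {b : ℕ}

theorem wp_walk (hE : E.Roomy b) (a : ℕ) (ha : a < 16) {v : VS} {x l p : ℕ} (hx : v.reg 20 = x)
    (hl : v.reg 23 = l) (hp : v.reg 28 = p) (hxn : x ≤ E.n) (hpl : p + l ≤ 2 * E.D) :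
    (walk a).wp E v fun u => Keeps [19, 20] [a] v u ∧ u.time ≤ v.time + 50 * l + 50 ∧
      (u.reg 20 = 0 ↔ E.dep x ≤ l) ∧
      (∀ i, i < l → l ≤ i + E.dep x →
        u.arr a (p + i) = ((E.str x).getD (E.dep x + i - l) 0).toNat) ∧
      (∀ i, i < p ∨ p + l ≤ i → u.arr a i = v.arr a i) := by
  have hw := hE.word
  have hDL := hE.D_le
  have hvis := hE.vis
  refine Cmd.wp_rep (fun j u => Keeps [19, 20] [a] v u ∧ u.time ≤ v.time + 50 * j + 50 ∧
    u.reg 20 ≤ E.n ∧ E.str (u.reg 20) = (E.str x).take (E.dep x - j) ∧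
    (∀ i, i < l → l ≤ i + E.dep x → l ≤ i + j →
        u.arr a (p + i) = ((E.str x).getD (E.dep x + i - l) 0).toNat) ∧
    (∀ i, i < p ∨ p + l ≤ i → u.arr a i = v.arr a i)) trivial ?_ ?_ ?_
  · refine ⟨Keeps.mk' (.refl _ _ _) (fun _ _ => rfl) fun _ _ => rfl, ?_, ?_, ?_, ?_, ?_⟩
    · simp [Ex.cost]
    · simpa [hx] using hxn
    · simp [hx, Env.dep]
    · intro i h1 h2 h3; omega
    · intros; rfl
  · rintro j hj u ⟨hk, ht, hn, hs, hc, hf⟩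
    have r23 := hk.reg 23 (by decide)
    have r28 := hk.reg 28 (by decide)
    simp only [Ex.eval, hl] at hj
    rw [hl] at r23
    rw [hp] at r28
    have hdep : E.dep (u.reg 20) = E.dep x - j := by
      have := congrArg List.length hs
      rw [List.length_take] at this
      simp only [Env.dep] at *
      omega
    simp only [Cmd.wp, Ex.Safe, Ex.eval, BinOp.eval, BinOp.Safe, Ex.cost, Function.update_apply,
      Nat.reduceEqDiff, if_true, if_false, r23, r28, and_assoc, true_and, ne_eq]
    refine ⟨?_, ?_⟩
    · intro h0
      have hpar := hE.wf.par_eq h0 hn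
      have hlet := hE.wf.letter_toNat h0 hn
      have hlt := E.par_lt h0
      have hd := E.dep_of_ne h0
      rw [← hpar]
      repeat refine ⟨by omega, ?_⟩
      refine ⟨hk.mk' ?_ ?_, by omega, by omega, ?_, ?_, ?_⟩
      · intro r hr; simp at hr; simp [hr]
      · intro r hr; simp at hr; simp [hr]
      · rw [Env.str_of_ne h0] at hs
        have := congrArg List.dropLast hs
        rw [List.dropLast_concat] at this
        have hlt : E.dep x - j ≤ (E.str x).length := by simp [Env.dep]
        rw [this, List.dropLast_eq_take, List.take_take, List.length_take, min_eq_left hlt,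
          min_eq_left (by omega), Nat.sub_sub]
      · intro i h1 h2 h3
        by_cases hi : i + j + 1 = l
        · rw [if_pos (by omega), ← hlet]
          have h4 : E.dep x + i - l = E.dep (E.par (u.reg 20)) := by omega
          have h5 : ((E.str x).take (E.dep x - j)).getD (E.dep x + i - l) 0 =
              E.letter (u.reg 20) := by
            rw [← hs, Env.str_of_ne h0, h4]
            simp [Env.dep]
          rw [← h5]
          simp only [List.getD_eq_getElem?_getD]
          rw [List.getElem?_take_of_lt (by omega)]
        · rw [if_neg (by omega)]
          exact hc i h1 h2 (by omega)
      · intro i hi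
        rw [if_neg (by omega)]
        exact hf i hi
    · intro h0
      rw [h0, Env.dep_zero] at hdep
      refine ⟨hk.mk' ?_ ?_, by omega, by omega, ?_, ?_, ?_⟩
      · intro r hr; simp at hr; simp [hr]
      · intro r hr; simp at hr; simp
      · rw [h0, show E.dep x - (j + 1) = 0 by omega]; simp
      · intro i h1 h2 h3
        exact hc i h1 h2 (by omega)
      · exact hf
  · rintro u ⟨hk, ht, hn, hs, hc, hf⟩
    simp only [Ex.eval, hl] at *
    refine ⟨hk, ht, ?_, fun i h1 h2 => hc i h1 h2 (by omega), hf⟩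
    have := congrArg List.length hs
    rw [List.length_take] at this
    rw [← Env.dep_eq_zero (E := E)]
    simp only [Env.dep] at *
    omega

/-- The variables that hold the parameters. -/
structure Params (E : Env w) (b : ℕ) (v : VS) : Prop where
  r0 : v.reg 0 = E.n
  r1 : v.reg 1 = E.P.length
  r2 : v.reg 2 = E.k
  r5 : v.reg 5 = E.D
  r6 : v.reg 6 = b
  r7 : v.reg 7 = 2 * E.P.length + 2 * E.k

theorem Params.keeps {R A : List ℕ} {v u : VS} (h : Params E b v) (hk : Keeps R A v u)
    (hR : ∀ r ∈ R, 7 < r) : Params E b u := by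
  have aux : ∀ r ≤ 7, u.reg r = v.reg r := fun r hr =>
    hk.reg r fun h' => by have := hR r h'; omega
  exact ⟨by rw [aux 0 (by decide), h.r0], by rw [aux 1 (by decide), h.r1],
    by rw [aux 2 (by decide), h.r2], by rw [aux 5 (by decide), h.r5],
    by rw [aux 6 (by decide), h.r6], by rw [aux 7 (by decide), h.r7]⟩

/-- Decides whether `D` is among the matches found by the last call. -/
def findEnd : Cmd :=
  .rep 19 (.var 24) (.ite (.get 2 (.var 19) ≐ .var 5) (.set 22 (.lit 1)) .skip)

theorem wp_findEnd (hE : E.Roomy b) {v : VS} (hS : Params E b v) (h22 : v.reg 22 = 0)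
    (h24 : v.reg 24 ≤ 2 * E.D) :
    findEnd.wp E v fun u => Keeps [19, 22] [] v u ∧ u.time ≤ v.time + 20 * v.reg 24 + 20 ∧
      (u.reg 22 ≠ 0 ↔ ∃ i < v.reg 24, v.arr 2 i = E.D) := by
  have hw := hE.word
  have hDL := hE.D_le
  have hvis := hE.vis
  refine Cmd.wp_rep (fun j u => Keeps [19, 22] [] v u ∧ u.time ≤ v.time + 20 * j + 20 ∧
      (u.reg 22 ≠ 0 ↔ ∃ i < j, v.arr 2 i = E.D)) trivial ?_ ?_ ?_
  · exact ⟨Keeps.mk' (.refl _ _ _) (fun _ _ => rfl) fun _ _ => rfl, by simp [Ex.cost],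
      by simp [h22]⟩
  · rintro j hj u ⟨hk, ht, hi⟩
    have r5 := (hS.keeps hk (by decide)).r5
    have a2 := hk.arr 2 (by decide)
    simp only [Ex.eval] at hj
    simp only [Cmd.wp, Ex.Safe, Ex.eval, BinOp.eval, BinOp.Safe, Ex.cost, Function.update_apply,
      Nat.reduceEqDiff, if_true, if_false, r5, a2, and_assoc, true_and, ne_eq]
    repeat refine ⟨by omega, ?_⟩
    refine ⟨fun h => ?_, fun h => ?_⟩
    · have h : v.arr 2 j = E.D := by simpa using h
      refine ⟨by omega, ⟨hk.mk' ?_ fun _ _ => rfl, by omega, ?_⟩⟩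
      · intro r hr; simp at hr; simp [hr]
      · exact ⟨fun _ => ⟨j, by omega, h⟩, fun _ => by simp⟩
    · have h : v.arr 2 j ≠ E.D := by simpa using h
      refine ⟨hk.mk' ?_ fun _ _ => rfl, by omega, ?_⟩
      · intro r hr; simp at hr; simp [hr]
      · refine hi.trans ⟨fun ⟨i, h1, h2⟩ => ⟨i, by omega, h2⟩, fun ⟨i, h1, h2⟩ => ⟨i, ?_, h2⟩⟩
        rcases Nat.lt_succ_iff_lt_or_eq.1 h1 with h3 | rfl
        · exact h3
        · exact absurd h2 h
  · rintro u h
    exact h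

/-- Decides for every node of the current block whether it is flagged, and appends the flagged nodes
to the array `12`. The depth of a node exceeds `D` if the walk over `D` edges does not arrive at
the root. -/
def findFlags : Cmd :=
  .rep 15 (.var 13) (
    .set 26 (.var 12 ⊕ .var 15) ;; .set 20 (.var 26) ;; .set 23 (.var 5) ;; .set 28 (.lit 0) ;;
    walk 0 ;;
    .ite (.var 20) (
      .call 0 24 ;; .set 22 (.lit 0) ;; findEnd ;;
      .ite (.var 22) (.set 8 (.var 8 ⊕ .lit 1) ;; .put 12 (.var 8) (.var 26)) .skip)
      .skip)

/-- The flagged nodes up to `x` are listed in the array `12`, starting at the position 1. -/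
structure FlagTable (E : Env w) (v : VS) (x : ℕ) : Prop where
  zero : v.arr 12 0 = 0
  mem : ∀ y ≤ x, E.Flagged y → v.arr 12 (E.flags y) = y

theorem take_matchesIn_text {v : VS} {a l : ℕ} (hl : l ≤ 2 * E.D) {X : List (BitVec w)}
    (hX : X.length = l) (h : ∀ i < l, v.arr a i = (X.getD i 0).toNat) :
    ((List.range (2 * E.P.length + 2 * E.k)).map fun i => BitVec.ofNat w (v.arr a i)).take l =
      X := by
  apply List.ext_getElem
  · simp [hX, Env.D] at *; omega
  · intro i h1 h2
    have := h i (by omega)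
    rw [List.getD_eq_getElem _ _ h2] at this
    simp [this]

theorem matchesIn_length_le (v : VS) (a : ℕ) : (Cmd.matchesIn E v a).length ≤ 2 * E.D := by
  rw [Cmd.matchesIn, Finset.length_sort]
  refine (Finset.card_le_card (matchSet_subset _ _ _)).trans ?_
  simp [Env.D]; omega

theorem wp_findFlags (hE : E.Roomy b) {v : VS} (hS : Params E b v) {lo cb : ℕ}
    (h12 : v.reg 12 = lo) (h13 : v.reg 13 = cb) (hlo : 0 < lo) (hcb : lo + cb ≤ E.n + 1)
    (h8 : v.reg 8 = E.flags (lo - 1)) (hT : FlagTable E v (lo - 1)) :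
    findFlags.wp E v fun u => Keeps [8, 15, 19, 20, 22, 23, 24, 26, 28] [0, 2, 3, 12] v u ∧
      u.time ≤ v.time + 200 * (cb * (E.D + E.callTime + 1)) + 200 ∧
      u.reg 8 = E.flags (lo + cb - 1) ∧ FlagTable E u (lo + cb - 1) := by
  have hw := hE.word
  have hDL := hE.D_le
  have hvis := hE.vis
  have hfl := hE.flags_lt
  have hD0 := hE.wf.D_pos
  refine Cmd.wp_rep (fun j u => Keeps [8, 15, 19, 20, 22, 23, 24, 26, 28] [0, 2, 3, 12] v u ∧
      u.time ≤ v.time + 200 * (j * (E.D + E.callTime + 1)) + 200 ∧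
      u.reg 8 = E.flags (lo + j - 1) ∧ FlagTable E u (lo + j - 1)) trivial ?_ ?_ ?_
  · exact ⟨Keeps.mk' (.refl _ _ _) (fun _ _ => rfl) fun _ _ => rfl, by simp [Ex.cost],
      h8, ⟨hT.1, hT.2⟩⟩
  · rintro j hj u ⟨hk, ht, hF, hTu⟩
    simp only [Ex.eval, h13] at hj
    have hSu := hS.keeps hk (by decide)
    have r5 := hSu.r5
    have r12 := hk.reg 12 (by decide)
    rw [h12] at r12
    simp only [Cmd.wp, Ex.Safe, Ex.eval, BinOp.eval, BinOp.Safe, Ex.cost, Function.update_apply,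
      Nat.reduceEqDiff, if_true, if_false, r5, r12, and_assoc, true_and, ne_eq]
    repeat refine ⟨by omega, ?_⟩
    refine Cmd.wp_mono E _ (wp_walk hE 0 (by decide) (x := lo + j) (l := E.D) (p := 0)
      ?_ ?_ ?_ (by omega) (by omega)) ?_
    iterate 3 simp
    rintro x ⟨hkx, htx, h20, hcont, -⟩
    have hkx' : Keeps [8, 15, 19, 20, 22, 23, 24, 26, 28] [0, 2, 3, 12] v x := by
      refine hk.trans (Keeps.trans ?_ (hkx.mono (by decide) (by decide)))
      exact Keeps.mk' (.refl _ _ _) (by intro r hr; simp at hr; simp [hr]) fun _ _ => rfl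
    have hSx := hS.keeps hkx' (by decide)
    have x26 : x.reg 26 = lo + j := by
      rw [hkx.reg 26 (by decide)]; simp
    have x8 : x.reg 8 = E.flags (lo + j - 1) := by
      rw [hkx.reg 8 (by decide)]; simpa using hF
    have x12 : x.arr 12 = u.arr 12 := hkx.arr 12 (by decide)
    have hTx : FlagTable E x (lo + j - 1) := ⟨by rw [x12]; exact hTu.1, by rw [x12]; exact hTu.2⟩
    simp only at htx
    have hmul : (j + 1) * (E.D + E.callTime + 1) =
      j * (E.D + E.callTime + 1) + (E.D + E.callTime + 1) := by ring
    have hv0 : lo + j ≠ 0 := by omega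
    have hfle : E.flags (lo + j) ≤ E.flags E.n := Env.flags_mono (by omega)
    have hfle' := E.flags_le E.n
    -- The table if the node is not flagged.
    have hskip : ¬ E.Flagged (lo + j) → E.flags (lo + (j + 1) - 1) = E.flags (lo + j - 1) ∧
        ∀ y : VS, y.arr 12 = x.arr 12 → FlagTable E y (lo + (j + 1) - 1) := by
      intro hnf
      refine ⟨?_, fun y hy => ⟨by rw [hy]; exact hTx.1, fun z hz hzf => ?_⟩⟩
      · rw [show lo + (j + 1) - 1 = lo + j by omega, Env.flags_of_not_flagged hv0 hnf]
      · rw [hy]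
        refine hTx.2 z ?_ hzf
        have : z ≠ lo + j := by rintro rfl; exact hnf hzf
        omega
    refine ⟨fun h0 => ?_, fun h0 => ?_⟩
    · have hdep : E.D < E.dep (lo + j) := by
        by_contra hc; exact h0 (h20.2 (by omega))
      have hW := take_matchesIn_text (E := E) (v := { x with time := x.time + (1 + 1) }) (a := 0)
        (l := E.D) (by omega) (X := (E.str (lo + j)).drop (E.dep (lo + j) - E.D))
        (by simp only [List.length_drop, Env.dep] at *; omega) (by
          intro i hi
          have := hcont i hi (by omega)
          rw [Nat.zero_add] at this
          dsimp only
          rw [this]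
          simp only [List.getD_eq_getElem?_getD, List.getElem?_drop]
          rw [show E.dep (lo + j) + i - E.D = E.dep (lo + j) - E.D + i by omega])
      have hiff := Env.mem_matchSet_suffix hD0 hdep.le hW
      refine ⟨by omega, by decide, by decide, hSx.r1, hSx.r2, hSx.r7, fun f hf2 hf => ?_⟩
      have hlen := matchesIn_length_le (E := E) { x with time := x.time + (1 + 1) } 0
      set M := Cmd.matchesIn E { x with time := x.time + (1 + 1) } 0 with hM
      have hkf : ∀ t, Keeps [8, 15, 19, 20, 22, 23, 24, 26, 28] [0, 2, 3, 12] v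
          ⟨Function.update (Function.update x.reg 24 M.length) 22 0, f, x.out, t⟩ := fun t => by
        refine hkx'.mk' ?_ ?_
        · intro r hr; simp at hr; simp [hr]
        · intro r hr; simp at hr; exact hf r (by tauto) (by tauto)
      refine ⟨by omega, ?_⟩
      refine Cmd.wp_mono E _ (wp_findEnd hE (hS.keeps (hkf _) (by decide)) ?_ ?_) ?_
      · simp
      · simpa using hlen
      rintro y ⟨hky, hty, h22⟩
      simp at hty h22
      have hflag : y.reg 22 ≠ 0 ↔ E.Flagged (lo + j) := by
        rw [Ne, h22]
        have : E.Flagged (lo + j) ↔ EndsMatch E.k E.P (E.str (lo + j)) :=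
          ⟨fun h => h.2, fun h => ⟨hdep, h⟩⟩
        rw [this, ← hiff]
        have hmem : ∀ d, d ∈ M ↔ d ∈ matchSet E.k E.P _ := fun d => Finset.mem_sort (· ≤ ·)
        rw [← hmem, List.mem_iff_getElem]
        constructor
        · rintro ⟨i, hi, h⟩
          exact ⟨i, hi, by rw [← h, hf2 i hi]⟩
        · rintro ⟨i, hi, h⟩
          exact ⟨i, hi, by rw [hf2 i hi, h]⟩
      have hky' : Keeps [8, 15, 19, 20, 22, 23, 24, 26, 28] [0, 2, 3, 12] v y :=
        (hkf _).trans (hky.mono (by decide) (by decide))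
      have y26 : y.reg 26 = lo + j := by rw [hky.reg 26 (by decide)]; simp [x26]
      have y8 : y.reg 8 = E.flags (lo + j - 1) := by rw [hky.reg 8 (by decide)]; simp [x8]
      have y12 : y.arr 12 = x.arr 12 := by
        rw [hky.arr 12 (by decide)]; exact hf 12 (by decide) (by decide)
      refine ⟨fun h1 => ?_, fun h1 => ?_⟩
      · have hfl' := hflag.1 h1
        have hcount := Env.flags_of_flagged hfl'
        rw [y26, y8]
        repeat refine ⟨by omega, ?_⟩
        rw [show lo + (j + 1) - 1 = lo + j by omega, ← hcount]
        refine ⟨hky'.mk' ?_ ?_, by omega, rfl, ?_, ?_⟩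
        · intro r hr; simp at hr; simp [hr]
        · intro r hr; simp at hr; simp [hr]
        · simp [y12, hTx.1, show (0 : ℕ) ≠ E.flags (lo + j) by omega]
        · intro z hz hzf
          by_cases hzv : z = lo + j
          · subst hzv; simp
          · have h3 : E.flags z ≤ E.flags (lo + j - 1) := Env.flags_mono (by omega)
            simp only [Function.update_self]
            rw [Function.update_of_ne (by omega), y12]
            exact hTx.2 z (by omega) hzf
      · have hnf : ¬ E.Flagged (lo + j) := fun h => (hflag.2 h) h1
        obtain ⟨h3, h4⟩ := hskip hnf
        refine ⟨hky'.mk' (fun _ _ => rfl) fun _ _ => rfl, by omega, y8.trans h3.symm, h4 _ y12⟩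
    · have hnf : ¬ E.Flagged (lo + j) := fun h => by
        have := h20.1 h0; have := h.1; omega
      obtain ⟨h3, h4⟩ := hskip hnf
      refine ⟨hkx'.mk' (fun _ _ => rfl) fun _ _ => rfl, by omega, x8.trans h3.symm, h4 _ rfl⟩
  · rintro u ⟨h1, h2, h3, h4⟩
    simp only [Ex.eval, h13] at *
    exact ⟨h1, h2, h3, h4⟩

end

/-! ### Ancestor queries for one block

The nodes are divided into blocks of `b` consecutive numbers. A query asks for the depth of a node
and for its nearest marked proper ancestor. The queries of one block are answered together, by going
through all blocks up to this one in descending order. -/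

section

variable {w : ℕ} {E : Env w} {b : ℕ}

/-- Starts the queries of the current block: the arrays `4`, `5` and `6` hold the ancestors that
have been reached, their distances, and the marks found so far. -/
def startQueries : Cmd :=
  .rep 15 (.var 13) (
    .put 4 (.var 15) (.ref ((.var 12 ⊕ .var 15) ⊖ .lit 1)) ;; .put 5 (.var 15) (.lit 1) ;;
    .put 6 (.var 15) (.lit 0))

/-- The query for the node `lo + j` has passed all nodes from `hi` on. -/
def QueryAt (E : Env w) (mk : ℕ → ℕ) (lo hi j : ℕ) (v : VS) : Prop :=
  v.arr 4 j < hi ∧ v.arr 5 j + E.dep (v.arr 4 j) = E.dep (lo + j) ∧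
    (v.arr 6 j ≠ 0 → E.near mk (E.par (lo + j)) = v.arr 6 j) ∧
    (v.arr 6 j = 0 → E.near mk (E.par (lo + j)) = E.near mk (v.arr 4 j))

/-- All queries for the nodes `lo, …, lo + cb - 1` have passed all nodes from `hi` on. -/
def Queries (E : Env w) (mk : ℕ → ℕ) (lo cb hi : ℕ) (v : VS) : Prop :=
  ∀ j < cb, QueryAt E mk lo hi j v

theorem wp_startQueries (hE : E.Roomy b) {v : VS} {lo cb : ℕ}
    (h12 : v.reg 12 = lo) (h13 : v.reg 13 = cb) (hlo : 0 < lo) (hcb : lo + cb ≤ E.n + 1)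
    (hb : cb ≤ b) (mk : ℕ → ℕ) :
    startQueries.wp E v fun u => Keeps [15] [4, 5, 6] v u ∧ u.time ≤ v.time + 50 * cb + 50 ∧
      Queries E mk lo cb (lo + cb) u := by
  have hw := hE.word
  have hbL := hE.b_le
  have hvis := hE.vis
  refine Cmd.wp_rep (fun j u => Keeps [15] [4, 5, 6] v u ∧ u.time ≤ v.time + 50 * j + 50 ∧
      ∀ i < j, u.arr 4 i = E.par (lo + i) ∧ u.arr 5 i = 1 ∧ u.arr 6 i = 0) trivial ?_ ?_ ?_
  · exact ⟨Keeps.mk' (.refl _ _ _) (fun _ _ => rfl) fun _ _ => rfl, by simp [Ex.cost],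
      fun i hi => by omega⟩
  · rintro j hj u ⟨hk, ht, hq⟩
    simp only [Ex.eval, h13] at hj
    have r12 := hk.reg 12 (by decide)
    rw [h12] at r12
    have hpar := hE.wf.par_eq (v := lo + j) (by omega) (by omega)
    simp only [Cmd.wp, Ex.Safe, Ex.eval, BinOp.eval, BinOp.Safe, Ex.cost, Function.update_apply,
      Nat.reduceEqDiff, if_true, if_false, r12, and_assoc, true_and, ← hpar]
    repeat refine ⟨by omega, ?_⟩
    refine ⟨hk.mk' ?_ ?_, by omega, ?_⟩
    · intro r hr; simp at hr; simp [hr]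
    · intro r hr; simp at hr; simp [hr]
    · intro i hi
      by_cases hij : i = j
      · subst hij; simp
      · simpa [hij] using hq i (by omega)
  · rintro u ⟨h1, h2, h3⟩
    simp only [Ex.eval, h13] at *
    refine ⟨h1, h2, fun j hj => ?_⟩
    obtain ⟨h4, h5, h6⟩ := h3 j hj
    have := E.par_lt (v := lo + j) (by omega)
    have := E.dep_of_ne (v := lo + j) (by omega)
    rw [QueryAt, h4, h5, h6]
    exact ⟨by omega, by omega, by simp, by simp⟩

/-- Tabulates, for the nodes of a block, the first ancestor outside of the block (array `9`), its
distance (array `10`), and the nearest mark on the way (array `11`, which holds the marks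
before). -/
def buildTable : Cmd :=
  .rep 19 (.var 18) (
    .set 21 (.ref ((.var 17 ⊕ .var 19) ⊖ .lit 1)) ;;
    .ite (.var 21 ≺ .var 17)
      (.put 9 (.var 19) (.var 21) ;; .put 10 (.var 19) (.lit 1))
      (.put 9 (.var 19) (.get 9 (.var 21 ⊖ .var 17)) ;;
        .put 10 (.var 19) (.get 10 (.var 21 ⊖ .var 17) ⊕ .lit 1) ;;
        .ite (.get 11 (.var 19)) .skip (.put 11 (.var 19) (.get 11 (.var 21 ⊖ .var 17)))))

/-- The entry of the table for the node `q` is correct; the mark only if `G` holds. -/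
def TableEntry (E : Env w) (mk : ℕ → ℕ) (G : ℕ → Prop) (slo q : ℕ) (v : VS) : Prop :=
  v.arr 9 (q - slo) < slo ∧ v.arr 10 (q - slo) + E.dep (v.arr 9 (q - slo)) = E.dep q ∧
    (G q → (v.arr 11 (q - slo) ≠ 0 → E.near mk q = v.arr 11 (q - slo)) ∧
      (v.arr 11 (q - slo) = 0 → E.near mk q = E.near mk (v.arr 9 (q - slo))))

theorem wp_buildTable (hE : E.Roomy b) {v : VS} {slo sz : ℕ} (h17 : v.reg 17 = slo)
    (h18 : v.reg 18 = sz) (hlo : 0 < slo) (hsz : slo + sz ≤ E.n + 1) (hb : sz ≤ b)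
    {mk : ℕ → ℕ} {G : ℕ → Prop} (hG : ∀ q, G q → slo ≤ E.par q → G (E.par q))
    (hmk : ∀ t < sz, G (slo + t) → v.arr 11 t = mk (slo + t)) :
    buildTable.wp E v fun u => Keeps [19, 21] [9, 10, 11] v u ∧
      u.time ≤ v.time + 100 * sz + 100 ∧ ∀ t < sz, TableEntry E mk G slo (slo + t) u := by
  have hw := hE.word
  have hbL := hE.b_le
  have hvis := hE.vis
  refine Cmd.wp_rep (fun j u => Keeps [19, 21] [9, 10, 11] v u ∧
    u.time ≤ v.time + 100 * j + 100 ∧ (∀ t < j, TableEntry E mk G slo (slo + t) u) ∧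
    ∀ t, j ≤ t → u.arr 11 t = v.arr 11 t) trivial ?_ ?_ ?_
  · exact ⟨Keeps.mk' (.refl _ _ _) (fun _ _ => rfl) fun _ _ => rfl, by simp [Ex.cost],
      fun i hi => by omega, fun _ _ => rfl⟩
  · rintro j hj u ⟨hk, ht, hq, h11⟩
    simp only [Ex.eval, h18] at hj
    have r17 := hk.reg 17 (by decide)
    rw [h17] at r17
    have hv0 : slo + j ≠ 0 := by omega
    have hpar := hE.wf.par_eq hv0 (by omega)
    have hplt := E.par_lt hv0
    have hd := E.dep_of_ne hv0
    have hmj := hmk j hj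
    rw [← h11 j le_rfl] at hmj
    simp only [Cmd.wp, Ex.Safe, Ex.eval, BinOp.eval, BinOp.Safe, Ex.cost, Function.update_apply,
      Nat.reduceEqDiff, if_true, if_false, r17, and_assoc, true_and, ne_eq, ← hpar]
    repeat refine ⟨by omega, ?_⟩
    -- The entries of the other nodes do not change.
    have hold : ∀ (x : VS), (∀ i ≠ j, x.arr 9 i = u.arr 9 i ∧ x.arr 10 i = u.arr 10 i ∧
        x.arr 11 i = u.arr 11 i) → TableEntry E mk G slo (slo + j) x →
        ∀ t < j + 1, TableEntry E mk G slo (slo + t) x := by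
      intro x hx hxj t ht
      by_cases htj : t = j
      · subst htj; exact hxj
      · obtain ⟨h1, h2, h3⟩ := hx t htj
        have := hq t (by omega)
        simp only [TableEntry, Nat.add_sub_cancel_left] at *
        rw [h1, h2, h3]; exact this
    refine ⟨fun h => ?_, fun h => ?_⟩
    · have hlt : E.par (slo + j) < slo := by simpa using h
      repeat refine ⟨by omega, ?_⟩
      refine ⟨hk.mk' ?_ ?_, by omega, ?_⟩
      · intro r hr; simp at hr; simp [hr]
      · intro r hr; simp at hr; simp [hr]
      · refine ⟨hold _ (fun i hi => by simp [hi]) ?_, fun t ht => h11 t (by omega)⟩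
        simp only [TableEntry, Nat.add_sub_cancel_left, Function.update_self,
          Function.update_of_ne (show (9 : ℕ) ≠ 10 by decide),
          Function.update_of_ne (show (11 : ℕ) ≠ 10 by decide),
          Function.update_of_ne (show (11 : ℕ) ≠ 9 by decide)]
        refine ⟨hlt, by omega, fun hGj => ⟨fun h1 => ?_, fun h1 => ?_⟩⟩
        · rw [hmj hGj] at h1 ⊢; exact Env.near_of_mark hv0 h1
        · rw [hmj hGj] at h1; exact Env.near_of_not_mark hv0 h1
    · have hge : slo ≤ E.par (slo + j) := by simpa using h
      obtain ⟨p, hp⟩ := Nat.exists_eq_add_of_le hge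
      have hentry := hq p (by omega)
      rw [← hp] at hentry
      have hGp := hG (slo + j)
      simp only [TableEntry] at hentry
      obtain ⟨e1, e2, e3⟩ := hentry
      have hdle := E.dep_le (E.par (slo + j))
      repeat refine ⟨by omega, ?_⟩
      refine ⟨fun h11j => ?_, fun h11j => ?_⟩
      · refine ⟨hk.mk' ?_ ?_, by omega, ?_⟩
        · intro r hr; simp at hr; simp [hr]
        · intro r hr; simp at hr; simp [hr]
        · refine ⟨hold _ (fun i hi => by simp [hi]) ?_, fun t ht => h11 t (by omega)⟩
          simp only [TableEntry, Nat.add_sub_cancel_left, Function.update_self,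
            Function.update_of_ne (show (9 : ℕ) ≠ 10 by decide),
            Function.update_of_ne (show (11 : ℕ) ≠ 10 by decide),
            Function.update_of_ne (show (11 : ℕ) ≠ 9 by decide)]
          refine ⟨by omega, by omega, fun hGj => ⟨fun h1 => ?_, fun h1 => absurd h1 h11j⟩⟩
          rw [hmj hGj] at h1 ⊢; exact Env.near_of_mark hv0 h1
      · repeat refine ⟨by omega, ?_⟩
        refine ⟨hk.mk' ?_ ?_, by omega, ?_⟩
        · intro r hr; simp at hr; simp [hr]
        · intro r hr; simp at hr; simp [hr]
        · refine ⟨hold _ (fun i hi => by simp [hi]) ?_, fun t ht => ?_⟩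
          swap
          · rw [if_neg (by omega)]; exact h11 t (by omega)
          simp only [TableEntry, Nat.add_sub_cancel_left, Function.update_self,
            Function.update_of_ne (show (9 : ℕ) ≠ 10 by decide),
            Function.update_of_ne (show (9 : ℕ) ≠ 11 by decide),
            Function.update_of_ne (show (10 : ℕ) ≠ 11 by decide)]
          refine ⟨by omega, by omega, fun hGj => ?_⟩
          rw [hmj hGj] at h11j
          rw [Env.near_of_not_mark hv0 h11j]
          exact e3 (hGp hGj hge)
  · rintro u ⟨h1, h2, h3, h4⟩
    simp only [Ex.eval, h18] at *
    exact ⟨h1, h2, h3⟩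

/-- Moves the queries out of a block, with the help of the table. -/
def advance : Cmd :=
  .rep 15 (.var 13) (
    .ite (.get 4 (.var 15) ≺ .var 17) .skip (
      .set 20 (.get 4 (.var 15) ⊖ .var 17) ;;
      .ite (.get 6 (.var 15)) .skip (.put 6 (.var 15) (.get 11 (.var 20))) ;;
      .put 5 (.var 15) (.get 5 (.var 15) ⊕ .get 10 (.var 20)) ;;
      .put 4 (.var 15) (.get 9 (.var 20))))

theorem wp_advance (hE : E.Roomy b) {v : VS} {slo sz lo cb : ℕ} (h17 : v.reg 17 = slo)
    (h13 : v.reg 13 = cb) (hcb : lo + cb ≤ E.n + 1) (hbc : cb ≤ b) (hb : sz ≤ b)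
    {mk : ℕ → ℕ} {G : ℕ → Prop} (hG : ∀ j < cb, slo ≤ v.arr 4 j → G (v.arr 4 j))
    (hq : Queries E mk lo cb (slo + sz) v)
    (htab : ∀ t < sz, TableEntry E mk G slo (slo + t) v) :
    advance.wp E v fun u => Keeps [15, 20] [4, 5, 6] v u ∧
      u.time ≤ v.time + 100 * cb + 100 ∧ Queries E mk lo cb slo u := by
  have hw := hE.word
  have hbL := hE.b_le
  have hvis := hE.vis
  refine Cmd.wp_rep (fun j u => Keeps [15, 20] [4, 5, 6] v u ∧
    u.time ≤ v.time + 100 * j + 100 ∧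
    (∀ i < j, QueryAt E mk lo slo i u) ∧
    ∀ i, j ≤ i → u.arr 4 i = v.arr 4 i ∧ u.arr 5 i = v.arr 5 i ∧ u.arr 6 i = v.arr 6 i)
    trivial ?_ ?_ ?_
  · exact ⟨Keeps.mk' (.refl _ _ _) (fun _ _ => rfl) fun _ _ => rfl, by simp [Ex.cost],
      fun i hi => by omega, fun _ _ => ⟨rfl, rfl, rfl⟩⟩
  · rintro j hj u ⟨hk, ht, hdone, htodo⟩
    simp only [Ex.eval, h13] at hj
    have r17 := hk.reg 17 (by decide)
    rw [h17] at r17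
    obtain ⟨h4, h5, h6⟩ := htodo j le_rfl
    obtain ⟨q1, q2, q3, q4⟩ := hq j hj
    have a9 := hk.arr 9 (by decide)
    have a10 := hk.arr 10 (by decide)
    have a11 := hk.arr 11 (by decide)
    simp only [Cmd.wp, Ex.Safe, Ex.eval, BinOp.eval, BinOp.Safe, Ex.cost, Function.update_apply,
      Nat.reduceEqDiff, if_true, if_false, r17, and_assoc, true_and, ne_eq, a9, a10, a11, h4, h5,
      h6]
    repeat refine ⟨by omega, ?_⟩
    have hnew : ∀ (x : VS), (∀ i ≠ j, x.arr 4 i = u.arr 4 i ∧ x.arr 5 i = u.arr 5 i ∧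
        x.arr 6 i = u.arr 6 i) → (x.arr 4 j < slo ∧ x.arr 5 j + E.dep (x.arr 4 j) = E.dep (lo + j) ∧
        (x.arr 6 j ≠ 0 → E.near mk (E.par (lo + j)) = x.arr 6 j) ∧
        (x.arr 6 j = 0 → E.near mk (E.par (lo + j)) = E.near mk (x.arr 4 j))) →
        ∀ i < j + 1, QueryAt E mk lo slo i x := by
      intro x hx hxj i hi
      by_cases hij : i = j
      · subst hij; exact hxj
      · obtain ⟨h1, h2, h3⟩ := hx i hij
        simp only [QueryAt] at *
        rw [h1, h2, h3]
        exact hdone i (by omega)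
    have htodo' : ∀ i, j + 1 ≤ i → i ≠ j ∧ u.arr 4 i = v.arr 4 i ∧ u.arr 5 i = v.arr 5 i ∧
        u.arr 6 i = v.arr 6 i := fun i hi => ⟨by omega, htodo i (by omega)⟩
    refine ⟨fun h => ?_, fun h => ?_⟩
    · have hlt : v.arr 4 j < slo := by simpa using h
      refine ⟨hk.mk' ?_ (fun _ _ => rfl), by omega, hnew _ (fun i _ => ⟨rfl, rfl, rfl⟩) ?_,
        fun i hi => (htodo' i hi).2⟩
      · intro r hr; simp at hr; simp [hr]
      · simp only [h4, h5, h6]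
        exact ⟨hlt, q2, q3, q4⟩
    · have hge : slo ≤ v.arr 4 j := by simpa using h
      have hGj := hG j hj hge
      obtain ⟨p, hp⟩ := Nat.exists_eq_add_of_le hge
      have hentry := htab p (by omega)
      rw [← hp] at hentry
      simp only [TableEntry] at hentry
      obtain ⟨e1, e2, e3⟩ := hentry
      obtain ⟨e3, e4⟩ := e3 hGj
      have hdle := E.dep_le (lo + j)
      repeat refine ⟨by omega, ?_⟩
      refine ⟨fun h1 => ?_, fun h1 => ?_⟩
      · repeat refine ⟨by omega, ?_⟩
        refine ⟨hk.mk' ?_ ?_, by omega, hnew _ (fun i hi => by simp [hi]) ?_,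
          fun i hi => by simpa [(htodo' i hi).1] using (htodo' i hi).2⟩
        · intro r hr; simp at hr; simp [hr]
        · intro r hr; simp at hr; simp [hr]
        · simp only [Function.update_self,
            Function.update_of_ne (show (5 : ℕ) ≠ 4 by decide),
            Function.update_of_ne (show (6 : ℕ) ≠ 4 by decide),
            Function.update_of_ne (show (6 : ℕ) ≠ 5 by decide), h6]
          exact ⟨e1, by omega, q3, fun h2 => absurd h2 h1⟩
      · repeat refine ⟨by omega, ?_⟩
        refine ⟨hk.mk' ?_ ?_, by omega, hnew _ (fun i hi => by simp [hi]) ?_,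
          fun i hi => by simpa [(htodo' i hi).1] using (htodo' i hi).2⟩
        · intro r hr; simp at hr; simp [hr]
        · intro r hr; simp at hr; simp [hr]
        · simp only [Function.update_self,
            Function.update_of_ne (show (5 : ℕ) ≠ 4 by decide),
            Function.update_of_ne (show (6 : ℕ) ≠ 4 by decide),
            Function.update_of_ne (show (6 : ℕ) ≠ 5 by decide)]
          rw [q4 h1]
          exact ⟨e1, by omega, e3, e4⟩
  · rintro u ⟨h1, h2, h3, h4⟩
    simp only [Ex.eval, h13] at *
    exact ⟨h1, h2, h3⟩

/-- Marks the flagged nodes of a block by their numbers; the variable `14` holds the number of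
flagged nodes that have not been passed. -/
def markFlags : Cmd :=
  .rep 19 (.var 18) (
    .set 20 ((.var 18 ⊖ .lit 1) ⊖ .var 19) ;;
    .put 11 (.var 20) (.lit 0) ;;
    .ite (.get 12 (.var 14) ≐ (.var 17 ⊕ .var 20))
      (.put 11 (.var 20) (.var 14) ;; .set 14 (.var 14 ⊖ .lit 1)) .skip)

theorem FlagTable.mono {v u : VS} {x y : ℕ} (h : FlagTable E v x) (hyx : y ≤ x)
    (hu : u.arr 12 = v.arr 12) : FlagTable E u y :=
  ⟨by rw [hu]; exact h.zero, fun z hz hf => by rw [hu]; exact h.mem z (hz.trans hyx) hf⟩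

/-- The last entry of the table identifies flagged nodes. -/
theorem FlagTable.eq_iff {v : VS} {x q : ℕ} (h : FlagTable E v x) (hq : q ≤ x) (h0 : q ≠ 0) :
    v.arr 12 (E.flags q) = q ↔ E.Flagged q := by
  refine ⟨fun hv => ?_, h.mem q hq⟩
  by_contra hnf
  have key : ∀ p, p ≤ q → E.flags p = E.flags q → ∃ y < q, v.arr 12 (E.flags q) = y := by
    intro p
    induction p with
    | zero => intro _ hp; rw [← hp, Env.flags_zero, h.zero]; exact ⟨0, by omega, rfl⟩
    | succ p ih =>
      intro hp hpe
      by_cases hf : E.Flagged (p + 1)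
      · refine ⟨p + 1, ?_, by rw [← hpe]; exact h.mem _ (by omega) hf⟩
        have : p + 1 ≠ q := by rintro rfl; exact hnf hf
        omega
      · exact ih (by omega) (by
          rw [← hpe, Env.flags_of_not_flagged (by omega) hf, Nat.add_sub_cancel])
  obtain ⟨y, hy, hy'⟩ := key q le_rfl rfl
  omega

theorem wp_markFlags (hE : E.Roomy b) {v : VS} {slo sz : ℕ} (h17 : v.reg 17 = slo)
    (h18 : v.reg 18 = sz) (hlo : 0 < slo) (hsz : slo + sz ≤ E.n + 1) (hb : sz ≤ b)
    (h14 : v.reg 14 = E.flags (slo + sz - 1)) (hT : FlagTable E v (slo + sz - 1)) :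
    markFlags.wp E v fun u => Keeps [14, 19, 20] [11] v u ∧
      u.time ≤ v.time + 100 * sz + 100 ∧ u.reg 14 = E.flags (slo - 1) ∧
      ∀ t < sz, u.arr 11 t = E.flagMark (slo + t) := by
  have hw := hE.word
  have hbL := hE.b_le
  have hvis := hE.vis
  have hfl := hE.flags_lt
  refine Cmd.wp_rep (fun j u => Keeps [14, 19, 20] [11] v u ∧
      u.time ≤ v.time + 100 * j + 100 ∧ u.reg 14 = E.flags (slo + sz - j - 1) ∧
      ∀ t, sz - j ≤ t → t < sz → u.arr 11 t = E.flagMark (slo + t)) trivial ?_ ?_ ?_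
  · exact ⟨Keeps.mk' (.refl _ _ _) (fun _ _ => rfl) fun _ _ => rfl, by simp [Ex.cost],
      by simpa using h14, fun i hi => by omega⟩
  · rintro j hj u ⟨hk, ht, h14u, hm⟩
    simp only [Ex.eval, h18] at hj
    have r17 := hk.reg 17 (by decide)
    rw [h17] at r17
    have r18 := hk.reg 18 (by decide)
    rw [h18] at r18
    have a12 := hk.arr 12 (by decide)
    have hle : E.flags (slo + sz - j - 1) ≤ E.flags E.n := Env.flags_mono (by omega)
    have hfle := E.flags_le E.n
    simp only [Cmd.wp, Ex.Safe, Ex.eval, BinOp.eval, BinOp.Safe, Ex.cost, Function.update_apply,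
      Nat.reduceEqDiff, if_true, if_false, r17, r18, and_assoc, true_and, ne_eq, a12, h14u]
    have hidx : slo + (sz - 1 - j) = slo + sz - j - 1 := by omega
    have hq0 : slo + sz - j - 1 ≠ 0 := by omega
    have hiff := hT.eq_iff (q := slo + sz - j - 1) (by omega) hq0
    rw [hidx]
    repeat refine ⟨by omega, ?_⟩
    refine ⟨fun h => ?_, fun h => ?_⟩
    · have hf : E.Flagged (slo + sz - j - 1) := hiff.1 (by simpa using h)
      have hcount := Env.flags_of_flagged hf
      repeat refine ⟨by omega, ?_⟩
      refine ⟨hk.mk' ?_ ?_, by omega, ?_, ?_⟩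
      · intro r hr; simp at hr; simp [hr]
      · intro r hr; simp at hr; simp [hr]
      · rw [hcount, show slo + sz - (j + 1) - 1 = slo + sz - j - 1 - 1 by omega]
        omega
      · intro t h1 h2
        by_cases htj : t = sz - 1 - j
        · subst htj
          simp only [if_true]
          rw [hidx, Env.flagMark_of_flagged hf]
        · simp only [htj, if_false]
          exact hm t (by omega) h2
    · have hf : ¬ E.Flagged (slo + sz - j - 1) := fun hf => by
        have := hiff.2 hf; simp [this] at h
      refine ⟨hk.mk' ?_ ?_, by omega, ?_, ?_⟩
      · intro r hr; simp at hr; simp [hr]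
      · intro r hr; simp at hr; simp [hr]
      · rw [Env.flags_of_not_flagged hq0 hf,
          show slo + sz - (j + 1) - 1 = slo + sz - j - 1 - 1 by omega]
      · intro t h1 h2
        by_cases htj : t = sz - 1 - j
        · subst htj
          simp only [if_true]
          rw [hidx, Env.flagMark_of_not_flagged hf]
        · simp only [htj, if_false]
          exact hm t (by omega) h2
  · rintro u ⟨h1, h2, h3, h4⟩
    simp only [Ex.eval, h18] at *
    refine ⟨h1, h2, ?_, fun t ht => h4 t (by omega) ht⟩
    rw [h3]; congr 1; omega

end

/-! ### Marks of the nodes of depth `D` -/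

section

variable {w : ℕ} {E : Env w} {b : ℕ}

/-- Removes all marks from the visited block. -/
def clearMarks : Cmd := .rep 19 (.var 18) (.put 11 (.var 19) (.lit 0))

theorem wp_clearMarks (hE : E.Roomy b) {v : VS} {sz : ℕ} (h18 : v.reg 18 = sz) (hb : sz ≤ b) :
    clearMarks.wp E v fun u => Keeps [19] [11] v u ∧
      u.time ≤ v.time + 20 * sz + 20 ∧ ∀ t < sz, u.arr 11 t = 0 := by
  have hw := hE.word
  have hbL := hE.b_le
  have hvis := hE.vis
  refine Cmd.wp_rep (fun j u => Keeps [19] [11] v u ∧ u.time ≤ v.time + 20 * j + 20 ∧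
      ∀ t < j, u.arr 11 t = 0) trivial ?_ ?_ ?_
  · exact ⟨Keeps.mk' (.refl _ _ _) (fun _ _ => rfl) fun _ _ => rfl, by simp [Ex.cost],
      fun i hi => by omega⟩
  · rintro j hj u ⟨hk, ht, hm⟩
    simp only [Ex.eval, h18] at hj
    simp only [Cmd.wp, Ex.Safe, Ex.eval, Ex.cost, Function.update_apply,
      if_true, true_and]
    repeat refine ⟨by omega, ?_⟩
    refine ⟨hk.mk' ?_ ?_, by omega, fun t ht => ?_⟩
    · intro r hr; simp at hr; simp [hr]
    · intro r hr; simp at hr; simp [hr]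
    · by_cases htj : t = j
      · simp [htj]
      · simp only [htj, if_false]; exact hm t (by omega)
  · rintro u ⟨h1, h2, h3⟩
    simp only [Ex.eval, h18] at *
    exact ⟨h1, h2, h3⟩

/-- Writes the known depths of the current positions of the queries into the marks; the array `7`
holds the depths of the nodes of the current block. -/
def seedDepths : Cmd :=
  .rep 15 (.var 13) (
    .ite (.get 4 (.var 15) ≺ .var 17) .skip
      (.put 11 (.get 4 (.var 15) ⊖ .var 17) (.get 7 (.var 15) ⊖ .get 5 (.var 15))))

theorem wp_seedDepths (hE : E.Roomy b) {v : VS} {slo sz lo cb : ℕ} (h17 : v.reg 17 = slo)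
    (h13 : v.reg 13 = cb) (hbc : cb ≤ b) (hb : sz ≤ b) {mk : ℕ → ℕ}
    (hq : Queries E mk lo cb (slo + sz) v) (h7 : ∀ j < cb, v.arr 7 j = E.dep (lo + j))
    (h11 : ∀ t < sz, v.arr 11 t = 0) :
    seedDepths.wp E v fun u => Keeps [15] [11] v u ∧ u.time ≤ v.time + 50 * cb + 50 ∧
      ∀ t < sz, (u.arr 11 t = 0 ∨ u.arr 11 t = E.dep (slo + t)) ∧
        ((∃ j < cb, v.arr 4 j = slo + t) → u.arr 11 t = E.dep (slo + t)) := by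
  have hw := hE.word
  have hbL := hE.b_le
  have hvis := hE.vis
  refine Cmd.wp_rep (fun j u => Keeps [15] [11] v u ∧ u.time ≤ v.time + 50 * j + 50 ∧
      ∀ t < sz, (u.arr 11 t = 0 ∨ u.arr 11 t = E.dep (slo + t)) ∧
        ((∃ i < j, v.arr 4 i = slo + t) → u.arr 11 t = E.dep (slo + t))) trivial ?_ ?_ ?_
  · exact ⟨Keeps.mk' (.refl _ _ _) (fun _ _ => rfl) fun _ _ => rfl, by simp [Ex.cost],
      fun t ht => ⟨Or.inl (h11 t ht), fun ⟨i, hi, _⟩ => by omega⟩⟩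
  · rintro j hj u ⟨hk, ht, hm⟩
    simp only [Ex.eval, h13] at hj
    obtain ⟨q1, q2, -, -⟩ := hq j hj
    have h7j := h7 j hj
    have r17 := hk.reg 17 (by decide)
    rw [h17] at r17
    have a4 := hk.arr 4 (by decide)
    have a5 := hk.arr 5 (by decide)
    have a7 := hk.arr 7 (by decide)
    simp only [Cmd.wp, Ex.Safe, Ex.eval, BinOp.eval, BinOp.Safe, Ex.cost, Function.update_apply,
      Nat.reduceEqDiff, if_true, if_false, and_assoc, true_and, ne_eq, r17, a4, a5, a7]
    repeat refine ⟨by omega, ?_⟩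
    refine ⟨fun h => ?_, fun h => ?_⟩
    · have hlt : v.arr 4 j < slo := by simpa using h
      refine ⟨hk.mk' ?_ (fun _ _ => rfl), by omega, fun t ht => ⟨(hm t ht).1, ?_⟩⟩
      · intro r hr; simp at hr; simp [hr]
      · rintro ⟨i, h1, h2⟩
        have : i ≠ j := by rintro rfl; omega
        exact (hm t ht).2 ⟨i, by omega, h2⟩
    · have hge : slo ≤ v.arr 4 j := by simpa using h
      repeat refine ⟨by omega, ?_⟩
      refine ⟨hk.mk' ?_ ?_, by omega, fun t ht => ?_⟩
      · intro r hr; simp at hr; simp [hr]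
      · intro r hr; simp at hr; simp [hr]
      · by_cases htj : t = v.arr 4 j - slo
        · rw [if_pos htj]
          have h1 : v.arr 7 j - v.arr 5 j = E.dep (slo + t) := by
            rw [show slo + t = v.arr 4 j by omega]; omega
          exact ⟨Or.inr h1, fun _ => h1⟩
        · rw [if_neg htj]
          refine ⟨(hm t ht).1, ?_⟩
          rintro ⟨i, h1, h2⟩
          have : i ≠ j := by rintro rfl; omega
          exact (hm t ht).2 ⟨i, by omega, h2⟩
  · rintro u ⟨h1, h2, h3⟩
    simp only [Ex.eval, h13] at *
    exact ⟨h1, h2, h3⟩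

/-- The nodes from `slo` on that are ancestors of the nodes in `c`, including these. -/
inductive Reached (E : Env w) (slo : ℕ) (c : ℕ → Prop) : ℕ → Prop
  | base {q : ℕ} : c q → Reached E slo c q
  | step {q : ℕ} : Reached E slo c q → slo ≤ E.par q → Reached E slo c (E.par q)

theorem Reached.lt {slo hi : ℕ} {c : ℕ → Prop} (hc : ∀ q, c q → q < hi) {q : ℕ}
    (h : Reached E slo c q) : q < hi := by
  induction h with
  | base h => exact hc _ h
  | @step q _ _ ih =>
    exact lt_of_le_of_lt ((min_le_right _ _).trans (Nat.sub_le _ _)) ih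

/-- Extends the depths to all ancestors within the block, in descending order, and then replaces the
depths by the marks of the nodes of depth `D`. The depth `0` stands for an unknown depth; nodes that
are not reached by any query do not need a correct mark. -/
def pushDepths : Cmd :=
  .rep 19 (.var 18) (
    .set 20 ((.var 18 ⊖ .lit 1) ⊖ .var 19) ;; .set 22 (.get 11 (.var 20)) ;;
    .ite (.var 22) (
      .set 21 (.ref ((.var 17 ⊕ .var 20) ⊖ .lit 1)) ;;
      .ite (.var 21 ≺ .var 17) .skip (.put 11 (.var 21 ⊖ .var 17) (.var 22 ⊖ .lit 1)) ;;
      .ite (.var 22 ≐ .var 5) (.put 11 (.var 20) (.var 17 ⊕ .var 20)) (.put 11 (.var 20) (.lit 0)))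
      .skip)

theorem wp_pushDepths (hE : E.Roomy b) {v : VS} {slo sz : ℕ} (hS : Params E b v)
    (h17 : v.reg 17 = slo) (h18 : v.reg 18 = sz) (hlo : 0 < slo) (hsz : slo + sz ≤ E.n + 1)
    (hb : sz ≤ b) {c : ℕ → Prop} (hc : ∀ q, c q → q < slo + sz)
    (h11 : ∀ t < sz, (v.arr 11 t = 0 ∨ v.arr 11 t = E.dep (slo + t)) ∧
      (c (slo + t) → v.arr 11 t = E.dep (slo + t))) :
    pushDepths.wp E v fun u => Keeps [19, 20, 21, 22] [11] v u ∧
      u.time ≤ v.time + 100 * sz + 100 ∧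
      ∀ t < sz, Reached E slo c (slo + t) → u.arr 11 t = E.depthMark (slo + t) := by
  have hw := hE.word
  have hbL := hE.b_le
  have hvis := hE.vis
  refine Cmd.wp_rep (fun j u => Keeps [19, 20, 21, 22] [11] v u ∧
      u.time ≤ v.time + 100 * j + 100 ∧
      (∀ t < sz, sz - j ≤ t → Reached E slo c (slo + t) → u.arr 11 t = E.depthMark (slo + t)) ∧
      ∀ t < sz - j, (u.arr 11 t = 0 ∨ u.arr 11 t = E.dep (slo + t)) ∧
        ((c (slo + t) ∨ ∃ q, slo + (sz - j) ≤ q ∧ q < slo + sz ∧ Reached E slo c q ∧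
          E.par q = slo + t) → u.arr 11 t = E.dep (slo + t))) trivial ?_ ?_ ?_
  · refine ⟨Keeps.mk' (.refl _ _ _) (fun _ _ => rfl) fun _ _ => rfl, by simp [Ex.cost],
      fun t h1 h2 => by omega, fun t ht => ⟨(h11 t (by omega)).1, ?_⟩⟩
    rintro (h | ⟨q, h1, h2, -⟩)
    · exact (h11 t (by omega)).2 h
    · omega
  · rintro j hj u ⟨hk, ht, hdone, htodo⟩
    simp only [Ex.eval, h18] at hj
    have r5 := (hS.keeps hk (by decide)).r5
    have r17 := hk.reg 17 (by decide)
    rw [h17] at r17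
    have r18 := hk.reg 18 (by decide)
    rw [h18] at r18
    obtain ⟨x, hx⟩ : ∃ x, x = sz - 1 - j := ⟨_, rfl⟩
    have hv0 : slo + x ≠ 0 := by omega
    have hpar := hE.wf.par_eq hv0 (by omega)
    have hplt := E.par_lt hv0
    have hd := E.dep_of_ne hv0
    have hcur := htodo x (by omega)
    -- A reached node has received its depth.
    have hreach : Reached E slo c (slo + x) → u.arr 11 x = E.dep (slo + x) := by
      intro hr
      apply hcur.2
      generalize hqq : slo + x = q at hr
      cases hr with
      | base h => left; exact h
      | @step q' h hge =>
        right
        have h0 : q' ≠ 0 := by rintro rfl; simp [Env.par] at hge; omega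
        have := E.par_lt h0
        exact ⟨q', by omega, h.lt hc, h, rfl⟩
    have hdle := E.dep_le (slo + x)
    -- The new invariant, if the parent receives its depth whenever the node has one.
    have hnew : ∀ f : ℕ → ℕ, (∀ t < sz, t ≠ x → slo + t ≠ E.par (slo + x) → f t = u.arr 11 t) →
        (∀ t, slo + t = E.par (slo + x) → (u.arr 11 x ≠ 0 ∧ f t = E.dep (slo + t)) ∨
          (u.arr 11 x = 0 ∧ f t = u.arr 11 t)) →
        (u.arr 11 x ≠ 0 → f x = E.depthMark (slo + x)) →
        (∀ t < sz, sz - (j + 1) ≤ t → Reached E slo c (slo + t) → f t = E.depthMark (slo + t)) ∧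
        ∀ t < sz - (j + 1), (f t = 0 ∨ f t = E.dep (slo + t)) ∧
          ((c (slo + t) ∨ ∃ q, slo + (sz - (j + 1)) ≤ q ∧ q < slo + sz ∧ Reached E slo c q ∧
            E.par q = slo + t) → f t = E.dep (slo + t)) := by
      intro f hf1 hf2 hf3
      refine ⟨fun t h1 h2 h3 => ?_, fun t h1 => ?_⟩
      · by_cases htx : t = x
        · subst htx
          exact hf3 (by rw [hreach h3]; omega)
        · rw [hf1 t h1 htx (by omega)]
          exact hdone t h1 (by omega) h3
      · have hold := htodo t (by omega)
        by_cases htp : slo + t = E.par (slo + x)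
        · rcases hf2 t htp with ⟨h2, h3⟩ | ⟨h2, h3⟩
          · exact ⟨Or.inr h3, fun _ => h3⟩
          · rw [h3]
            refine ⟨hold.1, fun h4 => hold.2 ?_⟩
            rcases h4 with h4 | ⟨q, h4, h5, h6, h7⟩
            · exact Or.inl h4
            · refine Or.inr ⟨q, ?_, h5, h6, h7⟩
              have : q ≠ slo + x := by
                rintro rfl
                have := hreach h6
                omega
              omega
        · rw [hf1 t (by omega) (by omega) htp]
          refine ⟨hold.1, fun h4 => hold.2 ?_⟩
          rcases h4 with h4 | ⟨q, h4, h5, h6, h7⟩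
          · exact Or.inl h4
          · refine Or.inr ⟨q, ?_, h5, h6, h7⟩
            have : q ≠ slo + x := by
              rintro rfl
              exact htp h7.symm
            omega
    simp only [Cmd.wp, Ex.Safe, Ex.eval, BinOp.eval, BinOp.Safe, Ex.cost, Function.update_apply,
      Nat.reduceEqDiff, if_true, if_false, r17, r18, r5, and_assoc, true_and, ne_eq, ← hpar, ← hx]
    repeat refine ⟨by omega, ?_⟩
    have hmark : ∀ f, (E.dep (slo + x) = E.D → f = slo + x) → (E.dep (slo + x) ≠ E.D → f = 0) →
        f = E.depthMark (slo + x) := by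
      intro f h1 h2
      rw [Env.depthMark]
      split_ifs with h
      · exact h1 h
      · exact h2 h
    refine ⟨fun hy => ?_, fun hy => ?_⟩
    · have hyd : u.arr 11 x = E.dep (slo + x) := hcur.1.resolve_left hy
      repeat refine ⟨by omega, ?_⟩
      refine ⟨fun h => ?_, fun h => ?_⟩
      · have hlt : E.par (slo + x) < slo := by simpa using h
        refine ⟨fun h => ?_, fun h => ?_⟩
        · have hyD : u.arr 11 x = E.D := by simpa using h
          repeat refine ⟨by omega, ?_⟩
          refine ⟨hk.mk' ?_ ?_, by omega, hnew _ ?_ ?_ ?_⟩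
          · intro r hr; simp at hr; simp [hr]
          · intro r hr; simp at hr; simp [hr]
          · intro t _ h1 _; simp [h1]
          · intro t ht; omega
          · intro _; exact hmark _ (fun _ => by simp) (fun h => by omega)
        · have hyD : u.arr 11 x ≠ E.D := by simpa using h
          repeat refine ⟨by omega, ?_⟩
          refine ⟨hk.mk' ?_ ?_, by omega, hnew _ ?_ ?_ ?_⟩
          · intro r hr; simp at hr; simp [hr]
          · intro r hr; simp at hr; simp [hr]
          · intro t _ h1 _; simp [h1]
          · intro t ht; omega
          · intro _; exact hmark _ (fun h => by omega) (fun _ => by simp)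
      · have hge : slo ≤ E.par (slo + x) := by simpa using h
        repeat refine ⟨by omega, ?_⟩
        refine ⟨fun h => ?_, fun h => ?_⟩
        · have hyD : u.arr 11 x = E.D := by simpa using h
          repeat refine ⟨by omega, ?_⟩
          refine ⟨hk.mk' ?_ ?_, by omega, hnew _ ?_ ?_ ?_⟩
          · intro r hr; simp at hr; simp [hr]
          · intro r hr; simp at hr; simp [hr]
          · intro t _ h1 h2; simp [h1, show t ≠ E.par (slo + x) - slo by omega]
          · intro t ht
            refine Or.inl ⟨hy, ?_⟩
            simp [show t = E.par (slo + x) - slo by omega,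
              show E.par (slo + x) - slo ≠ x by omega]
            rw [Nat.add_sub_cancel' hge]; omega
          · intro _; exact hmark _ (fun _ => by simp) (fun h => by omega)
        · have hyD : u.arr 11 x ≠ E.D := by simpa using h
          repeat refine ⟨by omega, ?_⟩
          refine ⟨hk.mk' ?_ ?_, by omega, hnew _ ?_ ?_ ?_⟩
          · intro r hr; simp at hr; simp [hr]
          · intro r hr; simp at hr; simp [hr]
          · intro t _ h1 h2; simp [h1, show t ≠ E.par (slo + x) - slo by omega]
          · intro t ht
            refine Or.inl ⟨hy, ?_⟩
            simp [show t = E.par (slo + x) - slo by omega,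
              show E.par (slo + x) - slo ≠ x by omega]
            rw [Nat.add_sub_cancel' hge]; omega
          · intro _; exact hmark _ (fun h => by omega) (fun _ => by simp)
    · refine ⟨hk.mk' ?_ ?_, by omega, hnew _ ?_ ?_ ?_⟩
      · intro r hr; simp at hr; simp [hr]
      · intro r hr; rfl
      · intro t _ h1 h2; rfl
      · intro t ht; exact Or.inr ⟨hy, rfl⟩
      · intro h; exact absurd hy h
  · rintro u ⟨h1, h2, h3, h4⟩
    simp only [Ex.eval, h18] at *
    exact ⟨h1, h2, fun t ht => h3 t ht (by omega)⟩

end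

/-! ### Passes through the blocks -/

section

variable {w : ℕ} {E : Env w} {b : ℕ}

theorem Cmd.wp_seq {c d : Cmd} {v : VS} {Q : VS → Prop} (h : c.wp E v fun u => d.wp E u Q) :
    (c ;; d).wp E v Q := h

theorem Cmd.wp_skip {v : VS} {Q : VS → Prop} (h : Q { v with time := v.time + 1 }) :
    Cmd.skip.wp E v Q := h

theorem Cmd.wp_set {r : ℕ} {e : Ex} {v : VS} {Q : VS → Prop} (hs : e.Safe E v)
    (h : Q { v with reg := Function.update v.reg r (e.eval E v), time := v.time + (e.cost + 1) }) :
    (Cmd.set r e).wp E v Q := ⟨hs, h⟩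

theorem of_ite_ne_zero {p : Prop} [Decidable p] (h : ¬ (if p then 1 else 0) = 0) : p := by
  by_contra hp; simp [hp] at h

theorem of_ite_eq_zero {p : Prop} [Decidable p] (h : (if p then 1 else 0) = 0) : ¬ p := by
  intro hp; simp [hp] at h

/-- The nodes of the block number `r` start at `r * b + 1`. -/
structure InBlock (E : Env w) (b r lo cb : ℕ) (v : VS) : Prop where
  r11 : v.reg 11 = r
  r12 : v.reg 12 = lo
  r13 : v.reg 13 = cb
  lo_eq : lo = r * b + 1
  lo_le : lo ≤ E.n
  cb_eq : cb = min b (E.n + 1 - lo)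

theorem InBlock.keeps {R A : List ℕ} {r lo cb : ℕ} {v u : VS} (h : InBlock E b r lo cb v)
    (hk : Keeps R A v u) (hR : 11 ∉ R ∧ 12 ∉ R ∧ 13 ∉ R) : InBlock E b r lo cb u :=
  ⟨by rw [hk.reg 11 hR.1, h.r11], by rw [hk.reg 12 hR.2.1, h.r12],
    by rw [hk.reg 13 hR.2.2, h.r13], h.lo_eq, h.lo_le, h.cb_eq⟩

/-- The nodes that remain after `s` blocks, starting with the block `r`, are those below this
bound. -/
def passBound (b r lo cb : ℕ) : ℕ → ℕ
  | 0 => lo + cb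
  | s + 1 => (r - s) * b + 1

/-- Selects the block number `r - s`. -/
def selectBlock : Cmd :=
  .set 17 ((.var 11 ⊖ .var 16) ⊗ .var 6 ⊕ .lit 1) ;;
  .set 18 ((.var 0 ⊕ .lit 1) ⊖ .var 17) ;;
  .ite (.var 6 ≺ .var 18) (.set 18 (.var 6)) .skip

theorem wp_selectBlock (hE : E.Roomy b) {v : VS} (hS : Params E b v) {r lo cb s : ℕ}
    (hB : InBlock E b r lo cb v) (h16 : v.reg 16 = s) (hs : s ≤ r) :
    selectBlock.wp E v fun u => Keeps [17, 18] [] v u ∧ u.time ≤ v.time + 40 ∧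
      u.reg 17 = passBound b r lo cb (s + 1) ∧
      u.reg 17 + u.reg 18 = passBound b r lo cb s ∧ u.reg 18 ≤ b ∧
      passBound b r lo cb s ≤ E.n + 1 := by
  have hw := hE.word
  obtain ⟨h11, h12, h13, hlo, hlon, hcb⟩ := hB
  have h1 : (r - s) * b ≤ r * b := Nat.mul_le_mul_right _ (Nat.sub_le _ _)
  have hsub : ∀ t, s = t + 1 → (r - t) * b = (r - s) * b + b ∧ (r - t) * b ≤ r * b := by
    rintro t rfl
    refine ⟨?_, Nat.mul_le_mul_right _ (Nat.sub_le _ _)⟩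
    rw [show r - t = r - (t + 1) + 1 by omega]; ring
  have hzero : s = 0 → (r - s) * b = r * b := by rintro rfl; simp
  have hnext : passBound b r lo cb (s + 1) = (r - s) * b + 1 := rfl
  have hend : (b < E.n + 1 - ((r - s) * b + 1) → (r - s) * b + 1 + b = passBound b r lo cb s) ∧
      (¬ b < E.n + 1 - ((r - s) * b + 1) → E.n + 1 = passBound b r lo cb s) ∧
      passBound b r lo cb s ≤ E.n + 1 := by
    cases s with
    | zero => simp only [passBound]; have := hzero rfl; omega
    | succ t => simp only [passBound]; have := hsub t rfl; omega
  obtain ⟨he1, he2, he3⟩ := hend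
  have hn : r * b ≤ E.n := by omega
  have hE0 : E.n ≤ E.n * E.n + E.n := by omega
  simp only [selectBlock, Cmd.wp, Ex.Safe, Ex.eval, BinOp.eval, BinOp.Safe, Ex.cost,
    Function.update_apply, Nat.reduceEqDiff, if_true, if_false, h11, h16, hS.r6, hS.r0, and_assoc,
    true_and, ne_eq]
  have hr : r ≤ r * b := Nat.le_mul_of_pos_right _ hE.b_pos
  have hww : 8 * E.n ≤ 2 ^ w := by omega
  repeat refine ⟨by omega, ?_⟩
  refine ⟨fun h => ?_, fun h => ?_⟩
  · have hb := of_ite_ne_zero h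
    refine ⟨Keeps.mk' (.refl _ _ _) ?_ fun _ _ => rfl, by omega, hnext.symm, he1 hb, le_rfl, he3⟩
    intro r hr; simp at hr; simp [hr]
  · have hb := of_ite_eq_zero h
    refine ⟨Keeps.mk' (.refl _ _ _) ?_ fun _ _ => rfl, by omega, hnext.symm, ?_, by omega, he3⟩
    · intro r hr; simp at hr; simp [hr]
    · rw [← he2 hb]; omega

/-- Answers the queries of the current block for the nearest flagged proper ancestors. -/
def flagQueries : Cmd :=
  startQueries ;; .set 14 (.var 8) ;;
  .rep 16 (.var 11 ⊕ .lit 1) (selectBlock ;; markFlags ;; buildTable ;; advance)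

theorem wp_flagQueries (hE : E.Roomy b) {v : VS} (hS : Params E b v) {r lo cb : ℕ}
    (hB : InBlock E b r lo cb v) (h8 : v.reg 8 = E.flags (lo + cb - 1))
    (hT : FlagTable E v (lo + cb - 1)) :
    flagQueries.wp E v fun u =>
      Keeps [14, 15, 16, 17, 18, 19, 20, 21] [4, 5, 6, 9, 10, 11] v u ∧
      u.time ≤ v.time + 1000 * ((r + 1) * (b + 1)) ∧
      ∀ j < cb, u.arr 5 j = E.dep (lo + j) ∧
        u.arr 6 j = E.near E.flagMark (E.par (lo + j)) := by
  have hw := hE.word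
  have hlo := hB.lo_eq
  have hlon := hB.lo_le
  have hcb := hB.cb_eq
  have hr : r ≤ r * b := Nat.le_mul_of_pos_right _ hE.b_pos
  refine Cmd.wp_seq <| Cmd.wp_mono E _ (wp_startQueries hE hB.r12 hB.r13 (by omega) (by omega)
    (by omega) E.flagMark) ?_
  rintro x ⟨hkx, htx, hqx⟩
  have hkx' : Keeps [14, 15, 16, 17, 18, 19, 20, 21] [4, 5, 6, 9, 10, 11] v x :=
    hkx.mono (by decide) (by decide)
  refine Cmd.wp_seq ⟨trivial, Cmd.wp_rep (fun s u =>
    Keeps [14, 15, 16, 17, 18, 19, 20, 21] [4, 5, 6, 9, 10, 11] v u ∧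
    u.time ≤ v.time + 500 * (s * (b + 1)) + 50 * b + 100 ∧
    u.reg 14 = E.flags (passBound b r lo cb s - 1) ∧
    Queries E E.flagMark lo cb (passBound b r lo cb s) u ∧
    passBound b r lo cb s ≤ lo + cb) ?_ ?_ ?_ ?_⟩
  · have := hB.r11
    have h11 := hkx.reg 11 (by decide)
    simp only [Ex.Safe, BinOp.Safe, Ex.eval, Function.update_apply, Nat.reduceEqDiff, if_false,
      true_and]
    omega
  · have h8x := hkx.reg 8 (by decide)
    refine ⟨hkx'.mk' ?_ fun _ _ => rfl, ?_, ?_, hqx, le_rfl⟩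
    · intro r hr; simp at hr; simp [hr]
    · simp only [Ex.cost]; omega
    · simp [Ex.eval, h8x, h8, passBound]
  · rintro s hs u ⟨hk, ht, h14, hq, hp⟩
    have h11x : x.reg 11 = r := (hkx.reg 11 (by decide)).trans hB.r11
    simp [Ex.eval, BinOp.eval, h11x] at hs
    have hk5 : Keeps [14, 15, 16, 17, 18, 19, 20, 21] [4, 5, 6, 9, 10, 11] v
        ⟨Function.update u.reg 16 s, u.arr, u.out, u.time + 5⟩ :=
      hk.mk' (by intro r hr; simp at hr; simp [hr]) fun _ _ => rfl
    simp only [Cmd.wp]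
    refine Cmd.wp_mono E _ (wp_selectBlock hE (hS.keeps hk5 (by decide))
      (hB.keeps hk5 (by decide)) (s := s) (by simp) (by omega)) ?_
    rintro y ⟨hky, hty, hy17, hy18, hyb, hyn⟩
    have hky' := hk5.trans (hky.mono (R' := [14, 15, 16, 17, 18, 19, 20, 21])
      (A' := [4, 5, 6, 9, 10, 11]) (by decide) (by decide))
    have hTy : FlagTable E y (lo + cb - 1) := hT.mono le_rfl (hky'.arr 12 (by decide))
    have hpos : 0 < y.reg 17 := by rw [hy17]; simp [passBound]
    refine Cmd.wp_mono E _ (wp_markFlags hE rfl rfl hpos (by omega) hyb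
      (by rw [hky.reg 14 (by decide), hy18]; simpa using h14)
      (hTy.mono (by omega) rfl)) ?_
    rintro z ⟨hkz, htz, hz14, hz11⟩
    have hkz' := hky'.trans (hkz.mono (R' := [14, 15, 16, 17, 18, 19, 20, 21])
      (A' := [4, 5, 6, 9, 10, 11]) (by decide) (by decide))
    refine Cmd.wp_mono E _ (wp_buildTable hE (hkz.reg 17 (by decide)) (hkz.reg 18 (by decide))
      hpos (by omega) hyb (G := fun _ => True) (fun _ _ _ => trivial) fun t ht _ => hz11 t ht) ?_
    rintro a ⟨hka, hta, hatab⟩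
    have hka' := hkz'.trans (hka.mono (R' := [14, 15, 16, 17, 18, 19, 20, 21])
      (A' := [4, 5, 6, 9, 10, 11]) (by decide) (by decide))
    have hqa : Queries E E.flagMark lo cb (y.reg 17 + y.reg 18) a := by
      rw [hy18]
      intro j hj
      have h4 : a.arr 4 = u.arr 4 := by
        rw [hka.arr 4 (by decide), hkz.arr 4 (by decide), hky.arr 4 (by decide)]
      have h5 : a.arr 5 = u.arr 5 := by
        rw [hka.arr 5 (by decide), hkz.arr 5 (by decide), hky.arr 5 (by decide)]
      have h6 : a.arr 6 = u.arr 6 := by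
        rw [hka.arr 6 (by decide), hkz.arr 6 (by decide), hky.arr 6 (by decide)]
      have := hq j hj
      rw [QueryAt] at *
      rwa [h4, h5, h6]
    have ha17 : a.reg 17 = y.reg 17 := by
      rw [hka.reg 17 (by decide), hkz.reg 17 (by decide)]
    refine Cmd.wp_mono E _ (wp_advance hE ha17 ((hB.keeps hka' (by decide)).r13) (by omega)
      (by omega) hyb (fun _ _ _ => trivial) hqa hatab) ?_
    rintro c ⟨hkc, htc, hqc⟩
    have hmul : (s + 1) * (b + 1) = s * (b + 1) + (b + 1) := by ring
    refine ⟨hka'.trans (hkc.mono (by decide) (by decide)), ?_, ?_, by rwa [← hy17], by omega⟩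
    · simp only at hty; omega
    · rw [hkc.reg 14 (by decide), hka.reg 14 (by decide), hz14, hy17]
  · rintro u ⟨hk, ht, -, hq, -⟩
    have h11x : x.reg 11 = r := (hkx.reg 11 (by decide)).trans hB.r11
    simp [Ex.eval, BinOp.eval, h11x] at ht hq
    have hmul : b + 1 ≤ (r + 1) * (b + 1) := Nat.le_mul_of_pos_left _ (by omega)
    refine ⟨hk, by omega, fun j hj => ?_⟩
    obtain ⟨q1, q2, q3, q4⟩ := hq j hj
    have h0 : u.arr 4 j = 0 := by simpa [passBound] using q1
    rw [h0] at q2 q4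
    refine ⟨by simpa using q2, ?_⟩
    by_cases h6 : u.arr 6 j = 0
    · rw [h6, q4 h6]; simp
    · exact (q3 h6).symm

/-- Answers the queries of the current block for the ancestors of depth `D`. -/
def depthQueries : Cmd :=
  startQueries ;;
  .rep 16 (.var 11 ⊕ .lit 1)
    (selectBlock ;; clearMarks ;; seedDepths ;; pushDepths ;; buildTable ;; advance)

theorem wp_depthQueries (hE : E.Roomy b) {v : VS} (hS : Params E b v) {r lo cb : ℕ}
    (hB : InBlock E b r lo cb v) (h7 : ∀ j < cb, v.arr 7 j = E.dep (lo + j)) :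
    depthQueries.wp E v fun u =>
      Keeps [15, 16, 17, 18, 19, 20, 21, 22] [4, 5, 6, 9, 10, 11] v u ∧
      u.time ≤ v.time + 1000 * ((r + 1) * (b + 1)) ∧
      ∀ j < cb, u.arr 6 j = E.near E.depthMark (E.par (lo + j)) := by
  have hw := hE.word
  have hlo := hB.lo_eq
  have hlon := hB.lo_le
  have hcb := hB.cb_eq
  have hr : r ≤ r * b := Nat.le_mul_of_pos_right _ hE.b_pos
  refine Cmd.wp_seq <| Cmd.wp_mono E _ (wp_startQueries hE hB.r12 hB.r13 (by omega) (by omega)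
    (by omega) E.depthMark) ?_
  rintro x ⟨hkx, htx, hqx⟩
  have hkx' : Keeps [15, 16, 17, 18, 19, 20, 21, 22] [4, 5, 6, 9, 10, 11] v x :=
    hkx.mono (by decide) (by decide)
  refine Cmd.wp_rep (fun s u =>
    Keeps [15, 16, 17, 18, 19, 20, 21, 22] [4, 5, 6, 9, 10, 11] v u ∧
    u.time ≤ v.time + 500 * (s * (b + 1)) + 50 * b + 100 ∧
    Queries E E.depthMark lo cb (passBound b r lo cb s) u ∧
    passBound b r lo cb s ≤ lo + cb) ?_ ?_ ?_ ?_
  · have := hB.r11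
    have h11 := hkx.reg 11 (by decide)
    simp only [Ex.Safe, BinOp.Safe, Ex.eval, true_and]
    omega
  · refine ⟨hkx'.mk' (fun _ _ => rfl) fun _ _ => rfl, ?_, hqx, le_rfl⟩
    simp only [Ex.cost]; omega
  · rintro s hs u ⟨hk, ht, hq, hp⟩
    have h11x : x.reg 11 = r := (hkx.reg 11 (by decide)).trans hB.r11
    simp [Ex.eval, BinOp.eval, h11x] at hs
    have hk5 : Keeps [15, 16, 17, 18, 19, 20, 21, 22] [4, 5, 6, 9, 10, 11] v
        ⟨Function.update u.reg 16 s, u.arr, u.out, u.time + 5⟩ :=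
      hk.mk' (by intro r hr; simp at hr; simp [hr]) fun _ _ => rfl
    simp only [Cmd.wp]
    refine Cmd.wp_mono E _ (wp_selectBlock hE (hS.keeps hk5 (by decide))
      (hB.keeps hk5 (by decide)) (s := s) (by simp) (by omega)) ?_
    rintro y ⟨hky, hty, hy17, hy18, hyb, hyn⟩
    have hky' := hk5.trans (hky.mono (R' := [15, 16, 17, 18, 19, 20, 21, 22])
      (A' := [4, 5, 6, 9, 10, 11]) (by decide) (by decide))
    have hpos : 0 < y.reg 17 := by rw [hy17]; simp [passBound]
    have hcopy : ∀ a : VS, a.arr 4 = u.arr 4 → a.arr 5 = u.arr 5 → a.arr 6 = u.arr 6 →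
        Queries E E.depthMark lo cb (y.reg 17 + y.reg 18) a := by
      intro a h4 h5 h6 j hj
      have := hq j hj
      rw [hy18]
      rw [QueryAt] at *
      rwa [h4, h5, h6]
    refine Cmd.wp_mono E _ (wp_clearMarks hE rfl hyb) ?_
    rintro z ⟨hkz, htz, hz11⟩
    have hkz' := hky'.trans (hkz.mono (R' := [15, 16, 17, 18, 19, 20, 21, 22])
      (A' := [4, 5, 6, 9, 10, 11]) (by decide) (by decide))
    have z4 : z.arr 4 = u.arr 4 := by rw [hkz.arr 4 (by decide), hky.arr 4 (by decide)]
    have z5 : z.arr 5 = u.arr 5 := by rw [hkz.arr 5 (by decide), hky.arr 5 (by decide)]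
    have z6 : z.arr 6 = u.arr 6 := by rw [hkz.arr 6 (by decide), hky.arr 6 (by decide)]
    refine Cmd.wp_mono E _ (wp_seedDepths hE (hkz.reg 17 (by decide))
      ((hB.keeps hkz' (by decide)).r13) (by omega) hyb (hcopy z z4 z5 z6)
      (by rw [hkz'.arr 7 (by decide)]; exact h7) hz11) ?_
    rintro d ⟨hkd, htd, hd11⟩
    have hkd' := hkz'.trans (hkd.mono (R' := [15, 16, 17, 18, 19, 20, 21, 22])
      (A' := [4, 5, 6, 9, 10, 11]) (by decide) (by decide))
    have d17 : d.reg 17 = y.reg 17 := by rw [hkd.reg 17 (by decide), hkz.reg 17 (by decide)]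
    have d18 : d.reg 18 = y.reg 18 := by rw [hkd.reg 18 (by decide), hkz.reg 18 (by decide)]
    have hc : ∀ q, (∃ j < cb, u.arr 4 j = q) → q < y.reg 17 + y.reg 18 := by
      rintro q ⟨j, hj, rfl⟩
      rw [hy18]; exact (hq j hj).1
    refine Cmd.wp_mono E _ (wp_pushDepths hE (hS.keeps hkd' (by decide)) d17 d18 hpos (by omega)
      hyb hc fun t ht => ⟨(hd11 t ht).1, by rw [← z4]; exact (hd11 t ht).2⟩) ?_
    rintro e ⟨hke, hte, he11⟩
    have hke' := hkd'.trans (hke.mono (R' := [15, 16, 17, 18, 19, 20, 21, 22])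
      (A' := [4, 5, 6, 9, 10, 11]) (by decide) (by decide))
    have e17 : e.reg 17 = y.reg 17 := by rw [hke.reg 17 (by decide), d17]
    have e18 : e.reg 18 = y.reg 18 := by rw [hke.reg 18 (by decide), d18]
    refine Cmd.wp_mono E _ (wp_buildTable hE e17 e18 hpos (by omega) hyb
      (G := Reached E (y.reg 17) fun q => ∃ j < cb, u.arr 4 j = q)
      (fun _ h1 h2 => h1.step h2) he11) ?_
    rintro a ⟨hka, hta, hatab⟩
    have hka' := hke'.trans (hka.mono (R' := [15, 16, 17, 18, 19, 20, 21, 22])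
      (A' := [4, 5, 6, 9, 10, 11]) (by decide) (by decide))
    have a4 : a.arr 4 = u.arr 4 := by
      rw [hka.arr 4 (by decide), hke.arr 4 (by decide), hkd.arr 4 (by decide), z4]
    have a5 : a.arr 5 = u.arr 5 := by
      rw [hka.arr 5 (by decide), hke.arr 5 (by decide), hkd.arr 5 (by decide), z5]
    have a6 : a.arr 6 = u.arr 6 := by
      rw [hka.arr 6 (by decide), hke.arr 6 (by decide), hkd.arr 6 (by decide), z6]
    have ha17 : a.reg 17 = y.reg 17 := by rw [hka.reg 17 (by decide), e17]
    refine Cmd.wp_mono E _ (wp_advance hE ha17 ((hB.keeps hka' (by decide)).r13) (by omega)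
      (by omega) hyb (fun j hj _ => .base ⟨j, hj, by rw [a4]⟩) (hcopy a a4 a5 a6) hatab) ?_
    rintro c ⟨hkc, htc, hqc⟩
    have hmul : (s + 1) * (b + 1) = s * (b + 1) + (b + 1) := by ring
    refine ⟨hka'.trans (hkc.mono (by decide) (by decide)), ?_, by rwa [← hy17], by omega⟩
    simp only at hty; omega
  · rintro u ⟨hk, ht, hq, -⟩
    have h11x : x.reg 11 = r := (hkx.reg 11 (by decide)).trans hB.r11
    simp [Ex.eval, BinOp.eval, h11x] at ht hq
    have hmul : b + 1 ≤ (r + 1) * (b + 1) := Nat.le_mul_of_pos_left _ (by omega)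
    refine ⟨hk, by omega, fun j hj => ?_⟩
    obtain ⟨q1, q2, q3, q4⟩ := hq j hj
    have h0 : u.arr 4 j = 0 := by simpa [passBound] using q1
    rw [h0] at q4
    by_cases h6 : u.arr 6 j = 0
    · rw [h6, q4 h6]; simp
    · exact (q3 h6).symm

/-- Copies the answers for the flagged ancestors, and the depths. -/
def saveAnswers : Cmd :=
  .rep 15 (.var 13) (.put 7 (.var 15) (.get 5 (.var 15)) ;; .put 8 (.var 15) (.get 6 (.var 15)))

theorem wp_saveAnswers (hE : E.Roomy b) {v : VS} {cb : ℕ} (h13 : v.reg 13 = cb) (hb : cb ≤ b) :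
    saveAnswers.wp E v fun u => Keeps [15] [7, 8] v u ∧ u.time ≤ v.time + 50 * cb + 50 ∧
      ∀ j < cb, u.arr 7 j = v.arr 5 j ∧ u.arr 8 j = v.arr 6 j := by
  have hw := hE.word
  have hbL := hE.b_le
  have hvis := hE.vis
  refine Cmd.wp_rep (fun j u => Keeps [15] [7, 8] v u ∧ u.time ≤ v.time + 50 * j + 50 ∧
      ∀ i < j, u.arr 7 i = v.arr 5 i ∧ u.arr 8 i = v.arr 6 i) trivial ?_ ?_ ?_
  · exact ⟨Keeps.mk' (.refl _ _ _) (fun _ _ => rfl) fun _ _ => rfl, by simp [Ex.cost],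
      fun i hi => by omega⟩
  · rintro j hj u ⟨hk, ht, hq⟩
    simp only [Ex.eval, h13] at hj
    have a5 := hk.arr 5 (by decide)
    have a6 := hk.arr 6 (by decide)
    simp only [Cmd.wp, Ex.Safe, Ex.eval, Ex.cost, Function.update_apply,
      Nat.reduceEqDiff, if_true, if_false, and_assoc, true_and, a5, a6]
    repeat refine ⟨by omega, ?_⟩
    refine ⟨hk.mk' ?_ ?_, by omega, ?_⟩
    · intro r hr; simp at hr; simp [hr]
    · intro r hr; simp at hr; simp [hr]
    · intro i hi
      by_cases hij : i = j
      · subst hij; simp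
      · simpa [hij] using hq i (by omega)
  · rintro u ⟨h1, h2, h3⟩
    simp only [Ex.eval, h13] at *
    exact ⟨h1, h2, h3⟩

/-- Answers all queries of the current block: depths go to the array `7`, nearest flagged proper
ancestors to the array `8`, proper ancestors of depth `D` to the array `6`. -/
def answerQueries : Cmd := flagQueries ;; saveAnswers ;; depthQueries

theorem wp_answerQueries (hE : E.Roomy b) {v : VS} (hS : Params E b v) {r lo cb : ℕ}
    (hB : InBlock E b r lo cb v) (h8 : v.reg 8 = E.flags (lo + cb - 1))
    (hT : FlagTable E v (lo + cb - 1)) :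
    answerQueries.wp E v fun u =>
      Keeps [14, 15, 16, 17, 18, 19, 20, 21, 22] [4, 5, 6, 7, 8, 9, 10, 11] v u ∧
      u.time ≤ v.time + 3000 * ((r + 1) * (b + 1)) ∧
      ∀ j < cb, u.arr 7 j = E.dep (lo + j) ∧
        u.arr 8 j = E.near E.flagMark (E.par (lo + j)) ∧
        u.arr 6 j = E.near E.depthMark (E.par (lo + j)) := by
  have hcb := hB.cb_eq
  simp only [answerQueries, Cmd.wp]
  refine Cmd.wp_mono E _ (wp_flagQueries hE hS hB h8 hT) ?_
  rintro x ⟨hkx, htx, hx⟩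
  have hkx' := hkx.mono (R' := [14, 15, 16, 17, 18, 19, 20, 21, 22])
    (A' := [4, 5, 6, 7, 8, 9, 10, 11]) (by decide) (by decide)
  refine Cmd.wp_mono E _ (wp_saveAnswers hE (hB.keeps hkx (by decide)).r13 (by omega)) ?_
  rintro y ⟨hky, hty, hy⟩
  have hky' := hkx'.trans (hky.mono (by decide) (by decide))
  refine Cmd.wp_mono E _ (wp_depthQueries hE (hS.keeps hky' (by decide))
    (hB.keeps hky' (by decide)) fun j hj => by rw [(hy j hj).1, (hx j hj).1]) ?_
  rintro z ⟨hkz, htz, hz⟩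
  have hmul : b + 1 ≤ (r + 1) * (b + 1) := Nat.le_mul_of_pos_left _ (by omega)
  generalize (r + 1) * (b + 1) = M at *
  refine ⟨hky'.trans (hkz.mono (by decide) (by decide)), by omega, fun j hj => ?_⟩
  rw [hkz.arr 7 (by decide), hkz.arr 8 (by decide), (hy j hj).1, (hy j hj).2, (hx j hj).1,
    (hx j hj).2, hz j hj]
  exact ⟨rfl, rfl, rfl⟩

end

/-! ### Matches near the start of a phrase -/

/-- `u` arises from `v` by changes of the variables `R`, the arrays `A`, the output and the time. -/
structure KeepsVars (R A : List ℕ) (v u : VS) : Prop where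
  reg : ∀ r, r ∉ R → u.reg r = v.reg r
  arr : ∀ a, a ∉ A → u.arr a = v.arr a

namespace KeepsVars

theorem refl (R A : List ℕ) (v : VS) : KeepsVars R A v v := ⟨fun _ _ => rfl, fun _ _ => rfl⟩

theorem trans {R A : List ℕ} {v u x : VS} (h : KeepsVars R A v u) (h' : KeepsVars R A u x) :
    KeepsVars R A v x :=
  ⟨fun r hr => (h'.reg r hr).trans (h.reg r hr), fun a ha => (h'.arr a ha).trans (h.arr a ha)⟩

theorem mono {R A R' A' : List ℕ} {v u : VS} (h : KeepsVars R A v u) (hR : R ⊆ R')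
    (hA : A ⊆ A') : KeepsVars R' A' v u :=
  ⟨fun r hr => h.reg r fun h' => hr (hR h'), fun a ha => h.arr a fun h' => ha (hA h')⟩

theorem mk' {R A : List ℕ} {v u : VS} {f : ℕ → ℕ} {g : ℕ → ℕ → ℕ} {l : List ℕ} {t : ℕ}
    (h : KeepsVars R A v u) (hf : ∀ r, r ∉ R → f r = u.reg r) (hg : ∀ a, a ∉ A → g a = u.arr a) :
    KeepsVars R A v ⟨f, g, l, t⟩ :=
  ⟨fun r hr => (hf r hr).trans (h.reg r hr), fun a ha => (hg a ha).trans (h.arr a ha)⟩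

end KeepsVars

theorem Keeps.vars {R A R' A' : List ℕ} {v u : VS} (h : Keeps R A v u) (hR : R ⊆ R')
    (hA : A ⊆ A') : KeepsVars R' A' v u :=
  KeepsVars.mono ⟨h.reg, h.arr⟩ hR hA

theorem KeepsVars.keeps {R A : List ℕ} {v u : VS} (h : KeepsVars R A v u) :
    Keeps R A { v with out := u.out } u := ⟨h.reg, h.arr, rfl⟩

section

variable {w : ℕ} {E : Env w} {b : ℕ}

theorem Params.keepsVars {R A : List ℕ} {v u : VS} (h : Params E b v) (hk : KeepsVars R A v u)
    (hR : ∀ r ∈ R, 7 < r) : Params E b u :=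
  Params.keeps (v := { v with out := u.out }) ⟨h.r0, h.r1, h.r2, h.r5, h.r6, h.r7⟩ hk.keeps hR

/-- The end of the text read so far is at hand: the variable `9` holds the length of the text, and
the array `1` the last characters, as many as the variable `10` says. -/
structure Window (E : Env w) (v : VS) (i : ℕ) : Prop where
  pos : v.reg 9 = (E.textTo i).length
  len : v.reg 10 = min (E.textTo i).length E.D
  arr : ∀ t < v.reg 10,
    v.arr 1 t = ((E.textTo i).getD ((E.textTo i).length - v.reg 10 + t) 0).toNat

/-- Appends the first `D` characters of the next phrase to the window. -/
def loadPhrase : Cmd :=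
  .set 26 (.var 12 ⊕ .var 15) ;; .set 27 (.get 7 (.var 15)) ;; .set 28 (.var 10) ;;
  .ite (.var 5 ≺ .var 27) (.set 23 (.var 5) ;; .set 20 (.get 6 (.var 15)))
    (.set 23 (.var 27) ;; .set 20 (.var 26)) ;;
  walk 1

theorem wp_loadPhrase (hE : E.Roomy b) {v : VS} (hS : Params E b v) {i j : ℕ} (hi : i < E.n)
    (hj : j < b) (h15 : v.reg 15 = j) (h12 : v.reg 12 + j = i + 1) (hW : Window E v i)
    (h7 : v.arr 7 j = E.dep (i + 1)) (h6 : v.arr 6 j = E.near E.depthMark (E.par (i + 1))) :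
    loadPhrase.wp E v fun u => Keeps [19, 20, 23, 26, 27, 28] [1] v u ∧
      u.time ≤ v.time + 50 * E.D + 200 ∧ u.reg 26 = i + 1 ∧ u.reg 27 = E.dep (i + 1) ∧
      u.reg 23 = min (E.dep (i + 1)) E.D ∧
      ∀ t < u.reg 10 + u.reg 23, u.arr 1 t =
        (((E.textTo i).drop ((E.textTo i).length - u.reg 10) ++
          (E.str (i + 1)).take (u.reg 23)).getD t 0).toNat := by
  have hw := hE.word
  have hbL := hE.b_le
  have hvis := hE.vis
  have hD0 := hE.wf.D_pos
  obtain ⟨hpos, hlen, harr⟩ := hW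
  have hdle := E.dep_le (i + 1)
  have hd := E.dep_of_ne (v := i + 1) (by omega)
  have hplt := E.par_lt (v := i + 1) (by omega)
  have hmain : ∀ (x l : ℕ) (a : VS), Keeps [19, 20, 23, 26, 27, 28] [1] v a →
      a.reg 20 = x → a.reg 23 = l → a.reg 28 = v.reg 10 → a.reg 26 = i + 1 →
      a.reg 27 = E.dep (i + 1) → a.arr 1 = v.arr 1 → x ≤ E.n → E.dep x = l →
      E.str x = (E.str (i + 1)).take l → l = min (E.dep (i + 1)) E.D →
      a.time ≤ v.time + 100 →
      (walk 1).wp E a fun u => Keeps [19, 20, 23, 26, 27, 28] [1] v u ∧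
        u.time ≤ v.time + 50 * E.D + 200 ∧ u.reg 26 = i + 1 ∧ u.reg 27 = E.dep (i + 1) ∧
        u.reg 23 = min (E.dep (i + 1)) E.D ∧
        ∀ t < u.reg 10 + u.reg 23, u.arr 1 t =
          (((E.textTo i).drop ((E.textTo i).length - u.reg 10) ++
            (E.str (i + 1)).take (u.reg 23)).getD t 0).toNat := by
    intro x l a hka h20 h23 h28 h26 h27 h1 hx hdx hstr hl ht
    refine Cmd.wp_mono E _ (wp_walk hE 1 (by decide) h20 h23 h28 hx (by omega)) ?_
    rintro u ⟨hku, htu, -, hc, ho⟩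
    have hku' := hka.trans (hku.mono (R' := [19, 20, 23, 26, 27, 28]) (A' := [1])
      (by decide) (by decide))
    have u10 := hku'.reg 10 (by decide)
    have u23 : u.reg 23 = l := (hku.reg 23 (by decide)).trans h23
    refine ⟨hku', by omega, (hku.reg 26 (by decide)).trans h26, (hku.reg 27 (by decide)).trans h27,
      u23.trans hl, ?_⟩
    rw [u10, u23]
    intro t ht
    have hdl : ((E.textTo i).drop ((E.textTo i).length - v.reg 10)).length = v.reg 10 := by
      rw [List.length_drop]; omega
    by_cases htg : t < v.reg 10
    · rw [ho t (Or.inl htg), h1, harr t htg]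
      congr 1
      rw [List.getD_eq_getElem?_getD, List.getD_eq_getElem?_getD,
        List.getElem?_append_left (by omega), List.getElem?_drop]
    · obtain ⟨s, rfl⟩ := Nat.exists_eq_add_of_le (show v.reg 10 ≤ t by omega)
      rw [hc s (by omega) (by omega), hstr]
      congr 1
      rw [List.getD_eq_getElem?_getD, List.getD_eq_getElem?_getD,
        List.getElem?_append_right (by omega), hdl, hdx]
      simp
  have r5 := hS.r5
  simp only [loadPhrase, Cmd.wp, Ex.Safe, Ex.eval, BinOp.eval, BinOp.Safe, Ex.cost,
    Function.update_apply, Nat.reduceEqDiff, if_true, if_false, and_assoc, true_and, ne_eq, h15,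
    h7, h6, r5]
  repeat refine ⟨by omega, ?_⟩
  refine ⟨fun h => ?_, fun h => ?_⟩
  · have hlt := of_ite_ne_zero h
    repeat refine ⟨by omega, ?_⟩
    obtain ⟨hn1, hn2⟩ := Env.near_depthMark (v := E.par (i + 1)) hD0 (by omega)
    have hpstr : (E.str (E.par (i + 1))).take E.D = (E.str (i + 1)).take E.D := by
      rw [E.str_of_ne (v := i + 1) (by omega), List.take_append_of_le_length]
      exact show E.D ≤ E.dep (E.par (i + 1)) by omega
    rw [hpstr] at hn2
    refine hmain (E.near E.depthMark (E.par (i + 1))) E.D _ (Keeps.mk' (.refl _ _ _) ?_ ?_)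
      ?_ ?_ ?_ ?_ ?_ rfl (by omega) ?_ hn2 (by omega) (by simp only; omega)
    · intro r hr; simp at hr; simp [hr]
    · intro r hr; rfl
    iterate 4 simp
    · simpa using h12
    · simp
    · have := congrArg List.length hn2
      rw [List.length_take] at this
      simp only [Env.dep] at *
      omega
  · have hge := of_ite_eq_zero h
    refine hmain (i + 1) (E.dep (i + 1)) _ (Keeps.mk' (.refl _ _ _) ?_ ?_)
      ?_ ?_ ?_ ?_ ?_ rfl (by omega) rfl ?_ (by omega) (by simp only; omega)
    · intro r hr; simp at hr; simp [hr]
    · intro r hr; rfl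
    · simpa using h12
    · simp
    · simp
    · simpa using h12
    · simp
    · exact List.take_length.symm

/-- Outputs the matches in the new part of the window. -/
def reportWindow : Cmd :=
  .rep 19 (.var 24) (
    .set 22 (.get 2 (.var 19)) ;;
    .ite (.var 10 ≺ .var 22)
      (.ite ((.var 10 ⊕ .var 23) ≺ .var 22) .skip (.out ((.var 9 ⊕ .var 22) ⊖ .var 10))) .skip)

theorem wp_reportWindow (hE : E.Roomy b) {v : VS} {M : List ℕ} {u₀ g l : ℕ}
    (h24 : v.reg 24 = M.length) (h10 : v.reg 10 = g) (h23 : v.reg 23 = l) (h9 : v.reg 9 = u₀)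
    (hM : ∀ (i : ℕ) (h : i < M.length), v.arr 2 i = M[i]) (hMD : ∀ x ∈ M, x ≤ 2 * E.D)
    (hML : M.length ≤ 2 * E.D) (hg : g + l ≤ 2 * E.D) (hu : u₀ ≤ E.n * E.n) :
    reportWindow.wp E v fun u => KeepsVars [19, 22] [] v u ∧
      u.time ≤ v.time + 50 * M.length + 50 ∧
      u.out = v.out ++ (M.filter fun x => g < x ∧ x ≤ g + l).map fun x => u₀ + x - g := by
  have hw := hE.word
  have hDL := hE.D_le
  have hvis := hE.vis
  have hnn : (E.n + 1) * (E.n + 1) = E.n * E.n + 2 * E.n + 1 := by ring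
  refine Cmd.wp_rep (fun j u => KeepsVars [19, 22] [] v u ∧ u.time ≤ v.time + 50 * j + 50 ∧
      u.out = v.out ++ ((M.take j).filter fun x => g < x ∧ x ≤ g + l).map fun x => u₀ + x - g)
      trivial ?_ ?_ ?_
  · exact ⟨KeepsVars.mk' (.refl _ _ _) (fun _ _ => rfl) fun _ _ => rfl, by simp [Ex.cost],
      by simp⟩
  · rintro j hj u ⟨hk, ht, hout⟩
    simp only [Ex.eval, h24] at hj
    have r10 := hk.reg 10 (by decide)
    rw [h10] at r10
    have r23 := hk.reg 23 (by decide)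
    rw [h23] at r23
    have r9 := hk.reg 9 (by decide)
    rw [h9] at r9
    have a2 := hk.arr 2 (by decide)
    have hMj := hMD _ (List.getElem_mem hj)
    simp only [Cmd.wp, Ex.Safe, Ex.eval, BinOp.eval, BinOp.Safe, Ex.cost, Function.update_apply,
      Nat.reduceEqDiff, if_true, if_false, r10, r23, r9, a2, hM j hj, and_assoc, true_and, ne_eq]
    rw [List.take_add_one, List.filter_append, List.map_append, List.getElem?_eq_getElem hj]
    generalize M[j] = x at *
    repeat refine ⟨by omega, ?_⟩
    have hkeep : ∀ (o : List ℕ) (t : ℕ), KeepsVars [19, 22] [] v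
        ⟨Function.update (Function.update u.reg 19 j) 22 x, u.arr, o, t⟩ := fun o t =>
      hk.mk' (by intro r hr; simp at hr; simp [hr]) fun _ _ => rfl
    refine ⟨fun h => ?_, fun h => ?_⟩
    · have h1 := of_ite_ne_zero h
      repeat refine ⟨by omega, ?_⟩
      refine ⟨fun h => ?_, fun h => ?_⟩
      · have h2 := of_ite_ne_zero h
        refine ⟨hkeep _ _, by omega, ?_⟩
        simp [hout, h2]
      · have h2 := of_ite_eq_zero h
        repeat refine ⟨by omega, ?_⟩
        refine ⟨hkeep _ _, by omega, ?_⟩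
        simp [hout, h1, not_lt.1 h2]
    · have h1 := of_ite_eq_zero h
      refine ⟨hkeep _ _, by omega, ?_⟩
      simp [hout, not_lt.1 h1]
  · rintro u ⟨h1, h2, h3⟩
    simp only [Ex.eval, h24] at *
    exact ⟨h1, h2, by simpa using h3⟩

/-- Outputs the matches that end within the first `D` characters of the next phrase. -/
def reportNear : Cmd := .call 1 24 ;; reportWindow

theorem wp_reportNear (hE : E.Roomy b) {v : VS} (hS : Params E b v) {i : ℕ} (hi : i < E.n)
    (h9 : v.reg 9 = (E.textTo i).length) (h10 : v.reg 10 = min (E.textTo i).length E.D)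
    (h23 : v.reg 23 = min (E.dep (i + 1)) E.D)
    (h1 : ∀ t < v.reg 10 + v.reg 23, v.arr 1 t =
        (((E.textTo i).drop ((E.textTo i).length - v.reg 10) ++
          (E.str (i + 1)).take (v.reg 23)).getD t 0).toNat) :
    reportNear.wp E v fun u => KeepsVars [19, 22, 24] [2, 3] v u ∧
      u.time ≤ v.time + 100 * E.D + E.callTime + 50 ∧
      ∃ l : List ℕ, u.out = v.out ++ l ∧ l.Nodup ∧
        ∀ x, x ∈ l ↔ ∃ q, 1 ≤ q ∧ q ≤ E.D ∧ q ≤ E.dep (i + 1) ∧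
          x = (E.textTo i).length + q ∧
          EndsMatch E.k E.P (E.textTo i ++ (E.str (i + 1)).take q) := by
  have hvis := hE.vis
  have hul := E.textTo_length_le i
  have hnn : i * i ≤ E.n * E.n := Nat.mul_le_mul hi.le hi.le
  have hlen : ((E.textTo i).drop ((E.textTo i).length - v.reg 10) ++
      (E.str (i + 1)).take (v.reg 23)).length = v.reg 10 + v.reg 23 := by
    have : (E.str (i + 1)).length = E.dep (i + 1) := rfl
    rw [List.length_append, List.length_drop, List.length_take]; omega
  have hW := take_matchesIn_text (E := E) (v := v) (a := 1) (l := v.reg 10 + v.reg 23) (by omega)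
    hlen h1
  have hiff : ∀ q, 1 ≤ q → q ≤ v.reg 23 → _ := fun q =>
    Env.mem_matchSet_window h10 (l := v.reg 23) (Y := E.str (i + 1))
      (by rw [h23]; exact min_le_left _ _) hW
  have hML := matchesIn_length_le (E := E) v 1
  have hMem : ∀ x, x ∈ Cmd.matchesIn E v 1 ↔ x ∈ matchSet E.k E.P _ :=
    fun x => Finset.mem_sort (· ≤ ·)
  have hnd : (Cmd.matchesIn E v 1).Nodup := Finset.sort_nodup _ _
  have hMD : ∀ x ∈ Cmd.matchesIn E v 1, x ≤ 2 * E.D := by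
    intro x hx
    have := (mem_matchSet_iff.1 ((hMem x).1 hx)).2.1
    simp only [List.length_map, List.length_range] at this
    simp only [Env.D]; omega
  refine Cmd.wp_seq ⟨by omega, by decide, by decide, hS.r1, hS.r2, hS.r7, fun f hf hf' => ?_⟩
  set M := Cmd.matchesIn E v 1 with hMdef
  refine Cmd.wp_mono E _ (wp_reportWindow hE (M := M) (u₀ := (E.textTo i).length) (g := v.reg 10)
    (l := v.reg 23) ?_ ?_ ?_ ?_ hf hMD hML (by omega) (by omega)) ?_
  · simp
  · simp
  · simp
  · simpa using h9
  rintro u ⟨hku, htu, hout⟩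
  refine ⟨KeepsVars.trans (KeepsVars.mk' (.refl _ _ _) ?_ ?_) (hku.mono (by decide) (by decide)),
    ?_, _, hout, ?_, ?_⟩
  · intro r hr; simp at hr; simp [hr]
  · intro r hr; simp at hr; exact hf' r hr.1 hr.2
  · simp only at htu; omega
  · refine (hnd.filter _).map_on fun x hx y hy hxy => ?_
    simp at hx hy
    omega
  · intro x
    simp only [List.mem_map, List.mem_filter, hMem, decide_eq_true_eq]
    constructor
    · rintro ⟨y, ⟨hy1, hy2, hy3⟩, rfl⟩
      obtain ⟨q, rfl⟩ := Nat.exists_eq_add_of_le hy2.le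
      exact ⟨q, by omega, by omega, by omega, by omega, (hiff q (by omega) (by omega)).1 hy1⟩
    · rintro ⟨q, hq1, hq2, hq3, rfl, hq4⟩
      exact ⟨v.reg 10 + q, ⟨(hiff q hq1 (by omega)).2 hq4, by omega, by omega⟩, by omega⟩

end

/-! ### Matches within a phrase -/

section

variable {w : ℕ} {E : Env w} {b : ℕ}

theorem Env.exists_flagged {N c : ℕ} (h0 : 0 < c) (hc : c ≤ E.flags N) :
    ∃ z ≤ N, E.Flagged z ∧ E.flags z = c := by
  induction N with
  | zero => rw [Env.flags_zero] at hc; omega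
  | succ N ih =>
    by_cases h : c ≤ E.flags N
    · obtain ⟨z, hz, h1⟩ := ih h
      exact ⟨z, by omega, h1⟩
    · by_cases hf : E.Flagged (N + 1)
      · have := Env.flags_of_flagged hf
        rw [Nat.add_sub_cancel] at this
        exact ⟨N + 1, le_rfl, hf, by omega⟩
      · rw [Env.flags_of_not_flagged (by omega) hf, Nat.add_sub_cancel] at hc
        omega

theorem Env.chain_length_le (v : ℕ) : (E.chain v).length ≤ E.dep v := by
  induction v using Nat.strong_induction_on with
  | _ v ih =>
    by_cases h0 : v = 0
    · subst h0; simp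
    have ih := ih _ (E.par_lt h0)
    have hd := E.dep_of_ne h0
    by_cases h : E.Flagged v
    · rw [Env.chain_of_flagged h, List.length_cons]; omega
    · rw [Env.chain_of_not_flagged h0 h]; omega

/-- For the flagged nodes up to `i`, in their order, the arrays `13`, `14` and `15` hold the depth,
the next flagged ancestor, and the number of flagged ancestors including the node itself. The
position `0` stands for the end of a chain. -/
structure ChainTable (E : Env w) (v : VS) (i : ℕ) : Prop where
  zero : v.arr 15 0 = 0
  depth : ∀ z ≤ i, E.Flagged z → v.arr 13 (E.flags z) = E.dep z
  next : ∀ z ≤ i, E.Flagged z → v.arr 14 (E.flags z) = E.near E.flagMark (E.par z)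
  count : ∀ z ≤ i, E.Flagged z → v.arr 15 (E.flags z) = (E.chain z).length

theorem ChainTable.keeps {v u : VS} {i : ℕ} (h : ChainTable E v i) (h13 : u.arr 13 = v.arr 13)
    (h14 : u.arr 14 = v.arr 14) (h15 : u.arr 15 = v.arr 15) : ChainTable E u i :=
  ⟨by rw [h15, h.zero], by rw [h13]; exact h.depth, by rw [h14]; exact h.next,
    by rw [h15]; exact h.count⟩

theorem ChainTable.count_near {v : VS} {i x : ℕ} (h : ChainTable E v i) (hx : x ≤ i) :
    v.arr 15 (E.near E.flagMark x) = (E.chain x).length := by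
  rcases Env.chain_near (E := E) x with ⟨h1, h2⟩ | ⟨z, hz, hf, h1, h2⟩
  · rw [h1, h2, h.zero]; rfl
  · rw [h1, h.count z (by omega) hf, h2, Env.chain_of_flagged hf]

theorem Env.near_le_flags (x : ℕ) : E.near E.flagMark x ≤ E.flags x := by
  rcases Env.chain_near (E := E) x with ⟨h1, h2⟩ | ⟨z, hz, hf, h1, h2⟩
  · omega
  · rw [h1]; exact Env.flags_mono hz

/-- Finds the nearest flagged ancestor of the current node; if the node is flagged itself, it is
entered in the tables. -/
def noteFlag : Cmd :=
  .set 25 (.get 8 (.var 15)) ;;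
  .ite (.var 14 ≺ .var 8)
    (.ite (.get 12 (.var 14 ⊕ .lit 1) ≐ .var 26) (
      .set 14 (.var 14 ⊕ .lit 1) ;; .put 13 (.var 14) (.var 27) ;; .put 14 (.var 14) (.var 25) ;;
      .put 15 (.var 14) (.get 15 (.var 25) ⊕ .lit 1) ;; .set 25 (.var 14)) .skip)
    .skip

theorem wp_noteFlag (hE : E.Roomy b) {v : VS} {i j N : ℕ} (hi : i < N) (hN : N ≤ E.n)
    (h15 : v.reg 15 = j) (hj : j < b) (h26 : v.reg 26 = i + 1) (h27 : v.reg 27 = E.dep (i + 1))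
    (h8 : v.arr 8 j = E.near E.flagMark (E.par (i + 1))) (h14 : v.reg 14 = E.flags i)
    (hF : v.reg 8 = E.flags N) (hT : FlagTable E v N) (hC : ChainTable E v i) :
    noteFlag.wp E v fun u => Keeps [14, 25] [13, 14, 15] v u ∧ u.time ≤ v.time + 100 ∧
      u.reg 14 = E.flags (i + 1) ∧ u.reg 25 = E.near E.flagMark (i + 1) ∧
      ChainTable E u (i + 1) := by
  have hw := hE.word
  have hbL := hE.b_le
  have hvis := hE.vis
  have hfl := hE.flags_lt
  have hplt := E.par_lt (v := i + 1) (by omega)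
  have hFn : E.flags N ≤ E.flags E.n := Env.flags_mono hN
  have hFn' := E.flags_le E.n
  have hcnt := hC.count_near (x := E.par (i + 1)) (by omega)
  have hcl := E.chain_length_le (E.par (i + 1))
  have hdl := E.dep_le (E.par (i + 1))
  have hnl := E.near_le_flags (E.par (i + 1))
  have hpf : E.flags (E.par (i + 1)) ≤ E.flags i := Env.flags_mono (by omega)
  have hif : E.flags i ≤ E.flags N := Env.flags_mono (by omega)
  have hflag : ∀ z ≤ N, E.Flagged z → E.flags z = E.flags i + 1 →
      v.arr 12 (E.flags i + 1) = z := fun z hz hf he => by rw [← he]; exact hT.mem z hz hf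
  have hno : ¬ E.Flagged (i + 1) → ∀ u : VS, u.arr 13 = v.arr 13 → u.arr 14 = v.arr 14 →
      u.arr 15 = v.arr 15 → E.flags i = E.flags (i + 1) ∧
      E.near E.flagMark (E.par (i + 1)) = E.near E.flagMark (i + 1) ∧
      ChainTable E u (i + 1) := by
    intro hnf u h1 h2 h3
    have hz : ∀ z ≤ i + 1, E.Flagged z → z ≤ i := by
      intro z hz hf
      have : z ≠ i + 1 := by rintro rfl; exact hnf hf
      omega
    refine ⟨by simpa using (Env.flags_of_not_flagged (by omega) hnf).symm,
      (Env.near_of_not_mark (by omega) (Env.flagMark_of_not_flagged hnf)).symm, ?_⟩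
    refine ChainTable.keeps (v := v) ⟨hC.zero, ?_, ?_, ?_⟩ h1 h2 h3
    · exact fun z h4 h5 => hC.depth z (hz z h4 h5) h5
    · exact fun z h4 h5 => hC.next z (hz z h4 h5) h5
    · exact fun z h4 h5 => hC.count z (hz z h4 h5) h5
  simp only [noteFlag, Cmd.wp, Ex.Safe, Ex.eval, BinOp.eval, BinOp.Safe, Ex.cost,
    Function.update_apply, Nat.reduceEqDiff, if_true, if_false, and_assoc, true_and, ne_eq, h15,
    h8, h14, hF, h26, h27]
  repeat refine ⟨by omega, ?_⟩
  refine ⟨fun h => ?_, fun h => ?_⟩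
  · have hlt := of_ite_ne_zero h
    repeat refine ⟨by omega, ?_⟩
    refine ⟨fun h => ?_, fun h => ?_⟩
    · have heq := of_ite_ne_zero h
      obtain ⟨z, hz, hzf, hze⟩ := Env.exists_flagged (E := E) (N := N) (c := E.flags i + 1)
        (by omega) (by omega)
      obtain rfl : z = i + 1 := by rw [← hflag z hz hzf hze, heq]
      simp only [hcnt]
      repeat refine ⟨by omega, ?_⟩
      refine ⟨Keeps.mk' (.refl _ _ _) ?_ ?_, by omega, hze.symm, ?_, ?_⟩
      · intro r hr; simp at hr; simp [hr]
      · intro r hr; simp at hr; simp [hr]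
      · rw [Env.near_of_mark (by omega) (by rw [Env.flagMark_of_flagged hzf]; omega),
          Env.flagMark_of_flagged hzf, hze]
      · have hz' : ∀ y ≤ i + 1, E.Flagged y → y = i + 1 ∨ y ≤ i ∧ E.flags y ≠ E.flags i + 1 := by
          intro y hy hyf
          rcases Nat.eq_or_lt_of_le hy with h1 | h1
          · exact Or.inl h1
          · have : E.flags y ≤ E.flags i := Env.flags_mono (by omega)
            exact Or.inr ⟨by omega, by omega⟩
        refine ⟨by simp [hC.zero], fun y hy hyf => ?_, fun y hy hyf => ?_, fun y hy hyf => ?_⟩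
        · rcases hz' y hy hyf with rfl | ⟨h1, h2⟩
          · simp [hze]
          · simpa [h2] using hC.depth y h1 hyf
        · rcases hz' y hy hyf with rfl | ⟨h1, h2⟩
          · simp [hze]
          · simpa [h2] using hC.next y h1 hyf
        · rcases hz' y hy hyf with rfl | ⟨h1, h2⟩
          · simp [hze, Env.chain_of_flagged hzf]
          · simpa [h2] using hC.count y h1 hyf
    · have hne := of_ite_eq_zero h
      have hnf : ¬ E.Flagged (i + 1) := fun hf =>
        hne (hflag (i + 1) hi hf (by simpa using Env.flags_of_flagged hf))
      refine ⟨Keeps.mk' (.refl _ _ _) ?_ fun _ _ => rfl, by omega, hno hnf _ rfl rfl rfl⟩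
      intro r hr; simp at hr; simp [hr]
  · have hge := of_ite_eq_zero h
    have hnf : ¬ E.Flagged (i + 1) := fun hf => by
      have h1 := Env.flags_of_flagged hf
      have h2 : E.flags (i + 1) ≤ E.flags N := Env.flags_mono hi
      simp at h1; omega
    refine ⟨Keeps.mk' (.refl _ _ _) ?_ fun _ _ => rfl, by omega, hno hnf _ rfl rfl rfl⟩
    intro r hr; simp at hr; simp [hr]

/-- Outputs the matches that end at later positions of the next phrase, by following the links
between the flagged nodes. -/
def reportChain : Cmd :=
  .rep 19 (.get 15 (.var 25)) (
    .out (.var 9 ⊕ .get 13 (.var 25)) ;; .set 25 (.get 14 (.var 25)))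

theorem wp_reportChain (hE : E.Roomy b) {v : VS} {i : ℕ} (hi : i < E.n)
    (h9 : v.reg 9 = (E.textTo i).length) (h25 : v.reg 25 = E.near E.flagMark (i + 1))
    (hC : ChainTable E v (i + 1)) :
    reportChain.wp E v fun u => KeepsVars [19, 25] [] v u ∧
      u.time ≤ v.time + 50 * (E.chain (i + 1)).length + 50 ∧
      u.out = v.out ++ (E.chain (i + 1)).map fun d => (E.textTo i).length + d := by
  have hw := hE.word
  have hvis := hE.vis
  have hfl := hE.flags_lt
  have hul := E.textTo_length_le i
  have hnn : i * i ≤ E.n * E.n := Nat.mul_le_mul hi.le hi.le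
  have hnn' : (E.n + 1) * (E.n + 1) = E.n * E.n + 2 * E.n + 1 := by ring
  have hN : (Ex.get 15 (.var 25)).eval E v = (E.chain (i + 1)).length := by
    simp only [Ex.eval]; rw [h25, hC.count_near le_rfl]
  have hsmall : ∀ x ≤ i + 1, E.near E.flagMark x < E.L := by
    intro x hx
    have h1 := E.near_le_flags x
    have h2 : E.flags x ≤ E.flags E.n := Env.flags_mono (by omega)
    omega
  refine Cmd.wp_rep (fun j u => KeepsVars [19, 25] [] v u ∧ u.time ≤ v.time + 50 * j + 50 ∧
      u.out = v.out ++ ((E.chain (i + 1)).take j).map (fun d => (E.textTo i).length + d) ∧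
      ∃ x ≤ i + 1, u.reg 25 = E.near E.flagMark x ∧ E.chain x = (E.chain (i + 1)).drop j)
      ?_ ?_ ?_ ?_
  · have := hsmall (i + 1) le_rfl
    simp only [Ex.Safe, Ex.eval, h25, true_and]; omega
  · exact ⟨KeepsVars.mk' (.refl _ _ _) (fun _ _ => rfl) fun _ _ => rfl, by simp [Ex.cost],
      by simp, i + 1, le_rfl, h25, by simp⟩
  · rintro j hj u ⟨hk, ht, hout, x, hx, h25u, hch⟩
    rw [hN] at hj
    have r9 := hk.reg 9 (by decide)
    rw [h9] at r9
    have a13 := hk.arr 13 (by decide)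
    have a14 := hk.arr 14 (by decide)
    have hxs := hsmall x hx
    rcases Env.chain_near (E := E) x with ⟨h1, h2⟩ | ⟨z, hz, hf, h1, h2⟩
    · rw [h2] at hch
      have := congrArg List.length hch
      simp at this
      omega
    have hzd := E.dep_le z
    have hz0 : z ≠ 0 := by rintro rfl; simpa using hf.1
    have hzp := E.par_lt hz0
    have hd13 := hC.depth z (by omega) hf
    have hd14 := hC.next z (by omega) hf
    rw [h1] at hxs
    simp only [Cmd.wp, Ex.Safe, Ex.eval, BinOp.eval, BinOp.Safe, Ex.cost, Function.update_apply,
      Nat.reduceEqDiff, if_true, if_false, r9, a13, a14, h25u, h1, hd13, hd14, and_assoc, true_and]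
    repeat refine ⟨by omega, ?_⟩
    have hget : E.dep z :: E.chain (E.par z) = (E.chain (i + 1)).drop j := by rw [← hch, h2]
    rw [List.drop_eq_getElem_cons hj, List.cons.injEq] at hget
    refine ⟨hk.mk' ?_ fun _ _ => rfl, by omega, ?_, E.par z, by omega, rfl, hget.2⟩
    · intro r hr; simp at hr; simp [hr]
    · rw [hout, List.take_add_one, List.map_append, List.getElem?_eq_getElem hj, ← hget.1]
      simp
  · rintro u ⟨h1, h2, h3, -⟩
    rw [hN] at h2 h3
    exact ⟨h1, h2, by simpa using h3⟩

/-- Moves the window to the end of the next phrase. -/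
def moveWindow : Cmd :=
  .set 22 (.var 5 ⊖ .var 23) ;; .ite (.var 22 ≺ .var 10) .skip (.set 22 (.var 10)) ;;
  .rep 19 (.var 22) (.put 1 (.var 19) (.get 1 ((.var 10 ⊖ .var 22) ⊕ .var 19))) ;;
  .set 20 (.var 26) ;; .set 28 (.var 22) ;; walk 1 ;;
  .set 10 (.var 22 ⊕ .var 23) ;; .set 9 (.var 9 ⊕ .var 27)

theorem wp_moveWindow (hE : E.Roomy b) {v : VS} (hS : Params E b v) {i : ℕ} (hi : i < E.n)
    (h26 : v.reg 26 = i + 1) (h27 : v.reg 27 = E.dep (i + 1))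
    (h23 : v.reg 23 = min (E.dep (i + 1)) E.D)
    (h9 : v.reg 9 = (E.textTo i).length) (h10 : v.reg 10 = min (E.textTo i).length E.D)
    (h1 : ∀ t < v.reg 10, v.arr 1 t =
      ((E.textTo i).getD ((E.textTo i).length - v.reg 10 + t) 0).toNat) :
    moveWindow.wp E v fun u => Keeps [9, 10, 19, 20, 22, 28] [1] v u ∧
      u.time ≤ v.time + 100 * E.D + 200 ∧ Window E u (i + 1) := by
  have hw := hE.word
  have hDL := hE.D_le
  have hvis := hE.vis
  have hdle := E.dep_le (i + 1)
  have hul := E.textTo_length_le (i + 1)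
  have hus := E.textTo_length_succ i
  have hnn : (i + 1) * (i + 1) ≤ E.n * E.n := Nat.mul_le_mul hi hi
  have hnn' : (E.n + 1) * (E.n + 1) = E.n * E.n + 2 * E.n + 1 := by ring
  have hlen : (E.str (i + 1)).length = E.dep (i + 1) := rfl
  obtain ⟨g, hg⟩ : ∃ g, g = min (E.textTo i).length E.D := ⟨_, rfl⟩
  obtain ⟨l, hl⟩ : ∃ l, l = min (E.dep (i + 1)) E.D := ⟨_, rfl⟩
  obtain ⟨g', hg'⟩ : ∃ g', g' = min g (E.D - l) := ⟨_, rfl⟩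
  rw [← hg] at h10
  rw [← hl] at h23
  rw [h10] at h1
  have hmain : ∀ a : VS, Keeps [22] [] v a → a.reg 22 = g' → a.time ≤ v.time + 50 →
      (Cmd.rep 19 (.var 22) (.put 1 (.var 19)
        (.get 1 ((.var 10 ⊖ .var 22) ⊕ .var 19))) ;;
      .set 20 (.var 26) ;; .set 28 (.var 22) ;; walk 1 ;;
      .set 10 (.var 22 ⊕ .var 23) ;; .set 9 (.var 9 ⊕ .var 27)).wp E a fun u =>
      Keeps [9, 10, 19, 20, 22, 28] [1] v u ∧
      u.time ≤ v.time + 100 * E.D + 200 ∧ Window E u (i + 1) := by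
    intro a hka a22 ta
    have a10 := (hka.reg 10 (by decide)).trans h10
    have a1 := hka.arr 1 (by decide)
    have hka' := hka.mono (R' := [9, 10, 19, 20, 22, 28]) (A' := [1]) (by decide) (by decide)
    refine Cmd.wp_seq (Cmd.wp_rep (fun j u => Keeps [19] [1] a u ∧
      u.time ≤ a.time + 50 * j + 20 ∧ (∀ t < j, u.arr 1 t = a.arr 1 (g - g' + t)) ∧
      ∀ t, j ≤ t → u.arr 1 t = a.arr 1 t) trivial ?_ ?_ ?_)
    · exact ⟨Keeps.mk' (.refl _ _ _) (fun _ _ => rfl) fun _ _ => rfl, by simp [Ex.cost],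
        fun i hi => by omega, fun _ _ => rfl⟩
    · rintro j hj u ⟨hk, ht, hdone, htodo⟩
      simp only [Ex.eval, a22] at hj
      have r10 := hk.reg 10 (by decide)
      have r22 := hk.reg 22 (by decide)
      rw [a10] at r10
      rw [a22] at r22
      simp only [Cmd.wp, Ex.Safe, Ex.eval, BinOp.eval, BinOp.Safe, Ex.cost, Function.update_apply,
        Nat.reduceEqDiff, if_true, if_false, r10, r22, and_assoc, true_and]
      repeat refine ⟨by omega, ?_⟩
      refine ⟨hk.mk' ?_ ?_, by omega, fun t ht => ?_, fun t ht => ?_⟩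
      · intro r hr; simp at hr; simp [hr]
      · intro r hr; simp at hr; simp [hr]
      · by_cases htj : t = j
        · subst htj; rw [if_pos rfl, htodo _ (by omega)]
        · rw [if_neg htj, hdone t (by omega)]
      · rw [if_neg (by omega), htodo t (by omega)]
    · rintro x ⟨hkx, htx, hx1, -⟩
      have hkx' := hka'.trans (hkx.mono (R' := [9, 10, 19, 20, 22, 28]) (A' := [1])
        (by decide) (by decide))
      simp only [Ex.eval, a22] at htx hx1
      have x26 := hkx'.reg 26 (by decide)
      have x22 := (hkx.reg 22 (by decide)).trans a22
      rw [h26] at x26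
      simp only [Cmd.wp, Ex.Safe, Ex.eval, BinOp.eval, BinOp.Safe, Ex.cost, Function.update_apply,
        Nat.reduceEqDiff, if_false, x26, x22, true_and]
      have x23 := (hkx'.reg 23 (by decide)).trans h23
      have hky : Keeps [9, 10, 19, 20, 22, 28] [1] v ⟨Function.update (Function.update x.reg 20
          (i + 1)) 28 g', x.arr, x.out, x.time + (1 + 1) + (1 + 1)⟩ :=
        hkx'.mk' (by intro r hr; simp at hr; simp [hr]) fun _ _ => rfl
      refine Cmd.wp_mono E _ (wp_walk hE 1 (by decide) (x := i + 1) (l := l) (p := g')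
        ?_ ?_ ?_ (by omega) (by omega)) ?_
      · simp
      · simpa using x23
      · simp
      rintro y ⟨hkY, hty, -, hc, ho⟩
      have hkY' := hky.trans (hkY.mono (R' := [9, 10, 19, 20, 22, 28]) (A' := [1])
        (by decide) (by decide))
      have y22 : y.reg 22 = g' := by
        rw [hkY.reg 22 (by decide)]; simpa using x22
      have y23 := (hkY'.reg 23 (by decide)).trans h23
      have y27 := (hkY'.reg 27 (by decide)).trans h27
      have y9 : y.reg 9 = (E.textTo i).length := by
        rw [hkY.reg 9 (by decide), ← h9, ← hka.reg 9 (by decide), ← hkx.reg 9 (by decide)]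
        simp
      simp only at hty
      rw [y22, y23, y9, y27]
      repeat refine ⟨by omega, ?_⟩
      refine ⟨hkY'.mk' ?_ fun _ _ => rfl, by omega, ?_⟩
      · intro r hr; simp at hr; simp [hr]
      · refine ⟨by simp [hus], by simp; omega, ?_⟩
        simp only [Function.update_apply, Nat.reduceEqDiff, if_true, if_false]
        intro t ht
        by_cases htg : t < g'
        · rw [ho t (Or.inl htg)]
          simp only
          rw [hx1 t htg, a1, h1 _ (by omega), hus]
          congr 1
          rw [Env.textTo, List.getD_eq_getElem?_getD, List.getD_eq_getElem?_getD,
            List.getElem?_append_left (by omega)]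
          congr 2; omega
        · obtain ⟨s, rfl⟩ := Nat.exists_eq_add_of_le (show g' ≤ t by omega)
          rw [hc s (by omega) (by omega), hus]
          congr 1
          rw [Env.textTo, List.getD_eq_getElem?_getD, List.getD_eq_getElem?_getD,
            List.getElem?_append_right (by omega)]
          congr 2; omega
  have r5 := hS.r5
  refine Cmd.wp_seq ⟨?_, Cmd.wp_seq ⟨⟨trivial, trivial, trivial⟩, fun h => ?_, fun h => ?_⟩⟩
  · simp only [Ex.Safe, Ex.eval, BinOp.Safe, true_and]; omega
  · simp only [Ex.eval, BinOp.eval, Function.update_apply, Nat.reduceEqDiff, if_true, if_false, r5,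
      h23, h10] at h
    have := of_ite_ne_zero h
    refine Cmd.wp_skip (hmain _ ⟨?_, fun _ _ => rfl, rfl⟩ ?_ ?_)
    · intro r hr; simp at hr; simp [hr]
    · simp only [Ex.eval, BinOp.eval, Function.update_self, r5, h23]; omega
    · simp only [Ex.cost]; omega
  · simp only [Ex.eval, BinOp.eval, Function.update_apply, Nat.reduceEqDiff, if_true, if_false, r5,
      h23, h10] at h
    have := of_ite_eq_zero h
    refine Cmd.wp_set trivial (hmain _ ⟨?_, fun _ _ => rfl, rfl⟩ ?_ ?_)
    · intro r hr; simp at hr; simp [hr]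
    · simp only [Ex.eval, BinOp.eval, Function.update_self,
        Function.update_of_ne (show (10 : ℕ) ≠ 22 by decide), h10]
      omega
    · simp only [Ex.cost]; omega

end

/-! ### The search -/

section

variable {w : ℕ} {E : Env w} {b : ℕ}

/-- The matches in the first `i` phrases have been reported. -/
structure Reported (E : Env w) (v : VS) (i : ℕ) : Prop where
  window : Window E v i
  lists : ListsExactly v.out (matchSet E.k E.P (E.textTo i))
  flag : v.reg 14 = E.flags i
  chain : ChainTable E v i

/-- Reports the matches in the next phrase. -/
def reportPhrase : Cmd := loadPhrase ;; reportNear ;; noteFlag ;; reportChain ;; moveWindow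

theorem wp_reportPhrase (hE : E.Roomy b) {v : VS} (hS : Params E b v) {i j N : ℕ} (hi : i < N)
    (hN : N ≤ E.n) (h15 : v.reg 15 = j) (hj : j < b) (h12 : v.reg 12 + j = i + 1)
    (h7 : v.arr 7 j = E.dep (i + 1)) (h8 : v.arr 8 j = E.near E.flagMark (E.par (i + 1)))
    (h6 : v.arr 6 j = E.near E.depthMark (E.par (i + 1)))
    (hF : v.reg 8 = E.flags N) (hT : FlagTable E v N) (hR : Reported E v i) :
    reportPhrase.wp E v fun u =>
      KeepsVars [9, 10, 14, 19, 20, 22, 23, 24, 25, 26, 27, 28] [1, 2, 3, 13, 14, 15] v u ∧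
      u.time + 50 * v.out.length ≤
        v.time + 50 * u.out.length + 700 * (E.D + E.callTime + 1) ∧ Reported E u (i + 1) := by
  have hin : i < E.n := by omega
  refine Cmd.wp_seq <| Cmd.wp_mono E _ (wp_loadPhrase hE hS hin hj h15 h12 hR.window h7 h6) ?_
  rintro x ⟨hkx, htx, x26, x27, x23, x1⟩
  have hkx' := hkx.vars (R' := [9, 10, 14, 19, 20, 22, 23, 24, 25, 26, 27, 28])
    (A' := [1, 2, 3, 13, 14, 15]) (by decide) (by decide)
  have x9 : x.reg 9 = (E.textTo i).length := by rw [hkx.reg 9 (by decide), hR.window.pos]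
  have x10 : x.reg 10 = min (E.textTo i).length E.D := by
    rw [hkx.reg 10 (by decide), hR.window.len]
  refine Cmd.wp_seq <| Cmd.wp_mono E _ (wp_reportNear hE (hS.keepsVars hkx' (by decide)) hin x9 x10
    x23 x1) ?_
  rintro y ⟨hky, hty, l, hyout, hl, hmem⟩
  have hky' := hkx'.trans (hky.mono (R' := [9, 10, 14, 19, 20, 22, 23, 24, 25, 26, 27, 28])
    (A' := [1, 2, 3, 13, 14, 15]) (by decide) (by decide))
  have y12 : y.arr 12 = v.arr 12 := hky'.arr 12 (by decide)
  have y26 := (hky.reg 26 (by decide)).trans x26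
  have y27 := (hky.reg 27 (by decide)).trans x27
  have y15 : y.reg 15 = j := by rw [hky'.reg 15 (by decide), h15]
  have y8 : y.arr 8 j = E.near E.flagMark (E.par (i + 1)) := by rw [hky'.arr 8 (by decide), h8]
  have y14 : y.reg 14 = E.flags i := by
    rw [hky.reg 14 (by decide), hkx.reg 14 (by decide), hR.flag]
  have yF : y.reg 8 = E.flags N := by rw [hky'.reg 8 (by decide), hF]
  have hTy : FlagTable E y N := hT.mono le_rfl y12
  have hCy : ChainTable E y i := hR.chain.keeps
    (by rw [hky.arr 13 (by decide), hkx.arr 13 (by decide)])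
    (by rw [hky.arr 14 (by decide), hkx.arr 14 (by decide)])
    (by rw [hky.arr 15 (by decide), hkx.arr 15 (by decide)])
  refine Cmd.wp_seq <| Cmd.wp_mono E _ (wp_noteFlag hE hi hN y15 hj y26 y27 y8 y14 yF hTy hCy) ?_
  rintro z ⟨hkz, htz, z14, z25, hCz⟩
  have hkz' := hky'.trans (hkz.vars (R' := [9, 10, 14, 19, 20, 22, 23, 24, 25, 26, 27, 28])
    (A' := [1, 2, 3, 13, 14, 15]) (by decide) (by decide))
  have z9 : z.reg 9 = (E.textTo i).length := by
    rw [hkz.reg 9 (by decide), hky.reg 9 (by decide), x9]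
  refine Cmd.wp_seq <| Cmd.wp_mono E _ (wp_reportChain hE hin z9 z25 hCz) ?_
  rintro p ⟨hkp, htp, hpout⟩
  have hkp' := hkz'.trans (hkp.mono (R' := [9, 10, 14, 19, 20, 22, 23, 24, 25, 26, 27, 28])
    (A' := [1, 2, 3, 13, 14, 15]) (by decide) (by decide))
  have p26 : p.reg 26 = i + 1 := by rw [hkp.reg 26 (by decide), hkz.reg 26 (by decide), y26]
  have p27 : p.reg 27 = E.dep (i + 1) := by
    rw [hkp.reg 27 (by decide), hkz.reg 27 (by decide), y27]
  have p23 : p.reg 23 = min (E.dep (i + 1)) E.D := by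
    rw [hkp.reg 23 (by decide), hkz.reg 23 (by decide), hky.reg 23 (by decide), x23]
  have p9 : p.reg 9 = (E.textTo i).length := by rw [hkp.reg 9 (by decide), z9]
  have p10 : p.reg 10 = x.reg 10 := by
    rw [hkp.reg 10 (by decide), hkz.reg 10 (by decide), hky.reg 10 (by decide)]
  have p1 : p.arr 1 = x.arr 1 := by
    rw [hkp.arr 1 (by decide), hkz.arr 1 (by decide), hky.arr 1 (by decide)]
  refine Cmd.wp_mono E _ (wp_moveWindow hE (hS.keepsVars hkp' (by decide)) hin p26 p27 p23 p9
    (p10.trans x10) ?_) ?_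
  · intro t ht
    rw [p10] at ht ⊢
    rw [p1, x1 t (by omega)]
    congr 1
    rw [List.getD_eq_getElem?_getD, List.getD_eq_getElem?_getD,
      List.getElem?_append_left (by rw [List.length_drop]; omega), List.getElem?_drop]
  rintro u ⟨hku, htu, hWu⟩
  have huout : u.out = v.out ++ l ++ (E.chain (i + 1)).map fun d => (E.textTo i).length + d := by
    rw [hku.out, hpout, hkz.out, hyout, hkx.out]
  refine ⟨hkp'.trans (hku.vars (by decide) (by decide)), ?_, hWu, ?_, ?_, ?_⟩
  · have := congrArg List.length huout
    simp only [List.length_append, List.length_map] at this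
    omega
  · rw [huout]
    exact Env.listsExactly_succ hR.lists hl hmem
  · rw [hku.reg 14 (by decide), hkp.reg 14 (by decide), z14]
  · refine hCz.keeps ?_ ?_ ?_
    · rw [hku.arr 13 (by decide), hkp.arr 13 (by decide)]
    · rw [hku.arr 14 (by decide), hkp.arr 14 (by decide)]
    · rw [hku.arr 15 (by decide), hkp.arr 15 (by decide)]

/-- Reports the matches in the phrases of the current block. -/
def reportBlock : Cmd := .rep 15 (.var 13) reportPhrase

theorem wp_reportBlock (hE : E.Roomy b) {v : VS} (hS : Params E b v) {lo cb : ℕ}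
    (h12 : v.reg 12 = lo) (h13 : v.reg 13 = cb) (hlo : 0 < lo) (hcb : lo + cb ≤ E.n + 1)
    (hb : cb ≤ b) (hq : ∀ j < cb, v.arr 7 j = E.dep (lo + j) ∧
      v.arr 8 j = E.near E.flagMark (E.par (lo + j)) ∧
      v.arr 6 j = E.near E.depthMark (E.par (lo + j)))
    (hF : v.reg 8 = E.flags (lo + cb - 1)) (hT : FlagTable E v (lo + cb - 1))
    (hR : Reported E v (lo - 1)) :
    reportBlock.wp E v fun u =>
      KeepsVars [9, 10, 14, 15, 19, 20, 22, 23, 24, 25, 26, 27, 28] [1, 2, 3, 13, 14, 15] v u ∧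
      u.time + 50 * v.out.length ≤
        v.time + 50 * u.out.length + 800 * (cb * (E.D + E.callTime + 1)) + 50 ∧
      Reported E u (lo + cb - 1) := by
  refine Cmd.wp_rep (fun j u =>
      KeepsVars [9, 10, 14, 15, 19, 20, 22, 23, 24, 25, 26, 27, 28] [1, 2, 3, 13, 14, 15] v u ∧
      u.time + 50 * v.out.length ≤
        v.time + 50 * u.out.length + 800 * (j * (E.D + E.callTime + 1)) + 50 ∧
      Reported E u (lo + j - 1)) trivial ?_ ?_ ?_
  · exact ⟨KeepsVars.mk' (.refl _ _ _) (fun _ _ => rfl) fun _ _ => rfl, by simp [Ex.cost]; omega,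
      ⟨⟨hR.window.pos, hR.window.len, hR.window.arr⟩, hR.lists, hR.flag,
        hR.chain.keeps rfl rfl rfl⟩⟩
  · rintro j hj u ⟨hk, ht, hRu⟩
    simp only [Ex.eval, h13] at hj
    have hk5 : KeepsVars [9, 10, 14, 15, 19, 20, 22, 23, 24, 25, 26, 27, 28]
        [1, 2, 3, 13, 14, 15] v ⟨Function.update u.reg 15 j, u.arr, u.out, u.time + 5⟩ :=
      hk.mk' (by intro r hr; simp at hr; simp [hr]) fun _ _ => rfl
    obtain ⟨q7, q8, q6⟩ := hq j hj
    have hidx : lo + j = lo + j - 1 + 1 := by omega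
    rw [hidx] at q7 q8 q6
    refine Cmd.wp_mono E _ (wp_reportPhrase hE (hS.keepsVars hk5 (by decide)) (i := lo + j - 1)
      (j := j) (N := lo + cb - 1) (by omega) (by omega) ?_ (by omega) ?_ ?_ ?_ ?_ ?_ ?_ ?_) ?_
    · simp
    · rw [hk5.reg 12 (by decide), h12]; exact hidx
    · rw [hk5.arr 7 (by decide), q7]
    · rw [hk5.arr 8 (by decide), q8]
    · rw [hk5.arr 6 (by decide), q6]
    · rw [hk5.reg 8 (by decide), hF]
    · exact hT.mono le_rfl (hk5.arr 12 (by decide))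
    · exact ⟨⟨by simpa using hRu.window.pos, by simpa using hRu.window.len,
        by simpa using hRu.window.arr⟩, hRu.lists, by simpa using hRu.flag,
        hRu.chain.keeps rfl rfl rfl⟩
    rintro x ⟨hkx, htx, hRx⟩
    have hmul : (j + 1) * (E.D + E.callTime + 1) =
      j * (E.D + E.callTime + 1) + (E.D + E.callTime + 1) := by ring
    refine ⟨hk5.trans (hkx.mono (by decide) (by decide)), ?_, ?_⟩
    · simp only at htx; omega
    · rw [show lo + (j + 1) - 1 = lo + j - 1 + 1 by omega]; exact hRx
  · rintro u ⟨h1, h2, h3⟩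
    simp only [Ex.eval, h13] at *
    exact ⟨h1, h2, h3⟩

/-- Processes the block number `r`, where the variable `11` holds `r`. -/
def processBlock : Cmd :=
  .set 12 (.var 11 ⊗ .var 6 ⊕ .lit 1) ;;
  .set 13 ((.var 0 ⊕ .lit 1) ⊖ .var 12) ;; .ite (.var 6 ≺ .var 13) (.set 13 (.var 6)) .skip ;;
  .set 29 (.var 8) ;; findFlags ;; answerQueries ;; .set 14 (.var 29) ;; reportBlock

/-- What holds after the first `i` nodes have been processed. -/
structure Processed (E : Env w) (b : ℕ) (v : VS) (i : ℕ) : Prop where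
  params : Params E b v
  count : v.reg 8 = E.flags i
  table : FlagTable E v i
  reported : Reported E v i

theorem wp_processBlock (hE : E.Roomy b) {v : VS} {r : ℕ} (h11 : v.reg 11 = r)
    (hr : r * b < E.n) (hP : Processed E b v (r * b)) :
    processBlock.wp E v fun u =>
      u.time + 50 * v.out.length ≤
        v.time + 50 * u.out.length +
          1000 * ((min ((r + 1) * b) E.n - r * b) * (E.D + E.callTime + 1)) +
          3000 * ((r + 1) * (b + 1)) + 500 ∧
      Processed E b u (min ((r + 1) * b) E.n) := by
  have hw := hE.word
  obtain ⟨hS, hF, hT, hR⟩ := hP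
  obtain ⟨lo, hlo⟩ : ∃ lo, lo = r * b + 1 := ⟨_, rfl⟩
  obtain ⟨cb, hcb⟩ : ∃ cb, cb = min b (E.n + 1 - lo) := ⟨_, rfl⟩
  have hsucc : (r + 1) * b = r * b + b := by ring
  have hmin : min ((r + 1) * b) E.n = lo + cb - 1 := by omega
  have hcbe : lo + cb - 1 - r * b = cb := by omega
  have hi : r * b = lo - 1 := by omega
  rw [hmin, hcbe]
  rw [hi] at hF hT hR
  have hrb : r ≤ r * b := Nat.le_mul_of_pos_right _ hE.b_pos
  have hstart : ∀ a : VS, Keeps [12, 13] [] v a → a.reg 12 = lo → a.reg 13 = cb →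
      a.time ≤ v.time + 50 → (.set 29 (.var 8) ;; findFlags ;; answerQueries ;;
        .set 14 (.var 29) ;; reportBlock : Cmd).wp E a fun u =>
      u.time + 50 * v.out.length ≤
        v.time + 50 * u.out.length + 1000 * (cb * (E.D + E.callTime + 1)) +
          3000 * ((r + 1) * (b + 1)) + 500 ∧
      Processed E b u (lo + cb - 1) := by
    intro a hka a12 a13 hta
    have hkc : Keeps [12, 13, 29] [] v ⟨Function.update a.reg 29 (a.reg 8), a.arr, a.out,
        a.time + 2⟩ := (hka.mono (R' := [12, 13, 29]) (by decide) (by decide)).mk'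
      (by intro r hr; simp at hr; simp [hr]) fun _ _ => rfl
    refine Cmd.wp_seq ⟨trivial, ?_⟩
    simp only [Ex.eval, Ex.cost]
    refine Cmd.wp_seq <| Cmd.wp_mono E _ (wp_findFlags hE (hS.keeps hkc (by decide)) (lo := lo)
      (cb := cb) ?_ ?_ (by omega) (by omega) ?_ ?_) ?_
    · simpa using a12
    · simpa using a13
    · rw [hkc.reg 8 (by decide), hF]
    · exact hT.mono le_rfl (hkc.arr 12 (by decide))
    rintro x ⟨hkx, htx, x8, hTx⟩
    have hSx := (hS.keeps hkc (by decide)).keeps hkx (by decide)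
    have hBx : InBlock E b r lo cb x := by
      refine InBlock.keeps ⟨?_, ?_, ?_, hlo, by omega, hcb⟩ hkx (by decide)
      · rw [hkc.reg 11 (by decide), h11]
      · simpa using a12
      · simpa using a13
    refine Cmd.wp_seq <| Cmd.wp_mono E _ (wp_answerQueries hE hSx hBx x8 hTx) ?_
    rintro y ⟨hky, hty, hq⟩
    refine Cmd.wp_seq ⟨trivial, ?_⟩
    simp only [Ex.eval, Ex.cost]
    have y29 : y.reg 29 = E.flags (lo - 1) := by
      rw [hky.reg 29 (by decide), hkx.reg 29 (by decide), ← hF]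
      simp [hka.reg 8 (by decide)]
    have hkz : Keeps [14, 15, 16, 17, 18, 19, 20, 21, 22] [4, 5, 6, 7, 8, 9, 10, 11] x
        ⟨Function.update y.reg 14 (y.reg 29), y.arr, y.out, y.time + (1 + 1)⟩ :=
      hky.mk' (by intro r hr; simp at hr; simp [hr]) fun _ _ => rfl
    have hBz := hBx.keeps hkz (by decide)
    have hTz : FlagTable E ⟨Function.update y.reg 14 (y.reg 29), y.arr, y.out,
        y.time + (1 + 1)⟩ (lo + cb - 1) := hTx.mono le_rfl (hkz.arr 12 (by decide))
    have hSz := hSx.keeps hkz (by decide)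
    have z8 : y.reg 8 = E.flags (lo + cb - 1) := by rw [hky.reg 8 (by decide), x8]
    have harr : ∀ s, s = 1 ∨ s = 13 ∨ s = 14 ∨ s = 15 → y.arr s = v.arr s := by
      intro s hs
      rw [hky.arr s (by simp; omega), hkx.arr s (by simp; omega), hkc.arr s (by simp)]
    have y9 : y.reg 9 = v.reg 9 := by
      rw [hky.reg 9 (by decide), hkx.reg 9 (by decide), hkc.reg 9 (by decide)]
    have y10 : y.reg 10 = v.reg 10 := by
      rw [hky.reg 10 (by decide), hkx.reg 10 (by decide), hkc.reg 10 (by decide)]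
    have yout : y.out = v.out := by rw [hky.out, hkx.out, hkc.out]
    refine Cmd.wp_mono E _ (wp_reportBlock hE hSz hBz.r12 hBz.r13 (by omega) (by omega)
      (by omega) hq (by simpa using z8) hTz ?_) ?_
    · refine ⟨⟨?_, ?_, ?_⟩, ?_, ?_, ?_⟩
      · simpa [y9] using hR.window.pos
      · simpa [y10] using hR.window.len
      · simpa [y10, harr 1] using hR.window.arr
      · simpa [yout] using hR.lists
      · simpa using y29
      · exact hR.chain.keeps (harr 13 (by simp)) (harr 14 (by simp)) (harr 15 (by simp))
    rintro u ⟨hku, htu, hRu⟩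
    refine ⟨?_, hSz.keepsVars hku (by decide), ?_, hTz.mono le_rfl (hku.arr 12 (by decide)), hRu⟩
    · simp only at htx htu
      rw [yout] at htu
      omega
    · rw [hku.reg 8 (by decide)]; simpa using z8
  have hnn : (E.n + 1) * (E.n + 1) = E.n * E.n + 2 * E.n + 1 := by ring
  refine Cmd.wp_seq ⟨?_, Cmd.wp_seq ⟨?_, Cmd.wp_seq ⟨⟨trivial, trivial, trivial⟩,
    fun h => ?_, fun h => ?_⟩⟩⟩
  · simp only [Ex.Safe, Ex.eval, BinOp.Safe, BinOp.eval, h11, hS.r6, true_and]; omega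
  · simp only [Ex.Safe, Ex.eval, BinOp.Safe, BinOp.eval, Function.update_apply, Nat.reduceEqDiff,
      if_true, if_false, h11, hS.r6, hS.r0, true_and]
    omega
  · simp only [Ex.eval, BinOp.eval, Function.update_apply, Nat.reduceEqDiff, if_true, if_false,
      h11, hS.r6, hS.r0] at h
    have := of_ite_ne_zero h
    refine Cmd.wp_set trivial (hstart _ ⟨?_, fun _ _ => rfl, rfl⟩ ?_ ?_ ?_)
    · intro r hr; simp at hr; simp [hr]
    · simp [Ex.eval, BinOp.eval, h11, hS.r6, hlo]
    · simp only [Ex.eval, Function.update_apply, Nat.reduceEqDiff, if_true, if_false, hS.r6]; omega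
    · simp only [Ex.cost]; omega
  · simp only [Ex.eval, BinOp.eval, Function.update_apply, Nat.reduceEqDiff, if_true, if_false,
      h11, hS.r6, hS.r0] at h
    have := of_ite_eq_zero h
    refine Cmd.wp_skip (hstart _ ⟨?_, fun _ _ => rfl, rfl⟩ ?_ ?_ ?_)
    · intro r hr; simp at hr; simp [hr]
    · simp [Ex.eval, BinOp.eval, h11, hS.r6, hlo]
    · simp only [Ex.eval, BinOp.eval, Function.update_apply, Nat.reduceEqDiff, if_true, if_false,
        hS.r6, hS.r0, h11]; omega
    · simp only [Ex.cost]; omega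

/-- Computes the parameters and prepares the tables. -/
def setup : Cmd :=
  .set 5 (.var 1 ⊕ .var 2) ;; .set 6 (.var 0 ⊘ .var 3 ⊕ .lit 1) ;; .set 7 (.var 5 ⊕ .var 5) ;;
  .set 8 (.lit 0) ;; .set 9 (.lit 0) ;; .set 10 (.lit 0) ;; .set 14 (.lit 0) ;;
  .put 12 (.lit 0) (.lit 0) ;; .put 15 (.lit 0) (.lit 0)

theorem wp_setup {v : VS} {τ : ℕ} (hb : b = E.n / τ + 1) (hE : E.Roomy b)
    (h0 : v.reg 0 = E.n) (h1 : v.reg 1 = E.P.length) (h2 : v.reg 2 = E.k) (h3 : v.reg 3 = τ)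
    (hout : v.out = []) :
    setup.wp E v fun u => u.time ≤ v.time + 100 ∧ u.out = [] ∧ Processed E b u 0 := by
  have hw := hE.word
  have hvis := hE.vis
  have hpos := hE.fits.pos
  have hD : E.D = E.P.length + E.k := rfl
  have hflag : ¬ E.Flagged 0 := fun h => by simpa using h.1
  have hz : ∀ z ≤ 0, ¬ E.Flagged z := fun z hz hf => by
    obtain rfl : z = 0 := by omega
    exact hflag hf
  simp only [setup, Cmd.wp, Ex.Safe, Ex.eval, BinOp.eval, BinOp.Safe, Ex.cost,
    Function.update_apply, Nat.reduceEqDiff, if_true, if_false, and_assoc, true_and, h0, h1, h2,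
    h3, ← hD, ← hb]
  repeat refine ⟨by omega, ?_⟩
  refine ⟨⟨by simp [h0], by simp [h1], by simp [h2], by simp, by simp, ?_⟩, ?_, ⟨?_, ?_⟩,
    ⟨?_, ?_, ?_⟩, ?_, ?_, ⟨?_, ?_, ?_, ?_⟩⟩
  · simp only [Function.update_apply, Nat.reduceEqDiff, if_true, if_false]; omega
  · simp [Env.flags_zero]
  · simp
  · exact fun y hy hf => absurd hf (hz y hy)
  · simp [Env.textTo]
  · simp [Env.textTo]
  · simp
  · simp only [hout]
    refine ⟨List.nodup_nil, ?_⟩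
    ext x
    simp [Env.textTo, mem_matchSet_iff]
    omega
  · simp [Env.flags_zero]
  · simp
  · exact fun y hy hf => absurd hf (hz y hy)
  · exact fun y hy hf => absurd hf (hz y hy)
  · exact fun y hy hf => absurd hf (hz y hy)

/-- The whole search. -/
def search : Cmd := setup ;; .rep 11 ((.var 0 ⊖ .lit 1) ⊘ .var 6 ⊕ .lit 1) processBlock

theorem wp_search {v : VS} {τ : ℕ} (hτ : 1 ≤ τ) (hE : E.Roomy (E.n / τ + 1)) (hn : 0 < E.n)
    (h0 : v.reg 0 = E.n) (h1 : v.reg 1 = E.P.length) (h2 : v.reg 2 = E.k) (h3 : v.reg 3 = τ)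
    (hout : v.out = []) :
    search.wp E v fun u => ListsExactly u.out (matchSet E.k E.P (E.textTo E.n)) ∧
      u.time ≤ v.time + 20000 * (E.n * (τ + E.D + E.callTime)) + 50 * u.out.length := by
  obtain ⟨b, hb⟩ : ∃ b, b = E.n / τ + 1 := ⟨_, rfl⟩
  rw [← hb] at hE
  have hw := hE.word
  have hD0 := hE.wf.D_pos
  have hnn : (E.n + 1) * (E.n + 1) = E.n * E.n + 2 * E.n + 1 := by ring
  obtain ⟨N, hN⟩ : ∃ N, N = (E.n - 1) / b + 1 := ⟨_, rfl⟩
  have hdm := Nat.div_mul_le_self (E.n - 1) b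
  have hdm' := Nat.lt_div_mul_add (a := E.n - 1) hE.b_pos
  have hNb : N * b = (E.n - 1) / b * b + b := by rw [hN]; ring
  have hNle : (E.n - 1) / b ≤ E.n - 1 := Nat.div_le_self _ _
  have hbn : b ≤ E.n + 1 := by rw [hb]; have := Nat.div_le_self E.n τ; omega
  have hNτ : N ≤ τ := by
    have h4 : E.n < τ * b := by
      have := Nat.lt_div_mul_add (a := E.n) hτ
      rw [hb, Nat.mul_comm, Nat.add_mul, Nat.one_mul]; exact this
    have : (E.n - 1) / b < τ := by
      rw [Nat.div_lt_iff_lt_mul hE.b_pos]; omega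
    omega
  refine Cmd.wp_seq <| Cmd.wp_mono E _ (wp_setup hb hE h0 h1 h2 h3 hout) ?_
  rintro x ⟨htx, hxout, hPx⟩
  have hNe : ((Ex.var 0 ⊖ .lit 1) ⊘ .var 6 ⊕ .lit 1).eval E x = N := by
    simp only [Ex.eval, BinOp.eval, hPx.params.r0, hPx.params.r6, hN]
  refine Cmd.wp_rep (fun r u => u.time ≤ x.time + 50 * u.out.length +
      1000 * (min (r * b) E.n * (E.D + E.callTime + 1)) +
      r * (3000 * (N * (b + 1)) + 505) + 50 ∧
    Processed E b u (min (r * b) E.n)) ?_ ?_ ?_ ?_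
  · simp only [Ex.Safe, Ex.eval, BinOp.eval, BinOp.Safe, hPx.params.r0, hPx.params.r6, true_and,
      and_true]
    omega
  · obtain ⟨h4, h5, h6, h7⟩ := hPx
    refine ⟨by simp [Ex.cost]; omega, ?_⟩
    rw [Nat.zero_mul, min_eq_left (Nat.zero_le _)]
    exact ⟨⟨h4.r0, h4.r1, h4.r2, h4.r5, h4.r6, h4.r7⟩, h5, ⟨h6.zero, h6.mem⟩,
      ⟨h7.window.pos, h7.window.len, h7.window.arr⟩, h7.lists, h7.flag,
      h7.chain.keeps rfl rfl rfl⟩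
  · rintro r hr u ⟨htu, hPu⟩
    rw [hNe] at hr
    have hrb : r * b ≤ (E.n - 1) / b * b := Nat.mul_le_mul_right _ (by omega)
    have hrn : r * b < E.n := by omega
    rw [min_eq_left hrn.le] at htu hPu
    have hk : Keeps [11] [] u ⟨Function.update u.reg 11 r, u.arr, u.out, u.time + 5⟩ :=
      Keeps.mk' (.refl _ _ _) (by intro r hr; simp at hr; simp [hr]) fun _ _ => rfl
    obtain ⟨h4, h5, h6, h7⟩ := hPu
    refine Cmd.wp_mono E _ (wp_processBlock hE (r := r) (by simp) hrn ⟨h4.keeps hk (by decide),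
      by simpa using h5, h6.mono le_rfl rfl, ⟨by simpa using h7.window.pos,
        by simpa using h7.window.len, by simpa using h7.window.arr⟩, h7.lists,
        by simpa using h7.flag, h7.chain.keeps rfl rfl rfl⟩) ?_
    rintro y ⟨hty, hPy⟩
    refine ⟨?_, hPy⟩
    have hmin : r * b ≤ min ((r + 1) * b) E.n :=
      le_min (Nat.mul_le_mul_right _ (by omega)) hrn.le
    obtain ⟨c, hc⟩ := Nat.exists_eq_add_of_le hmin
    rw [hc] at hty ⊢
    have e1 : (r * b + c) * (E.D + E.callTime + 1) =
      r * b * (E.D + E.callTime + 1) + c * (E.D + E.callTime + 1) := by ring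
    have e2 : (r + 1) * (3000 * (N * (b + 1)) + 505) = r * (3000 * (N * (b + 1)) + 505) +
      3000 * (N * (b + 1)) + 505 := by ring
    have e3 : (r + 1) * (b + 1) ≤ N * (b + 1) := Nat.mul_le_mul_right _ hr
    rw [Nat.add_sub_cancel_left] at hty
    simp only at hty
    omega
  · rintro u ⟨htu, hPu⟩
    rw [hNe] at htu hPu
    rw [min_eq_right (by omega)] at htu hPu
    refine ⟨hPu.reported.lists, ?_⟩
    have e1 : N * (b + 1) ≤ 3 * E.n := by
      have h1 : N * (b + 1) = N * b + N := by ring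
      have h2 : b ≤ E.n / 1 + 1 := hb ▸ Nat.add_le_add_right (Nat.div_le_div_left hτ one_pos) 1
      omega
    have e2 : N * (3000 * (N * (b + 1)) + 505) ≤ τ * (9000 * E.n + 505 * E.n) :=
      Nat.mul_le_mul hNτ (by omega)
    have e3 : E.n * (E.D + E.callTime + 1) ≤ 2 * (E.n * (E.D + E.callTime)) := by
      have := Nat.mul_le_mul_left E.n (show E.D + E.callTime + 1 ≤ 2 * (E.D + E.callTime) by omega)
      linarith
    have e4 : E.n * (τ + E.D + E.callTime) = E.n * τ + E.n * (E.D + E.callTime) := by ring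
    have e5 : τ * (9000 * E.n + 505 * E.n) = 9505 * (E.n * τ) := by ring
    have e6 : E.n ≤ E.n * τ := Nat.le_mul_of_pos_right _ hτ
    omega

end

/-! ### Determinism and expected time -/

section

variable {w : ℕ}

theorem Exec.unique {p : Program} {σ σ₁ : State w} {T₁ : ℕ} (h₁ : Exec p σ T₁ σ₁) :
    ∀ {T₂ : ℕ} {σ₂ : State w}, Exec p σ T₂ σ₂ → T₁ = T₂ ∧ σ₁ = σ₂ := by
  induction h₁ with
  | instr e σ => intro T₂ σ₂ h; cases h; exact ⟨rfl, rfl⟩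
  | seq _ _ ih ih' =>
    intro T₂ σ₂ h
    cases h with
    | seq a b =>
      obtain ⟨rfl, rfl⟩ := ih a
      obtain ⟨rfl, rfl⟩ := ih' b
      exact ⟨rfl, rfl⟩
  | ite_true h0 _ ih =>
    intro T₂ σ₂ h
    cases h with
    | ite_true _ a => obtain ⟨rfl, rfl⟩ := ih a; exact ⟨rfl, rfl⟩
    | ite_false h1 _ => exact absurd h1 h0
  | ite_false h0 _ ih =>
    intro T₂ σ₂ h
    cases h with
    | ite_true h1 _ => exact absurd h0 h1
    | ite_false _ a => obtain ⟨rfl, rfl⟩ := ih a; exact ⟨rfl, rfl⟩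
  | loop_done h0 =>
    intro T₂ σ₂ h
    cases h with
    | loop_done _ => exact ⟨rfl, rfl⟩
    | loop_next h1 _ _ => exact absurd h0 h1
  | loop_next h0 _ _ ih ih' =>
    intro T₂ σ₂ h
    cases h with
    | loop_done h1 => exact absurd h1 h0
    | loop_next _ a b =>
      obtain ⟨rfl, rfl⟩ := ih a
      obtain ⟨rfl, rfl⟩ := ih' b
      exact ⟨rfl, rfl⟩

/-- A worst-case bound for all sequences of random words is a bound for the expectation. -/
theorem runsWithinExpected_of_forall {p : Program} {σ : State w} {T S : ℕ} {R : List ℕ → Prop}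
    (h : ∀ ω, RunsWithin p { σ with tape := ω } T S R) : RunsWithinExpected p σ T S R := by
  constructor
  · have : IsProbabilityMeasure (randomTape w) := by unfold randomTape; infer_instance
    calc expectedTime p σ ≤ ∫⁻ _, (T : ℝ≥0∞) ∂(randomTape w) := by
          refine lintegral_mono fun ω => ?_
          obtain ⟨T', σ', he, hT, -⟩ := h ω
          have h1 : runTime p { σ with tape := ω } ≤ (T' : ℕ∞) := iInf₂_le T' ⟨σ', he⟩
          have h2 : runTime p { σ with tape := ω } ≤ (T : ℕ∞) :=
            h1.trans (by exact_mod_cast hT)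
          simpa using ENat.toENNReal_mono h2
      _ = T := by simp
  · intro ω T' σ' he
    obtain ⟨T'', σ'', he', -, hS, hR⟩ := h ω
    obtain ⟨-, rfl⟩ := he.unique he'
    exact ⟨hS, hR⟩

theorem RunsWithin.mono {p : Program} {σ : State w} {T S T' S' : ℕ} {R : List ℕ → Prop}
    (h : RunsWithin p σ T S R) (hT : T ≤ T') (hS : S ≤ S') : RunsWithin p σ T' S' R := by
  obtain ⟨U, σ', h1, h2, h3, h4⟩ := h
  exact ⟨U, σ', h1, h2.trans hT, h3.trans hS, h4⟩

/-! ### Sizes -/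

/-- The number of elements of each array, apart from the space for a converted compressed string. -/
def arraySize (n m k τ occ S : ℕ) : ℕ := 2 * (m + k) + (n / τ + 1) + occ + S + 2

theorem le_word {n m S κ : ℕ} (hn : 0 < n) (hm : 0 < m)
    (hw : (n + m + S + 1) ^ (2 * κ + 12) ≤ 2 ^ w) :
    (∀ x ≤ 5 * m, x ^ κ ≤ 2 ^ w) ∧ 1000 * ((n + m + S + 1) * (n + m + S + 1)) ≤ 2 ^ w := by
  obtain ⟨X, hX⟩ : ∃ X, X = n + m + S + 1 := ⟨_, rfl⟩
  rw [← hX] at hw ⊢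
  constructor
  · intro x hx
    have h1 : x ≤ X ^ 2 := by
      have : m + 2 ≤ X := by omega
      nlinarith
    calc x ^ κ ≤ (X ^ 2) ^ κ := Nat.pow_le_pow_left h1 κ
      _ = X ^ (2 * κ) := (pow_mul X 2 κ).symm
      _ ≤ X ^ (2 * κ + 12) := Nat.pow_le_pow_right (by omega) (by omega)
      _ ≤ 2 ^ w := hw
  · calc 1000 * (X * X) ≤ 3 ^ 10 * (X * X) := Nat.mul_le_mul_right _ (by norm_num)
      _ ≤ X ^ 10 * (X * X) := Nat.mul_le_mul_right _ (Nat.pow_le_pow_left (by omega) 10)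
      _ = X ^ 12 := by ring
      _ ≤ X ^ (2 * κ + 12) := Nat.pow_le_pow_right (by omega) (by omega)
      _ ≤ 2 ^ w := hw

theorem arraySize_room {n m k τ occ S κ x : ℕ} (hn : 0 < n) (hk : k < m) (ho : occ ≤ n * n)
    (hw : (n + m + S + 1) ^ (2 * κ + 12) ≤ 2 ^ w) (hx : x ≤ n) :
    32 * (arraySize n m k τ occ S + x) ≤ 2 ^ w := by
  have h := (le_word hn (by omega) hw).2
  have hd : n / τ ≤ n := Nat.div_le_self n τ
  have h1 : (n + m + S + 1) * (n + m + S + 1) =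
    n * n + 2 * n + 2 * m + 2 * S + 1 + (m + S) * (2 * n + m + S) := by ring
  simp only [arraySize]
  generalize (m + S) * (2 * n + m + S) = y at *
  omega

namespace Env

variable {E : Env w}

theorem card_matchSet_le (E : Env w) :
    (matchSet E.k E.P (E.textTo E.n)).card ≤ E.n * E.n := by
  refine (Finset.card_le_card (matchSet_subset _ _ _)).trans ?_
  simpa using E.textTo_length_le E.n

theorem Fits.roomy (hE : E.Fits) (hwf : E.Wf) (hvis : 16 ≤ E.vis) (hn : 0 < E.n)
    {τ S κ : ℕ} (hL : arraySize E.n E.P.length E.k τ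
      (matchSet E.k E.P (E.textTo E.n)).card S ≤ E.L)
    (hw : (E.n + E.P.length + S + 1) ^ (2 * κ + 12) ≤ 2 ^ w) : E.Roomy (E.n / τ + 1) := by
  have hk := hwf.k_lt
  have hD : E.D = E.P.length + E.k := rfl
  have h := (le_word hn (by omega) hw).2
  have hd : E.n / τ ≤ E.n := Nat.div_le_self E.n τ
  have hd0 : 0 ≤ E.n / τ := Nat.zero_le _
  have h1 : (E.n + E.P.length + S + 1) * (E.n + E.P.length + S + 1) =
    E.n * E.n + 2 * E.n + 2 * E.P.length + 2 * S + 1 +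
      (E.P.length + S) * (2 * E.n + E.P.length + S) := by ring
  have h2 : (E.n + 1) * (E.n + 1) = E.n * E.n + 2 * E.n + 1 := by ring
  have hf : E.flags E.n ≤ _ := E.flags_le_card
  simp only [arraySize] at hL
  generalize (E.P.length + S) * (2 * E.n + E.P.length + S) = y at *
  exact ⟨hE, hwf, hvis, by omega, by omega, by omega, by omega, by omega⟩

theorem calls {A : Program} {κ : ℕ} {t s : ℕ → ℕ → ℕ → ℕ} (hA : SolvesMatching A κ t s)
    (hk : E.k < E.P.length) (hw : ∀ x ≤ 5 * E.P.length, x ^ κ ≤ 2 ^ w) {pat : ℕ}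
    (hpat : ∀ (i : ℕ) (hi : i < E.P.length), E.inp pat (BitVec.ofNat w i) = E.P[i])
    (hvis : 4 ≤ E.vis) {S T : ℕ} (hS : S = s E.P.length (2 * E.P.length + 2 * E.k) E.k)
    (hT : T = t E.P.length (2 * E.P.length + 2 * E.k) E.k)
    (hL : 2 * E.P.length + 2 * E.k + S ≤ E.L) (ht : 5 * T + 10 ≤ E.callTime) :
    E.Calls A pat S T := by
  refine ⟨by omega, by omega, hvis, hpat, ht, fun U hU ρ hρ => ?_⟩
  have := hA w E.P U E.k hk (hw _ (by omega)) ρ hρ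
  rwa [hU, ← hS, ← hT] at this

end Env

theorem ListsExactly.length_eq {l : List ℕ} {F : Finset ℕ} (h : ListsExactly l F) :
    l.length = F.card := by
  rw [← h.2, List.toFinset_card_of_nodup h.1]

/-! ### Compressed strings in the input -/

/-- The state of the structured language that `σ` represents, if all arrays are visible. -/
def State.toVS (σ : State w) : VS where
  reg r := (σ.reg (4 * r)).toNat
  arr a i := (σ.mem (cell w a i)).toNat
  out := σ.output.map BitVec.toNat
  time := 0

theorem State.represents_toVS {E : Env w} {σ : State w} (hvis : E.vis = 32)
    (hinp : σ.input = E.inp) (hs : σ.space = 0) : Represents E σ σ.toVS :=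
  ⟨fun _ => rfl, fun _ _ _ _ => rfl, fun _ h1 h2 => by omega, rfl, by omega, hinp⟩

/-- Moves the numbers in the registers `1, …, 4` to the variables `1, …, 4`. -/
def moveArguments : Program :=
  code (.op .or 16 4 4) [.op .or 12 3 3, .op .or 8 2 2, .op .or 4 1 1]

theorem exec_moveArguments (σ : State w) : ∃ σ', Exec moveArguments σ 4 σ' ∧
    (∀ r ≤ 4, σ'.reg (4 * r) = σ.reg r) ∧ σ'.input = σ.input ∧ σ'.output = σ.output ∧
    σ'.space = σ.space := by
  refine ⟨_, exec_code _ _ _, fun r hr => ?_, rfl, rfl, rfl⟩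
  interval_cases r <;> simp [Instr.step, WordOp.eval]

theorem ofNat_toNat_lt {x : ℕ} (h : x < 2 ^ w) : (BitVec.ofNat w x).toNat = x := by
  rw [BitVec.toNat_ofNat, Nat.mod_eq_of_lt h]

theorem Env.textTo_eq_flatten (E : Env w) (i : ℕ) :
    E.textTo i = ((List.range i).map fun j => E.str (j + 1)).flatten := by
  induction i with
  | zero => rfl
  | succ i ih => rw [Env.textTo, ih, List.range_succ]; simp

/-- The environment for a ZL78 compressed string in the input. -/
def ZL78.env (Z : ZL78 (BitVec w)) (P : List (BitVec w)) (k : ℕ) (σ : State w) (L callTime : ℕ) :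
    Env w where
  L := L
  vis := 32
  stored := false
  n := Z.n
  ref i := if h : i < Z.n then Z.ref ⟨i, h⟩ else 0
  chr i := if h : i < Z.n then (Z.label ⟨i, h⟩).toNat else 0
  inp := σ.input
  hid _ _ := 0
  P := P
  k := k
  callTime := callTime

section

variable (Z : ZL78 (BitVec w)) (P : List (BitVec w)) (k : ℕ) (σ : State w) (L callTime : ℕ)

theorem ZL78.wf_env (hk : k < P.length) : (Z.env P k σ L callTime).Wf := by
  refine ⟨fun i hi => ?_, fun i hi => ?_, hk⟩
  · change i < Z.n at hi
    simp only [ZL78.env, hi, dif_pos]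
    exact Z.ref_le ⟨i, hi⟩
  · change i < Z.n at hi
    simp only [ZL78.env, hi, dif_pos]
    exact BitVec.isLt _

theorem ZL78.str_env (i : ℕ) (h : i ≤ Z.n) : (Z.env P k σ L callTime).str i = Z.phrase i h := by
  induction i using Nat.strong_induction_on with
  | _ i ih =>
    cases i with
    | zero => simp [ZL78.phrase]
    | succ i =>
      have hi : i < Z.n := h
      have hr := Z.ref_le ⟨i, hi⟩
      have hpar : (Z.env P k σ L callTime).par (i + 1) = Z.ref ⟨i, hi⟩ := by
        simp only [Env.par, ZL78.env, Nat.add_sub_cancel, hi, dif_pos]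
        exact min_eq_left hr
      rw [Env.str_of_ne (by omega), hpar, ih _ (Nat.lt_succ_of_le hr) (by omega), ZL78.phrase]
      congr 2
      simp [Env.letter, ZL78.env, hi]

theorem ZL78.textTo_env : (Z.env P k σ L callTime).textTo Z.n = Z.text := by
  rw [Env.textTo_eq_flatten, ZL78.text]
  congr 1
  refine List.ext_getElem (by simp) fun i h1 h2 => ?_
  simpa using Z.str_env P k σ L callTime (i + 1) (by simpa using h2)

end

/-- The program for ZL78 compressed strings. -/
def searchZL78 (A : Program) : Program := .seq moveArguments (search.compile false A 2 0)

theorem runsWithin_searchZL78 {A : Program} {κ : ℕ} {t s : ℕ → ℕ → ℕ → ℕ}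
    (hA : SolvesMatching A κ t s) (Z : ZL78 (BitVec w)) (P : List (BitVec w)) {k τ S occ : ℕ}
    (hn : 0 < Z.n) (hk : k < P.length) (hτ : 1 ≤ τ) (hτw : τ < 2 ^ w)
    (hS : S = s P.length (2 * P.length + 2 * k) k) (hocc : occ = (matchSet k P Z.text).card)
    (hw : (Z.n + P.length + S + 1) ^ (2 * κ + 12) ≤ 2 ^ w) {σ : State w}
    (hσ : Loaded σ [Z.n, P.length, k, τ] (Z.arrays ++ [P])) :
    RunsWithin (searchZL78 A) σ
      (1000000 * (Z.n * (τ + P.length + t P.length (2 * P.length + 2 * k) k) + occ))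
      (1000000 * (Z.n / τ + P.length + S + occ)) fun l => ListsExactly l (matchSet k P Z.text) := by
  obtain ⟨hout, hspace, hreg, hinp⟩ := hσ
  obtain ⟨T, hT⟩ : ∃ T, T = t P.length (2 * P.length + 2 * k) k := ⟨_, rfl⟩
  rw [← hT]
  obtain ⟨hwκ, hww⟩ := le_word hn (by omega) hw
  have hd : 0 ≤ Z.n / τ := Nat.zero_le _
  have hwx : Z.n + P.length + S + 1 ≤ (Z.n + P.length + S + 1) * (Z.n + P.length + S + 1) :=
    Nat.le_mul_self _
  obtain ⟨E, hE⟩ : ∃ E, E = Z.env P k σ (arraySize Z.n P.length k τ occ S) (5 * T + 10) :=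
    ⟨_, rfl⟩
  have htext : E.textTo Z.n = Z.text := by rw [hE]; exact Z.textTo_env ..
  have hEn : E.n = Z.n := by rw [hE]; rfl
  have hEP : E.P = P := by rw [hE]; rfl
  have hEk : E.k = k := by rw [hE]; rfl
  have hEL : E.L = arraySize Z.n P.length k τ occ S := by rw [hE]; rfl
  have hEv : E.vis = 32 := by rw [hE]; rfl
  have hEs : E.stored = false := by rw [hE]; rfl
  have hEi : E.inp = σ.input := by rw [hE]; rfl
  have hEc : E.callTime = 5 * T + 10 := by rw [hE]; rfl
  have hEcard : (matchSet E.k E.P (E.textTo E.n)).card = occ := by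
    rw [hEk, hEP, hEn, htext, hocc]
  have hocc' : occ ≤ Z.n * Z.n := by
    have := E.card_matchSet_le
    rwa [hEcard, hEn] at this
  have hroom := arraySize_room (τ := τ) (x := 0) hn hk hocc' hw (by omega)
  have hin0 : ∀ (i : ℕ) (h : i < Z.n), σ.input 0 (BitVec.ofNat w i) =
      BitVec.ofNat w (Z.ref ⟨i, h⟩) := by
    intro i h
    simpa [ZL78.arrays] using hinp 0 (by simp) i (by simpa [ZL78.arrays] using h)
  have hin1 : ∀ (i : ℕ) (h : i < Z.n), σ.input 1 (BitVec.ofNat w i) = Z.label ⟨i, h⟩ := by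
    intro i h
    simpa [ZL78.arrays] using hinp 1 (by simp [ZL78.arrays]) i (by simpa [ZL78.arrays] using h)
  have hin2 : ∀ (i : ℕ) (h : i < P.length), σ.input 2 (BitVec.ofNat w i) = P[i] := by
    intro i h
    simpa [ZL78.arrays] using hinp 2 (by simp [ZL78.arrays]) i (by simpa [ZL78.arrays] using h)
  have hfits : E.Fits := by
    refine ⟨by rw [hEL, arraySize]; omega, by rw [hEL]; simpa using hroom, by omega,
      by simp [hEs], by simp [hEs], by simp [hEs], by simp [hEs], ?_, ?_⟩
    · intro _ i hi
      rw [hEn] at hi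
      have hr := Z.ref_le ⟨i, hi⟩
      rw [hEi, hin0 i hi, ofNat_toNat_lt (by simp only at hr; omega), hE]
      simp [ZL78.env, hi]
    · intro _ i hi
      rw [hEn] at hi
      rw [hEi, hin1 i hi, hE]
      simp [ZL78.env, hi]
  have hwf : E.Wf := by rw [hE]; exact Z.wf_env _ _ _ _ _ hk
  have hroomy : E.Roomy (E.n / τ + 1) := hfits.roomy hwf (by omega) (by omega) (S := S)
    (κ := κ) (by rw [hEcard, hEn, hEP, hEk, hEL]) (by rw [hEn, hEP]; exact hw)
  have hcalls := E.calls hA hwf.k_lt (by rw [hEP]; exact hwκ) (pat := 2)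
    (by rw [hEi]; simp only [hEP]; exact hin2) (by omega) (S := S) (T := T)
    (by rw [hEP, hEk, hS]) (by rw [hEP, hEk, hT])
    (by rw [hEP, hEk, hEL, arraySize]; omega) (by rw [hEc])
  obtain ⟨σ₁, hex₁, hreg₁, hinp₁, hout₁, hspace₁⟩ := exec_moveArguments σ
  have hrep : Represents E σ₁ σ₁.toVS :=
    State.represents_toVS hEv (hinp₁.trans hEi.symm) (hspace₁.trans hspace)
  have hvar : ∀ r ≤ 4, σ₁.toVS.reg r = (σ.reg r).toNat := fun r hr => by
    rw [← hreg₁ r hr]; rfl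
  have hwp := wp_search (E := E) (v := σ₁.toVS) hτ hroomy (by omega)
    (by rw [hvar 0 (by decide), hreg 0 (by simp), hEn]; exact ofNat_toNat_lt (x := Z.n) (by omega))
    (by rw [hvar 1 (by decide), hreg 1 (by simp), hEP]
        exact ofNat_toNat_lt (x := P.length) (by omega))
    (by rw [hvar 2 (by decide), hreg 2 (by simp), hEk]; exact ofNat_toNat_lt (x := k) (by omega))
    (by rw [hvar 3 (by decide), hreg 3 (by simp)]; exact ofNat_toNat_lt hτw)
    (by simp [State.toVS, hout₁, hout])
  obtain ⟨T₂, σ₂, u, hex₂, hrep₂, htime, -, hlist, hu⟩ :=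
    Cmd.exec_compile hfits hcalls search 0 _ _ hwp σ₁ hrep
  rw [hEs] at hex₂
  rw [hEk, hEP, hEn, htext] at hlist
  have hlen := hlist.length_eq
  rw [← hocc] at hlen
  refine ⟨_, σ₂, hex₁.seq hex₂, ?_, ?_, by rw [hrep₂.out]; exact hlist⟩
  · have hD : E.D = P.length + k := by rw [Env.D, hEP, hEk]
    rw [hEn, hD, hEc, hlen] at hu
    have h0 : σ₁.toVS.time = 0 := rfl
    have h1 := Nat.mul_le_mul_left Z.n
      (show τ + (P.length + k) + (5 * T + 10) ≤ 12 * (τ + P.length + T) by omega)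
    have h2 : Z.n * (12 * (τ + P.length + T)) = 12 * (Z.n * (τ + P.length + T)) := by ring
    have h3 : 1 ≤ Z.n * (τ + P.length + T) := Nat.mul_pos hn (by omega)
    omega
  · have := hrep₂.space
    rw [hEL, arraySize] at this
    omega

end

/-! ### Conversion of ZLW to ZL78 compressed strings -/

namespace ZLW

theorem first_lt (Z : ZLW) (i : ℕ) (h : i < Z.n) : Z.first i h < Z.alph := by
  induction i using Nat.strong_induction_on with
  | _ i ih =>
    have h' : Z.code ⟨i, h⟩ < Z.alph + i := Z.code_lt ⟨i, h⟩
    rw [first]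
    split_ifs with hc
    · exact hc
    · exact ih _ (by omega) _

/-- The first character of the phrase number `i`, with a value beyond the last phrase. -/
def firstAt (Z : ZLW) (i : ℕ) : ℕ := if h : i < Z.n then Z.first i h else 0

/-- The reference of the phrase number `i`: the number of the prefix phrase, where 0 stands for the
empty phrase and the numbers of the phrases are shifted by one. -/
def refAt (Z : ZLW) (i : ℕ) : ℕ :=
  if h : i < Z.n then if Z.code ⟨i, h⟩ < Z.alph then 0 else Z.code ⟨i, h⟩ - Z.alph + 1 else 0

/-- The last character of the phrase number `i`. -/
def charAt (Z : ZLW) (i : ℕ) : ℕ :=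
  if h : i < Z.n then
    if Z.code ⟨i, h⟩ < Z.alph then Z.code ⟨i, h⟩ else Z.firstAt (Z.code ⟨i, h⟩ - Z.alph + 1)
  else 0

theorem firstAt_of_lt (Z : ZLW) {i : ℕ} (h : i < Z.n) (hc : Z.code ⟨i, h⟩ < Z.alph) :
    Z.firstAt i = Z.code ⟨i, h⟩ := by
  rw [firstAt, dif_pos h, first, dif_pos hc]

theorem firstAt_of_not_lt (Z : ZLW) {i : ℕ} (h : i < Z.n) (hc : ¬ Z.code ⟨i, h⟩ < Z.alph) :
    Z.firstAt i = Z.firstAt (Z.code ⟨i, h⟩ - Z.alph) := by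
  have h' : Z.code ⟨i, h⟩ < Z.alph + i := Z.code_lt ⟨i, h⟩
  rw [firstAt, dif_pos h, first, dif_neg hc, firstAt, dif_pos (by omega)]

theorem firstAt_le (Z : ZLW) (i : ℕ) : Z.firstAt i ≤ Z.alph := by
  rw [firstAt]
  split_ifs with h
  · exact (Z.first_lt i h).le
  · exact Nat.zero_le _

/-- The environment with the converted compressed string in the arrays `30` and `31`. -/
def env {w : ℕ} (Z : ZLW) (P : List (BitVec w)) (k : ℕ) (inp : ℕ → BitVec w → BitVec w)
    (hid : ℕ → ℕ → ℕ) (L callTime : ℕ) : Env w where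
  L := L
  vis := 30
  stored := true
  n := Z.n
  ref := Z.refAt
  chr := Z.charAt
  inp := inp
  hid := hid
  P := P
  k := k
  callTime := callTime

section

variable {w : ℕ} (Z : ZLW) (P : List (BitVec w)) (k : ℕ) (inp : ℕ → BitVec w → BitVec w)
  (hid : ℕ → ℕ → ℕ) (L callTime : ℕ)

theorem wf_env (hk : k < P.length) (hw : Z.alph + Z.n < 2 ^ w) :
    (Z.env P k inp hid L callTime).Wf := by
  refine ⟨fun i hi => ?_, fun i hi => ?_, hk⟩
  · change i < Z.n at hi
    have h' : Z.code ⟨i, hi⟩ < Z.alph + i := Z.code_lt ⟨i, hi⟩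
    change Z.refAt i ≤ i
    rw [refAt, dif_pos hi]
    split_ifs <;> omega
  · change i < Z.n at hi
    have h' : Z.code ⟨i, hi⟩ < Z.alph + i := Z.code_lt ⟨i, hi⟩
    have := Z.firstAt_le (Z.code ⟨i, hi⟩ - Z.alph + 1)
    change Z.charAt i < _
    rw [charAt, dif_pos hi]
    split_ifs <;> omega

theorem str_env (i : ℕ) (h : i < Z.n) :
    (Z.env P k inp hid L callTime).str (i + 1) = (Z.phrase i h).map (BitVec.ofNat w) := by
  induction i using Nat.strong_induction_on with
  | _ i ih =>
    have h' : Z.code ⟨i, h⟩ < Z.alph + i := Z.code_lt ⟨i, h⟩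
    have hpar : (Z.env P k inp hid L callTime).par (i + 1) = min (Z.refAt i) i := rfl
    have hlet : (Z.env P k inp hid L callTime).letter (i + 1) = BitVec.ofNat w (Z.charAt i) := rfl
    rw [Env.str_of_ne (by omega), hpar, hlet, refAt, charAt, dif_pos h, dif_pos h, phrase]
    by_cases hc : Z.code ⟨i, h⟩ < Z.alph
    · simp [hc]
    · rw [if_neg hc, if_neg hc, dif_neg hc, min_eq_left (by omega), ih _ (by omega) (by omega),
        firstAt, dif_pos (by omega)]
      simp

theorem textTo_env :
    (Z.env P k inp hid L callTime).textTo Z.n = Z.text.map (BitVec.ofNat w) := by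
  rw [Env.textTo_eq_flatten, text, List.map_flatten]
  congr 1
  refine List.ext_getElem (by simp) fun i h1 h2 => ?_
  simpa using Z.str_env P k inp hid L callTime i (by simpa using h2)

end

end ZLW

section

variable {w : ℕ} {E : Env w}

/-- Computes the references (array `30`) and characters (array `31`) of a ZLW compressed string,
whose codes are read as references. The array `29` holds the first characters of the phrases, and
the variable `4` the size of the alphabet. The first character of a phrase is stored before the last
one is determined, because a code may refer to the step immediately before. -/
def convert : Cmd :=
  .rep 15 (.var 0) (
    .set 20 (.ref (.var 15)) ;;
    .ite (.var 20 ≺ .var 4)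
      (.put 30 (.var 15) (.lit 0) ;; .put 29 (.var 15) (.var 20) ;; .put 31 (.var 15) (.var 20))
      (.set 20 (.var 20 ⊖ .var 4) ;; .put 30 (.var 15) (.var 20 ⊕ .lit 1) ;;
        .put 29 (.var 15) (.get 29 (.var 20)) ;;
        .put 31 (.var 15) (.get 29 (.var 20 ⊕ .lit 1))))

theorem wp_convert (Z : ZLW) (hvis : E.vis = 32) (hn : E.n = Z.n) (hL : E.n ≤ E.L)
    (hcode : ∀ (i : ℕ) (h : i < Z.n), E.ref i = Z.code ⟨i, h⟩) (hw : Z.alph + Z.n < 2 ^ w)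
    {v : VS} (h0 : v.reg 0 = Z.n) (h4 : v.reg 4 = Z.alph) :
    convert.wp E v fun u => Keeps [15, 20] [29, 30, 31] v u ∧
      u.time ≤ v.time + 100 * Z.n + 20 ∧
      ∀ i < Z.n, u.arr 30 i = Z.refAt i ∧ u.arr 31 i = Z.charAt i := by
  refine Cmd.wp_rep (fun j u => Keeps [15, 20] [29, 30, 31] v u ∧ u.time ≤ v.time + 100 * j + 20 ∧
      (∀ i < j, u.arr 29 i = Z.firstAt i) ∧
      ∀ i < j, u.arr 30 i = Z.refAt i ∧ u.arr 31 i = Z.charAt i) trivial ?_ ?_ ?_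
  · exact ⟨Keeps.mk' (.refl _ _ _) (fun _ _ => rfl) fun _ _ => rfl, by simp [Ex.cost],
      fun i hi => by omega, fun i hi => by omega⟩
  · rintro j hj u ⟨hk, ht, hfst, hres⟩
    simp only [Ex.eval, h0] at hj
    have r4 := hk.reg 4 (by decide)
    rw [h4] at r4
    have h' : Z.code ⟨j, hj⟩ < Z.alph + j := Z.code_lt ⟨j, hj⟩
    simp only [Cmd.wp, Ex.Safe, Ex.eval, BinOp.eval, BinOp.Safe, Ex.cost, Function.update_apply,
      Nat.reduceEqDiff, if_true, if_false, r4, hcode j hj, and_assoc, true_and, ne_eq]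
    repeat refine ⟨by omega, ?_⟩
    -- The entries before the current one remain.
    have hnew : ∀ x y z : ℕ → ℕ, (∀ i ≠ j, x i = u.arr 29 i ∧ y i = u.arr 30 i ∧
        z i = u.arr 31 i) → x j = Z.firstAt j → y j = Z.refAt j → z j = Z.charAt j →
        (∀ i < j + 1, x i = Z.firstAt i) ∧ ∀ i < j + 1, y i = Z.refAt i ∧ z i = Z.charAt i := by
      intro x y z hx hx1 hx2 hx3
      refine ⟨fun i hi => ?_, fun i hi => ?_⟩
      · by_cases hij : i = j
        · rw [hij, hx1]
        · rw [(hx i hij).1, hfst i (by omega)]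
      · by_cases hij : i = j
        · rw [hij, hx2, hx3]; exact ⟨rfl, rfl⟩
        · rw [(hx i hij).2.1, (hx i hij).2.2]; exact hres i (by omega)
    refine ⟨fun h => ?_, fun h => ?_⟩
    · have hc := of_ite_ne_zero h
      repeat refine ⟨by omega, ?_⟩
      refine ⟨hk.mk' ?_ ?_, by omega, hnew _ _ _ (fun i hi => by simp [hi]) ?_ ?_ ?_⟩
      · intro r hr; simp at hr; simp [hr]
      · intro r hr; simp at hr; simp [hr]
      · simp [Z.firstAt_of_lt hj hc]
      · simp [ZLW.refAt, hj, hc]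
      · simp [ZLW.charAt, hj, hc]
    · have hc := of_ite_eq_zero h
      have hf := Z.firstAt_of_not_lt hj hc
      have hf1 := hfst (Z.code ⟨j, hj⟩ - Z.alph) (by omega)
      repeat refine ⟨by omega, ?_⟩
      refine ⟨hk.mk' ?_ ?_, by omega, hnew _ _ _ (fun i hi => by simp [hi]) ?_ ?_ ?_⟩
      · intro r hr; simp at hr; simp [hr]
      · intro r hr; simp at hr; simp [hr]
      · simp [hf, hf1]
      · simp [ZLW.refAt, hj, hc]
      · by_cases hj1 : Z.code ⟨j, hj⟩ - Z.alph + 1 = j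
        · simp only [ZLW.charAt, hj, hc, dif_pos, if_false]
          simp [hj1, hf, hf1]
        · simp only [ZLW.charAt, hj, hc, dif_pos, if_false]
          simp [hj1, hfst (Z.code ⟨j, hj⟩ - Z.alph + 1) (by omega)]
  · rintro u ⟨h1, h2, -, h3⟩
    simp only [Ex.eval, h0] at *
    exact ⟨h1, h2, h3⟩

/-- The program for ZLW compressed strings. -/
def searchZLW (A : Program) : Program :=
  .seq moveArguments (.seq (convert.compile false A 1 0) (search.compile true A 1 0))

theorem runsWithin_searchZLW {A : Program} {κ : ℕ} {t s : ℕ → ℕ → ℕ → ℕ}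
    (hA : SolvesMatching A κ t s) (Z : ZLW) (P Q : List (BitVec w)) {k τ S occ : ℕ}
    (hn : 0 < Z.n) (hk : k < P.length) (hτ : 1 ≤ τ) (hτw : τ < 2 ^ w)
    (hS : S = s P.length (2 * P.length + 2 * k) k) (halph : Z.alph + Z.n < 2 ^ w)
    (hQ : Q = Z.text.map (BitVec.ofNat w)) (hocc : occ = (matchSet k P Q).card)
    (hw : (Z.n + P.length + S + 1) ^ (2 * κ + 12) ≤ 2 ^ w) {σ : State w}
    (hσ : Loaded σ [Z.n, P.length, k, τ, Z.alph] [Z.array w, P]) :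
    RunsWithin (searchZLW A) σ
      (1000000 * (Z.n * (τ + P.length + t P.length (2 * P.length + 2 * k) k) + occ))
      (1000000 * (Z.n / τ + P.length + S + occ + Z.n)) fun l =>
        ListsExactly l (matchSet k P Q) := by
  obtain ⟨hout, hspace, hreg, hinp⟩ := hσ
  obtain ⟨T, hT⟩ : ∃ T, T = t P.length (2 * P.length + 2 * k) k := ⟨_, rfl⟩
  rw [← hT]
  obtain ⟨hwκ, hww⟩ := le_word hn (by omega) hw
  have hd : 0 ≤ Z.n / τ := Nat.zero_le _
  have hwx : Z.n + P.length + S + 1 ≤ (Z.n + P.length + S + 1) * (Z.n + P.length + S + 1) :=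
    Nat.le_mul_self _
  obtain ⟨L, hL⟩ : ∃ L, L = arraySize Z.n P.length k τ occ S + Z.n := ⟨_, rfl⟩
  have hLl : 2 * (P.length + k) + S + Z.n + 2 ≤ L := by rw [hL, arraySize]; omega
  have hcard : ∀ hid, (matchSet k P ((Z.env P k σ.input hid L (5 * T + 10)).textTo Z.n)).card =
      occ := fun hid => by rw [Z.textTo_env, ← hQ, hocc]
  have hocc' : occ ≤ Z.n * Z.n := by
    rw [← hcard fun _ _ => 0]
    exact (Z.env P k σ.input (fun _ _ => 0) L (5 * T + 10)).card_matchSet_le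
  have hroom : 32 * L ≤ 2 ^ w := hL ▸ arraySize_room (τ := τ) hn hk hocc' hw le_rfl
  have hin0 : ∀ (i : ℕ) (h : i < Z.n), (σ.input 0 (BitVec.ofNat w i)).toNat = Z.code ⟨i, h⟩ := by
    intro i h
    have h' : Z.code ⟨i, h⟩ < Z.alph + i := Z.code_lt ⟨i, h⟩
    rw [← ofNat_toNat_lt (w := w) (show Z.code ⟨i, h⟩ < 2 ^ w by omega)]
    congr 1
    simpa [ZLW.array] using hinp 0 (by simp) i (by simpa [ZLW.array] using h)
  have hin1 : ∀ (i : ℕ) (h : i < P.length), σ.input 1 (BitVec.ofNat w i) = P[i] := by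
    intro i h
    simpa using hinp 1 (by simp) i (by simpa using h)
  -- The conversion reads the codes as references.
  obtain ⟨E, hE⟩ : ∃ E : Env w, E = ⟨L, 32, false, Z.n,
    fun i => (σ.input 0 (BitVec.ofNat w i)).toNat,
    fun i => (σ.input 1 (BitVec.ofNat w i)).toNat, σ.input, fun _ _ => 0, P, k, 5 * T + 10⟩ :=
    ⟨_, rfl⟩
  have hfits : E.Fits := by
    subst hE
    exact ⟨by simp only; omega, hroom, le_rfl, by simp, by simp, by simp, by simp,
      fun _ _ _ => rfl, fun _ _ _ => rfl⟩
  have hcalls : E.Calls A 1 S T := by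
    subst hE
    exact Env.calls hA hk hwκ hin1 (show 4 ≤ 32 by omega) hS hT
      (show 2 * P.length + 2 * k + S ≤ L by omega) le_rfl
  obtain ⟨σ₁, hex₁, hreg₁, hinp₁, hout₁, hspace₁⟩ := exec_moveArguments σ
  have hrep : Represents E σ₁ σ₁.toVS :=
    State.represents_toVS (by rw [hE]) (by rw [hinp₁, hE]) (hspace₁.trans hspace)
  have hvar : ∀ r ≤ 4, σ₁.toVS.reg r = (σ.reg r).toNat := fun r hr => by
    rw [← hreg₁ r hr]; rfl
  have hr0 : σ₁.toVS.reg 0 = Z.n := by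
    rw [hvar 0 (by decide), hreg 0 (by simp)]; exact ofNat_toNat_lt (x := Z.n) (by omega)
  have hr4 : σ₁.toVS.reg 4 = Z.alph := by
    rw [hvar 4 (by decide), hreg 4 (by simp)]; exact ofNat_toNat_lt (x := Z.alph) (by omega)
  have hconv := wp_convert (E := E) Z (by rw [hE]) (by rw [hE]) (by rw [hE]; simp only; omega)
    (by rw [hE]; exact hin0) halph hr0 hr4
  obtain ⟨T₂, σ₂, u, hex₂, hrep₂, htime₂, -, hk₂, hu₂, harr₂⟩ :=
    Cmd.exec_compile hfits hcalls convert 0 _ _ hconv σ₁ hrep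
  obtain ⟨F, hF⟩ : ∃ F, F = Z.env P k σ.input u.arr L (5 * T + 10) := ⟨_, rfl⟩
  have hEs : E.stored = false := by rw [hE]
  have hfitsF : F.Fits := by
    subst hF
    exact ⟨show 0 < L by omega, hroom, show 30 ≤ 32 by omega, fun _ => le_rfl,
      fun _ => show Z.n ≤ L by omega,
      fun _ i hi => ((harr₂ i hi).1).symm, fun _ i hi => ((harr₂ i hi).2).symm,
      fun h => absurd rfl h, fun h => absurd rfl h⟩
  have hwfF : F.Wf := by rw [hF]; exact Z.wf_env _ _ _ _ _ _ hk halph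
  have hcallsF : F.Calls A 1 S T := by
    subst hF
    exact Env.calls hA hk hwκ hin1 (show 4 ≤ 30 by omega) hS hT
      (show 2 * P.length + 2 * k + S ≤ L by omega) le_rfl
  have hroomy : F.Roomy (F.n / τ + 1) := by
    subst hF
    refine hfitsF.roomy hwfF (show 16 ≤ 30 by omega) hn (S := S) (κ := κ) ?_ hw
    change arraySize Z.n P.length k τ
      (matchSet k P ((Z.env P k σ.input u.arr L (5 * T + 10)).textTo Z.n)).card S ≤ L
    rw [hcard]; omega
  have hrepF : Represents F σ₂ u := by
    subst hF hE
    exact ⟨hrep₂.reg,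
      fun a ha i hi => hrep₂.arr a (show a < 32 from lt_trans ha (show 30 < 32 by omega)) i hi,
      fun a _ ha i hi => hrep₂.arr a ha i hi, hrep₂.out, hrep₂.space, hrep₂.inp⟩
  have hvu : ∀ r ≤ 4, u.reg r = (σ.reg r).toNat := fun r hr => by
    rw [← hvar r hr, hk₂.reg r (by simp; omega)]
  have hwp := wp_search (E := F) (v := u) hτ hroomy (by rw [hF]; exact hn)
    (by rw [hvu 0 (by decide), hreg 0 (by simp), hF]; exact ofNat_toNat_lt (x := Z.n) (by omega))
    (by rw [hvu 1 (by decide), hreg 1 (by simp), hF]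
        exact ofNat_toNat_lt (x := P.length) (by omega))
    (by rw [hvu 2 (by decide), hreg 2 (by simp), hF]; exact ofNat_toNat_lt (x := k) (by omega))
    (by rw [hvu 3 (by decide), hreg 3 (by simp)]; exact ofNat_toNat_lt hτw)
    (by rw [hk₂.out]; simp [State.toVS, hout₁, hout])
  obtain ⟨T₃, σ₃, x, hex₃, hrep₃, htime₃, -, hlist, hx⟩ :=
    Cmd.exec_compile hfitsF hcallsF search 0 _ _ hwp σ₂ hrepF
  rw [hEs] at hex₂
  have hlist : ListsExactly x.out (matchSet k P Q) := by
    rw [hF] at hlist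
    rw [hQ, ← Z.textTo_env P k σ.input u.arr L (5 * T + 10)]
    exact hlist
  have hFs : F.stored = true := by rw [hF]; rfl
  rw [hFs] at hex₃
  have hlen := hlist.length_eq
  rw [← hocc] at hlen
  refine ⟨_, σ₃, hex₁.seq (hex₂.seq hex₃), ?_, ?_, by rw [hrep₃.out]; exact hlist⟩
  · have hFn : F.n = Z.n := by rw [hF]; rfl
    have hFD : F.D = P.length + k := by rw [hF]; rfl
    have hFc : F.callTime = 5 * T + 10 := by rw [hF]; rfl
    rw [hFn, hFD, hFc, hlen] at hx
    have h0 : σ₁.toVS.time = 0 := rfl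
    have h1 := Nat.mul_le_mul_left Z.n
      (show τ + (P.length + k) + (5 * T + 10) ≤ 12 * (τ + P.length + T) by omega)
    have h2 : Z.n * (12 * (τ + P.length + T)) = 12 * (Z.n * (τ + P.length + T)) := by ring
    have h3 : Z.n ≤ Z.n * (τ + P.length + T) := Nat.le_mul_of_pos_right _ (by omega)
    omega
  · have h := hrep₃.space
    have hFL : F.L = L := by rw [hF]; rfl
    rw [hFL, hL, arraySize] at h
    omega

end

theorem theorem1 :
    ∃ c : ℕ, ∀ (A : Program) (κ : ℕ) (t s : ℕ → ℕ → ℕ → ℕ), SolvesMatching A κ t s →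
      -- ZL78, expected time
      (∃ (B : Program) (κ' : ℕ), ∀ (w : ℕ) (Z : ZL78 (BitVec w)) (P : List (BitVec w))
        (n m k τ T S occ : ℕ), n = Z.n → 0 < n → m = P.length → k < m → 1 ≤ τ → τ < 2 ^ w →
        T = t m (2 * m + 2 * k) k → S = s m (2 * m + 2 * k) k → occ = (matchSet k P Z.text).card →
        (n + m + S + 1) ^ κ' ≤ 2 ^ w →
        ∀ σ : State w, Loaded σ [n, m, k, τ] (Z.arrays ++ [P]) →
          RunsWithinExpected B σ (c * (n * (τ + m + T) + occ)) (c * (n / τ + m + S + occ))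
            fun l => ListsExactly l (matchSet k P Z.text)) ∧
      -- ZL78, worst-case time with `O(n)` additional space
      (∃ (B : Program) (κ' : ℕ), ∀ (w : ℕ) (Z : ZL78 (BitVec w)) (P : List (BitVec w))
        (n m k τ T S occ : ℕ), n = Z.n → 0 < n → m = P.length → k < m → 1 ≤ τ → τ < 2 ^ w →
        T = t m (2 * m + 2 * k) k → S = s m (2 * m + 2 * k) k → occ = (matchSet k P Z.text).card →
        (n + m + S + 1) ^ κ' ≤ 2 ^ w →
        ∀ σ : State w, Loaded σ [n, m, k, τ] (Z.arrays ++ [P]) →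
          RunsWithin B σ (c * (n * (τ + m + T) + occ)) (c * (n / τ + m + S + occ + n))
            fun l => ListsExactly l (matchSet k P Z.text)) ∧
      -- ZLW, worst-case time with `O(n)` additional space
      (∃ (B : Program) (κ' : ℕ), ∀ (w : ℕ) (Z : ZLW) (P Q : List (BitVec w))
        (n m k τ T S occ : ℕ), n = Z.n → 0 < n → m = P.length → k < m → 1 ≤ τ → τ < 2 ^ w →
        T = t m (2 * m + 2 * k) k → S = s m (2 * m + 2 * k) k →
        Z.alph + n < 2 ^ w → Q = Z.text.map (BitVec.ofNat w) → occ = (matchSet k P Q).card →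
        (n + m + S + 1) ^ κ' ≤ 2 ^ w →
        ∀ σ : State w, Loaded σ [n, m, k, τ, Z.alph] [Z.array w, P] →
          RunsWithin B σ (c * (n * (τ + m + T) + occ)) (c * (n / τ + m + S + occ + n))
            fun l => ListsExactly l (matchSet k P Q)) := by
  refine ⟨1000000, fun A κ t s hA => ⟨⟨searchZL78 A, 2 * κ + 12, ?_⟩,
    ⟨searchZL78 A, 2 * κ + 12, ?_⟩, ⟨searchZLW A, 2 * κ + 12, ?_⟩⟩⟩
  · rintro w Z P n m k τ T S occ rfl hn rfl hk hτ hτw rfl hS hocc hw σ hσ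
    exact runsWithinExpected_of_forall fun ω =>
      runsWithin_searchZL78 hA Z P hn hk hτ hτw hS hocc hw hσ
  · rintro w Z P n m k τ T S occ rfl hn rfl hk hτ hτw rfl hS hocc hw σ hσ
    exact (runsWithin_searchZL78 hA Z P hn hk hτ hτw hS hocc hw hσ).mono le_rfl
      (Nat.mul_le_mul_left _ (Nat.le_add_right _ _))
  · rintro w Z P Q n m k τ T S occ rfl hn rfl hk hτ hτw rfl hS halph hQ hocc hw σ hσ
    exact runsWithin_searchZLW hA Z P Q hn hk hτ hτw hS halph hQ hocc hw hσ
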